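/- **Proposition.** A two-state spin system on a finite simple graph $G=(V,E)$ with edge parameters $\beta,\gamma$ and uniform external field $\lambda$ has partition function $$Z_{\beta,\gamma,\lambda}(G)=\sum_{\sigma:V\to\{0,1\}}\beta^{m_0(\sigma)}\,\gamma^{m_1(\sigma)}\,\lambda^{|\{v\in V:\ \sigma(v)=0\}|},$$ where $m_s(\sigma)$ is the number of edges both of whose endpoints have spin $s$. Let $\mathrm{Spin}(\beta,\gamma,\lambda)$ be the problem of computing $Z_{\beta,\gamma,\lambda}(G)$ for a given finite graph $G$ (encoded by its adjacency matrix), the parameters $\beta,\gamma,\lambda$ being fixed. It has an FPTAS if there are one deterministic algorithm and one polynomial $p$ such that for every graph $G$ and every rational $\varepsilon>0$ the algorithm, on input $(G,\varepsilon)$, outputs a rational number $\widehat Z$ (as numerator and denominator in binary) with $|\widehat Z-Z_{\beta,\gamma,\lambda}(G)|\le\varepsilon\, Z_{\beta,\gamma,\lambda}(G)$ in time at most $p(s+\lceil 1/\varepsilon\rceil)$, where $s$ is the bit length of the input $(G,\varepsilon)$ and time is counted with logarithmic (bit) cost. Let $\beta=0.6$, $\gamma=2$ and $\lambda=1002762$,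 and put $$\Delta_c=\frac{\sqrt{\beta\gamma}+1}{\sqrt{\beta\gamma}-1},\qquad \lambda_c=\left(\frac{\gamma}{\beta}\right)^{\frac{\Delta_c+1}{2}}.$$ Then $\lambda>\lambda_c$, and $\mathrm{Spin}(\beta,\gamma,\lambda)$ has an FPTAS. -/

import Mathlib

/-! Two-state spin systems. -/

namespace TwoSpin

/-- The number of edges of `G` both of whose endpoints have spin `s` under `σ`. -/
noncomputable def monoEdges {V : Type*} [Fintype V] (G : SimpleGraph V) (σ : V → Fin 2)
    (s : Fin 2) : ℕ :=
  {e : Sym2 V | e ∈ G.edgeSet ∧ ∀ v ∈ e, σ v = s}.ncard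

/-- The weight `β ^ m₀(σ) * γ ^ m₁(σ) * ∏_{v : σ v = 0} π v`. -/
noncomputable def weight {V : Type*} [Fintype V] (β γ : ℝ) (π : V → ℝ) (G : SimpleGraph V)
    (σ : V → Fin 2) : ℝ :=
  β ^ monoEdges G σ 0 * γ ^ monoEdges G σ 1 * ∏ v, (if σ v = 0 then π v else 1)

open Classical in
/-- The partition function `Z_{β,γ,π}(G) = ∑_{σ : V → {0,1}} w(σ)`. -/
noncomputable def partitionFunction {V : Type*} [Fintype V] (β γ : ℝ) (π : V → ℝ)
    (G : SimpleGraph V) : ℝ :=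
  ∑ σ : V → Fin 2, weight β γ π G σ

/-- The critical degree `Δ_c = (√(βγ) + 1) / (√(βγ) - 1)`. -/
noncomputable def criticalDegree (β γ : ℝ) : ℝ :=
  (Real.sqrt (β * γ) + 1) / (Real.sqrt (β * γ) - 1)

/-- The critical field `λ_c = (γ / β) ^ ((Δ_c + 1) / 2)`. -/
noncomputable def criticalField (β γ : ℝ) : ℝ :=
  (γ / β) ^ ((criticalDegree β γ + 1) / 2)

end TwoSpin

/-! The machine model: deterministic loop programs on binary trees whose leaves carry natural
numbers, with logarithmic (bit) cost. Every step is charged the total bit length of the data it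
acts on, and no step makes data longer than what has been paid for, so that this model and
multitape Turing machines simulate each other with polynomial overhead. -/

namespace LoopMachine

/-- Data: binary trees with natural numbers at the leaves. -/
inductive Data where
  | atom (n : ℕ) : Data
  | pair (x y : Data) : Data

namespace Data

/-- The length of a datum: numbers are measured by their number of binary digits. -/
def size : Data → ℕ
  | atom n => Nat.size n + 1
  | pair x y => x.size + y.size + 1

/-- A list as a right comb of pairs, ended by the leaf `0`. -/
def ofList : List Data → Data
  | [] => atom 0
  | x :: l => pair x (ofList l)

end Data

open Data

/-- The primitive operations. -/
inductive Prim where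
  | id | fst | snd | isPair | add | sub | mul | div

/-- The result of a primitive operation. The arithmetical ones act on a pair of numbers
(`sub` is truncated subtraction, `div` is division with rounding down). Where an operation makes
no sense the result is the leaf `0`. -/
def Prim.apply : Prim → Data → Data
  | .id, x => x
  | .fst, .pair x _ => x
  | .snd, .pair _ y => y
  | .isPair, .pair _ _ => .atom 1
  | .add, .pair (.atom a) (.atom b) => .atom (a + b)
  | .sub, .pair (.atom a) (.atom b) => .atom (a - b)
  | .mul, .pair (.atom a) (.atom b) => .atom (a * b)
  | .div, .pair (.atom a) (.atom b) => .atom (a / b)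
  | _, _ => .atom 0

/-- Programs. Each one transforms the current datum. -/
inductive Prog where
  /-- a primitive operation -/
  | prim (o : Prim) : Prog
  /-- replace the current datum by a constant -/
  | const (c : Data) : Prog
  /-- run both programs on the current datum and pair the results -/
  | pair (p q : Prog) : Prog
  /-- run `p`, then `q` on its result -/
  | seq (p q : Prog) : Prog
  /-- test the current datum with `c`; then run `p` if the test does not give the leaf `0`,
  and `q` if it does -/
  | ite (c p q : Prog) : Prog
  /-- while the test `c` does not give the leaf `0`, replace the current datum by what `p`
  makes of it -/
  | loop (c p : Prog) : Prog

/-- `Run p x y t`: started on `x`, the program `p` halts with result `y` at total cost `t`. Each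
time a program construct is executed it costs one plus the length of the current datum (and, for
a constant, the length of that constant). -/
inductive Run : Prog → Data → Data → ℕ → Prop where
  | prim (o : Prim) (x : Data) : Run (.prim o) x (o.apply x) (1 + x.size)
  | const (c x : Data) : Run (.const c) x c (1 + x.size + c.size)
  | pair {p q : Prog} {x y z : Data} {s t : ℕ} : Run p x y s → Run q x z t →
      Run (.pair p q) x (.pair y z) (1 + x.size + s + t)
  | seq {p q : Prog} {x y z : Data} {s t : ℕ} : Run p x y s → Run q y z t →
      Run (.seq p q) x z (1 + x.size + s + t)
  | ite_true {c p q : Prog} {x b y : Data} {s t : ℕ} : Run c x b s → b ≠ .atom 0 →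
      Run p x y t → Run (.ite c p q) x y (1 + x.size + s + t)
  | ite_false {c p q : Prog} {x y : Data} {s t : ℕ} : Run c x (.atom 0) s →
      Run q x y t → Run (.ite c p q) x y (1 + x.size + s + t)
  | loop_stop {c p : Prog} {x : Data} {s : ℕ} : Run c x (.atom 0) s →
      Run (.loop c p) x x (1 + x.size + s)
  | loop_step {c p : Prog} {x b y z : Data} {s t u : ℕ} : Run c x b s → b ≠ .atom 0 →
      Run p x y t → Run (.loop c p) y z u → Run (.loop c p) x z (1 + x.size + s + t + u)

/-- The model is deterministic: result and cost of a halting run are unique. -/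
theorem Run.unique {p : Prog} {x y y' : Data} {t t' : ℕ} (h : Run p x y t)
    (h' : Run p x y' t') : y = y' ∧ t = t' := by
  induction h generalizing y' t' with
  | prim o x => cases h'; exact ⟨rfl, rfl⟩
  | const c x => cases h'; exact ⟨rfl, rfl⟩
  | pair _ _ ih1 ih2 =>
    cases h' with
    | pair a b =>
      obtain ⟨rfl, rfl⟩ := ih1 a
      obtain ⟨rfl, rfl⟩ := ih2 b
      exact ⟨rfl, rfl⟩
  | seq _ _ ih1 ih2 =>
    cases h' with
    | seq a b =>
      obtain ⟨rfl, rfl⟩ := ih1 a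
      obtain ⟨rfl, rfl⟩ := ih2 b
      exact ⟨rfl, rfl⟩
  | ite_true _ hb _ ih1 ih2 =>
    cases h' with
    | ite_true a _ b =>
      obtain ⟨rfl, rfl⟩ := ih1 a
      obtain ⟨rfl, rfl⟩ := ih2 b
      exact ⟨rfl, rfl⟩
    | ite_false a b => exact absurd (ih1 a).1 hb
  | ite_false _ _ ih1 ih2 =>
    cases h' with
    | ite_true a hb b => exact absurd (ih1 a).1.symm hb
    | ite_false a b =>
      obtain ⟨_, rfl⟩ := ih1 a
      obtain ⟨rfl, rfl⟩ := ih2 b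
      exact ⟨rfl, rfl⟩
  | loop_stop _ ih =>
    cases h' with
    | loop_stop a =>
      obtain ⟨_, rfl⟩ := ih a
      exact ⟨rfl, rfl⟩
    | loop_step a hb _ _ => exact absurd (ih a).1.symm hb
  | loop_step _ hb _ _ ih1 ih2 ih3 =>
    cases h' with
    | loop_stop a => exact absurd (ih1 a).1 hb
    | loop_step a _ b c =>
      obtain ⟨rfl, rfl⟩ := ih1 a
      obtain ⟨rfl, rfl⟩ := ih2 b
      obtain ⟨rfl, rfl⟩ := ih3 c
      exact ⟨rfl, rfl⟩

/-- A counting problem: instances, their encoding as machine inputs, and the real number that is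
asked for. -/
structure CountingProblem where
  /-- the instances -/
  Instance : Type
  /-- the encoding of instances -/
  encode : Instance → Data
  /-- the quantity to be computed -/
  value : Instance → ℝ

/-- The machine input for an instance and an accuracy `ε` (a positive rational number, given by
numerator and denominator in binary). -/
def CountingProblem.input (P : CountingProblem) (x : P.Instance) (ε : ℚ) : Data :=
  .pair (P.encode x) (.pair (.atom ε.num.toNat) (.atom ε.den))

/-- A fully polynomial-time approximation scheme: one deterministic program which, for every
instance `x` and every rational `ε > 0`, outputs a fraction `a / b` that approximates the value
of `x` within relative error `ε`, in time polynomial in the input length and `1 / ε`. -/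
def CountingProblem.HasFPTAS (P : CountingProblem) : Prop :=
  ∃ (A : Prog) (p : Polynomial ℕ), ∀ (x : P.Instance) (ε : ℚ), 0 < ε →
    ∃ a b t : ℕ, Run A (P.input x ε) (.pair (.atom a) (.atom b)) t ∧
      t ≤ p.eval ((P.input x ε).size + ⌈1 / ε⌉₊) ∧
      0 < b ∧ |(a : ℝ) / (b : ℝ) - P.value x| ≤ (ε : ℝ) * P.value x

open Classical in
/-- A graph on the vertices `0, …, n - 1` is encoded by its adjacency matrix, as the list of its
rows, each of which is a list of `n` entries `0` or `1`. -/
noncomputable def encodeGraph {n : ℕ} (G : SimpleGraph (Fin n)) : Data :=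
  .ofList ((List.finRange n).map fun i =>
    .ofList ((List.finRange n).map fun j => .atom (if G.Adj i j then 1 else 0)))

/-- The problem `Spin(β, γ, l)`: given a finite graph, compute its partition function with edge
parameters `β`, `γ` and the uniform field `l`. -/
noncomputable def spinProblem (β γ l : ℝ) : CountingProblem where
  Instance := Σ n : ℕ, SimpleGraph (Fin n)
  encode := fun G => encodeGraph G.2
  value := fun G => TwoSpin.partitionFunction β γ (fun _ => l) G.2

end LoopMachine

/-! The algorithm rests on correlation decay. After division by 2^|E|, the set S of vertices of spin
0 has weight ∏_{v∈S} λ/2^{deg v} · (βγ)^{e(S)}. Deleting the vertices one by one turns the sum of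
these weights into a product of terms 1 + ratio (`subsetSum_eq_prod`). A ratio is in turn a product
over the neighbours of functions of their ratios after further deletions (`ratio_eq_prod`).
Unfolding this recursion completely takes exponential time. It is therefore cut off by a budget that
is divided by 2·deg at every vertex, which leaves a tree of polynomial size.

The cut-off is harmless because the recursion contracts. In the original scale it reads F = λ ∏
(3x_i/5 + 1)/(x_i + 2), and log F has partial derivatives of modulus `sensitivity` in log x_i. In
the metric with density log λ - log x, non-expansion follows by summing sensitivity(x)·(log λ - log
x) ≤ logFactor(x). This holds for all x exactly up to λ_c, where it is an equality at x = √(γ/β) =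
√(10/3). Here λ is slightly larger, so the inequality fails near that point.

For a failure in the sum, however, all x_i and F would have to be close to √(10/3), hence the number
of neighbours close to Δ_c ≈ 21.954, which is not an integer. Adding `deviation`, which grows at
least quadratically in the distance of log x from log √(10/3), to the density makes this
quantitative. The squares gained at the arguments and at F outweigh the loss for every integer
degree (`degree_gap`), leaving a constant additive gain (`sum_density_add_le`). Since the density is
bounded in bounded degree and exponentially large in large degree, this becomes a multiplicative
gain (2(D+1))^{1/k} (`exists_rate`), which is what one division of the budget costs.

The truncated and the true value are joined by a path (`interp`). The contraction bounds its
derivative by O((B+1)^{-1/k}) (`interp_deriv`), so a budget polynomial in n and 1/ε suffices. The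
recursion is run by a loop with an explicit stack, and a potential that decreases in every step
bounds both its time and its space (`potential_step_lt`). -/

namespace LoopMachine

open Data

/-! ### Polynomial time -/

theorem polynomial_eval_mono (p : Polynomial ℕ) : Monotone fun n => p.eval n := by
  intro a b h
  simp only [Polynomial.eval_eq_sum_range]
  gcongr

theorem Data.size_pos (x : Data) : 0 < x.size := by
  cases x <;> simp [Data.size]

theorem natSize_add_le (a b : ℕ) : Nat.size (a + b) ≤ Nat.size a + Nat.size b + 1 := by
  rw [Nat.size_le]
  have ha := Nat.lt_size_self a
  have hb := Nat.lt_size_self b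
  have h1 : 2 ^ a.size ≤ 2 ^ (a.size + b.size) := Nat.pow_le_pow_right (by norm_num) (by omega)
  have h2 : 2 ^ b.size ≤ 2 ^ (a.size + b.size) := Nat.pow_le_pow_right (by norm_num) (by omega)
  rw [pow_succ]
  omega

theorem natSize_mul_le (a b : ℕ) : Nat.size (a * b) ≤ Nat.size a + Nat.size b := by
  rw [Nat.size_le, pow_add]
  exact Nat.mul_lt_mul'' (Nat.lt_size_self a) (Nat.lt_size_self b)

theorem Prim.size_apply_le (o : Prim) (x : Data) : (o.apply x).size ≤ 1 + x.size := by
  have h0 : (Data.atom 0).size = 1 := by simp [Data.size]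
  cases o <;> rcases x with a | ⟨a | ⟨a, a'⟩, b | ⟨b, b'⟩⟩ <;>
    simp only [Prim.apply, Data.size, Nat.size_zero] <;> try omega
  · have : Nat.size 1 = 1 := by simp
    omega
  · have : Nat.size 1 = 1 := by simp
    omega
  · have : Nat.size 1 = 1 := by simp
    omega
  · have : Nat.size 1 = 1 := by simp
    omega
  · have := natSize_add_le a b
    omega
  · have := Nat.size_le_size (Nat.sub_le a b)
    omega
  · have := natSize_mul_le a b
    omega
  · have := Nat.size_le_size (Nat.div_le_self a b)
    omega

/-- Every construct is charged for the data it produces. Time bounds are thus length bounds too, and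
composition needs no separate estimate of intermediate results. -/
theorem Run.size_le {p : Prog} {x y : Data} {t : ℕ} (h : Run p x y t) : y.size ≤ t := by
  induction h with
  | prim o x => exact o.size_apply_le x
  | const c x => omega
  | pair _ _ _ _ => simp only [Data.size]; omega
  | seq _ _ _ _ => omega
  | ite_true _ _ _ _ _ => omega
  | ite_false _ _ _ _ => omega
  | loop_stop _ _ => omega
  | loop_step _ _ _ _ _ _ _ => omega

/-- Types whose elements are given to the machine as data. -/
class Enc (α : Type) where
  /-- the encoding -/
  enc : α → Data


open Enc

instance : Enc ℕ := ⟨Data.atom⟩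

instance {α β : Type} [Enc α] [Enc β] : Enc (α × β) := ⟨fun x => .pair (enc x.1) (enc x.2)⟩

instance {α : Type} [Enc α] : Enc (List α) := ⟨fun l => .ofList (l.map enc)⟩

/-- Only options of pairs: a pair is never a leaf, so `isPair` separates the two cases and `some`
costs nothing. -/
instance {α β : Type} [Enc α] [Enc β] : Enc (Option (α × β)) :=
  ⟨fun o => o.elim (.atom 0) enc⟩

/-- The length of the encoding. -/
def sz {α : Type} [Enc α] (a : α) : ℕ := (enc a).size

theorem sz_nat (n : ℕ) : sz n = Nat.size n + 1 := rfl

theorem sz_pair {α β : Type} [Enc α] [Enc β] (x : α) (y : β) : sz (x, y) = sz x + sz y + 1 := rfl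

theorem sz_nil {α : Type} [Enc α] : sz ([] : List α) = 1 := by
  simp [sz, enc, Data.ofList, Data.size]

theorem sz_cons {α : Type} [Enc α] (x : α) (l : List α) : sz (x :: l) = sz x + sz l + 1 := rfl

theorem sz_none {α β : Type} [Enc α] [Enc β] : sz (none : Option (α × β)) = 1 := by
  simp [sz, enc, Data.size]

theorem sz_some {α β : Type} [Enc α] [Enc β] (x : α × β) : sz (some x) = sz x := rfl

theorem sz_pos {α : Type} [Enc α] (a : α) : 0 < sz a := Data.size_pos _

theorem length_le_sz {α : Type} [Enc α] (l : List α) : l.length + 1 ≤ sz l := by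
  induction l with
  | nil => simp [sz_nil]
  | cons x l ih => rw [sz_cons, List.length_cons]; omega

theorem sz_append {α : Type} [Enc α] (l l' : List α) : sz (l ++ l') + 1 = sz l + sz l' := by
  induction l with
  | nil => simp [sz_nil]; omega
  | cons x l ih => rw [List.cons_append, sz_cons, sz_cons]; omega

theorem sz_le_of_mem {α : Type} [Enc α] {l : List α} {x : α} (h : x ∈ l) : sz x ≤ sz l := by
  induction l with
  | nil => simp at h
  | cons y l ih =>
    rw [sz_cons]
    rcases List.mem_cons.1 h with rfl | h
    · omega
    · have := ih h; omega

/-- At most `k` rounds of a while loop with test `c` and body `f`. -/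
def whileIter {α : Type} (c : α → ℕ) (f : α → α) : ℕ → α → α
  | 0, x => x
  | k + 1, x => if c x = 0 then x else whileIter c f k (f x)

theorem whileIter_add {α : Type} (c : α → ℕ) (f : α → α) (j k : ℕ) (x : α) :
    whileIter c f (j + k) x = whileIter c f k (whileIter c f j x) := by
  induction j generalizing x with
  | zero => simp [whileIter]
  | succ j ih =>
    rw [Nat.succ_add, whileIter, whileIter]
    split_ifs with h
    · cases k <;> simp [whileIter, h]
    · exact ih _

theorem whileIter_of_halted {α : Type} {c : α → ℕ} (f : α → α) {x : α} (h : c x = 0) (k : ℕ) :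
    whileIter c f k x = x := by
  cases k <;> simp [whileIter, h]

section PolyTime

variable {α β γ δ : Type} [Enc α] [Enc β] [Enc γ] [Enc δ]

/-- `f` is computed by a program in time polynomial in the input length and the parameter `m`. -/
def PolyTime (m : α → ℕ) (f : α → β) : Prop :=
  ∃ (p : Prog) (q : Polynomial ℕ), ∀ a, ∃ t ≤ q.eval (sz a + m a), Run p (enc a) (enc (f a)) t

/-- Functions computed in polynomial time. -/
def FP (f : α → β) : Prop := PolyTime (fun _ => 0) f

theorem PolyTime.sz_le {m : α → ℕ} {f : α → β} (hf : PolyTime m f) :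
    ∃ q : Polynomial ℕ, ∀ a, sz (f a) ≤ q.eval (sz a + m a) := by
  obtain ⟨p, q, h⟩ := hf
  refine ⟨q, fun a => ?_⟩
  obtain ⟨t, ht, hr⟩ := h a
  exact hr.size_le.trans ht

theorem FP.sz_le {f : α → β} (hf : FP f) : ∃ q : Polynomial ℕ, ∀ a, sz (f a) ≤ q.eval (sz a) :=
  PolyTime.sz_le hf

theorem FP.polyTime {f : α → β} (hf : FP f) (m : α → ℕ) : PolyTime m f := by
  obtain ⟨p, q, h⟩ := hf
  refine ⟨p, q, fun a => ?_⟩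
  obtain ⟨t, ht, hr⟩ := h a
  exact ⟨t, ht.trans (polynomial_eval_mono q (by simp)), hr⟩

theorem PolyTime.comp {m : α → ℕ} {m' : β → ℕ} {f : α → β} {g : β → γ} (hg : PolyTime m' g)
    (hf : PolyTime m f) (hm : ∃ q : Polynomial ℕ, ∀ a, m' (f a) ≤ q.eval (sz a + m a)) :
    PolyTime m fun a => g (f a) := by
  obtain ⟨s, hs⟩ := hf.sz_le
  obtain ⟨p, q, h⟩ := hf
  obtain ⟨p', q', h'⟩ := hg
  obtain ⟨r, hr⟩ := hm
  refine ⟨.seq p p', 1 + Polynomial.X + q + q'.comp (s + r), fun a => ?_⟩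
  obtain ⟨t, ht, hrun⟩ := h a
  obtain ⟨t', ht', hrun'⟩ := h' (f a)
  refine ⟨_, ?_, Run.seq hrun hrun'⟩
  have := polynomial_eval_mono q' (add_le_add (hs a) (hr a))
  simp only [Polynomial.eval_add, Polynomial.eval_comp, Polynomial.eval_X, Polynomial.eval_one]
  change 1 + sz a + t + t' ≤ _
  simp only at this
  omega

theorem FP.comp_polyTime {m : α → ℕ} {f : α → β} {g : β → γ} (hg : FP g) (hf : PolyTime m f) :
    PolyTime m fun a => g (f a) :=
  PolyTime.comp hg hf ⟨0, fun _ => by simp⟩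

theorem FP.comp {f : α → β} {g : β → γ} (hg : FP g) (hf : FP f) : FP fun a => g (f a) :=
  hg.comp_polyTime hf

theorem PolyTime.pair {m : α → ℕ} {f : α → β} {g : α → γ} (hf : PolyTime m f)
    (hg : PolyTime m g) : PolyTime m fun a => (f a, g a) := by
  obtain ⟨p, q, h⟩ := hf
  obtain ⟨p', q', h'⟩ := hg
  refine ⟨.pair p p', 1 + Polynomial.X + q + q', fun a => ?_⟩
  obtain ⟨t, ht, hrun⟩ := h a
  obtain ⟨t', ht', hrun'⟩ := h' a
  refine ⟨_, ?_, Run.pair hrun hrun'⟩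
  simp only [Polynomial.eval_add, Polynomial.eval_X, Polynomial.eval_one]
  change 1 + sz a + t + t' ≤ _
  omega

theorem FP.pair {f : α → β} {g : α → γ} (hf : FP f) (hg : FP g) : FP fun a => (f a, g a) :=
  PolyTime.pair hf hg

theorem FP.of_prim (o : Prim) {f : α → β} (h : ∀ a, o.apply (enc a) = enc (f a)) : FP f :=
  ⟨.prim o, 1 + Polynomial.X, fun a => ⟨1 + sz a, by simp, h a ▸ Run.prim o (enc a)⟩⟩

theorem FP.id : FP fun a : α => a := FP.of_prim .id fun _ => rfl

theorem FP.fst' : FP fun a : α × β => a.1 := FP.of_prim .fst fun _ => rfl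

theorem FP.snd' : FP fun a : α × β => a.2 := FP.of_prim .snd fun _ => rfl

theorem FP.fst {f : γ → α × β} (hf : FP f) : FP fun a => (f a).1 := FP.fst'.comp hf

theorem FP.snd {f : γ → α × β} (hf : FP f) : FP fun a => (f a).2 := FP.snd'.comp hf

theorem FP.const (b : β) : FP fun _ : α => b :=
  ⟨.const (enc b), 1 + Polynomial.X + Polynomial.C (sz b), fun a =>
    ⟨1 + sz a + sz b, by simp, Run.const (enc b) (enc a)⟩⟩

theorem FP.add {f g : α → ℕ} (hf : FP f) (hg : FP g) : FP fun a => f a + g a :=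
  FP.comp (g := fun x : ℕ × ℕ => x.1 + x.2) (FP.of_prim .add fun _ => rfl) (hf.pair hg)

theorem FP.sub {f g : α → ℕ} (hf : FP f) (hg : FP g) : FP fun a => f a - g a :=
  FP.comp (g := fun x : ℕ × ℕ => x.1 - x.2) (FP.of_prim .sub fun _ => rfl) (hf.pair hg)

theorem FP.mul {f g : α → ℕ} (hf : FP f) (hg : FP g) : FP fun a => f a * g a :=
  FP.comp (g := fun x : ℕ × ℕ => x.1 * x.2) (FP.of_prim .mul fun _ => rfl) (hf.pair hg)

theorem FP.div {f g : α → ℕ} (hf : FP f) (hg : FP g) : FP fun a => f a / g a :=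
  FP.comp (g := fun x : ℕ × ℕ => x.1 / x.2) (FP.of_prim .div fun _ => rfl) (hf.pair hg)

theorem FP.pow {f : α → ℕ} (hf : FP f) (k : ℕ) : FP fun a => f a ^ k := by
  induction k with
  | zero => simpa using FP.const 1
  | succ k ih => simpa only [pow_succ] using ih.mul hf

theorem FP.cons {f : γ → α} {g : γ → List α} (hf : FP f) (hg : FP g) : FP fun c => f c :: g c :=
  FP.comp (g := fun x : α × List α => x.1 :: x.2) (FP.of_prim .id fun _ => rfl) (hf.pair hg)

theorem FP.optSome {f : γ → α × β} (hf : FP f) : FP fun c => some (f c) :=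
  FP.comp (g := fun x : α × β => Option.some x) (FP.of_prim .id fun _ => rfl) hf

/-- A case distinction by a test program, with the inputs of the branches prepared separately. -/
theorem FP.branch {F : α → β} {c : Prog} {u v : Prog} {qc qu qv : Polynomial ℕ} (P : α → Prop)
    (hc : ∀ a, ∃ b, ∃ t ≤ qc.eval (sz a), Run c (enc a) b t ∧ (b = .atom 0 ↔ P a))
    (hu : ∀ a, P a → ∃ t ≤ qu.eval (sz a), Run u (enc a) (enc (F a)) t)
    (hv : ∀ a, ¬ P a → ∃ t ≤ qv.eval (sz a), Run v (enc a) (enc (F a)) t) : FP F := by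
  refine ⟨.ite c v u, 1 + Polynomial.X + qc + qu + qv, fun a => ?_⟩
  obtain ⟨b, t, ht, hrun, hb⟩ := hc a
  simp only [Polynomial.eval_add, Polynomial.eval_X, Polynomial.eval_one, add_zero]
  by_cases h : P a
  · obtain ⟨t', ht', hrun'⟩ := hu a h
    rw [hb.2 h] at hrun
    refine ⟨_, ?_, Run.ite_false hrun hrun'⟩
    change 1 + sz a + t + t' ≤ _
    omega
  · obtain ⟨t', ht', hrun'⟩ := hv a h
    refine ⟨_, ?_, Run.ite_true hrun (fun h' => h (hb.1 h')) hrun'⟩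
    change 1 + sz a + t + t' ≤ _
    omega

theorem FP.ite {c : α → ℕ} {f g : α → β} (hc : FP c) (hf : FP f) (hg : FP g) :
    FP fun a => if c a = 0 then f a else g a := by
  obtain ⟨p, q, h⟩ := hc
  obtain ⟨p', q', h'⟩ := hf
  obtain ⟨p'', q'', h''⟩ := hg
  refine FP.branch (c := p) (u := p') (v := p'') (qc := q) (qu := q') (qv := q'')
    (fun a => c a = 0) (fun a => ?_) (fun a ha => ?_) (fun a ha => ?_)
  · obtain ⟨t, ht, hr⟩ := h a
    exact ⟨_, t, ht, hr, by simp [enc]⟩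
  · simpa only [ha, if_true, add_zero] using h' a
  · simpa only [ha, if_false, add_zero] using h'' a

/-- Decidable predicates that are tested in polynomial time. -/
def FPred (P : α → Prop) : Prop := ∃ c : α → ℕ, FP c ∧ ∀ a, c a = 0 ↔ P a

theorem FPred.ite {P : α → Prop} [DecidablePred P] {f g : α → β} (hP : FPred P) (hf : FP f)
    (hg : FP g) : FP fun a => if P a then f a else g a := by
  obtain ⟨c, hc, h⟩ := hP
  simpa only [h] using hc.ite hf hg

theorem FPred.eq {f g : α → ℕ} (hf : FP f) (hg : FP g) : FPred fun a => f a = g a :=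
  ⟨fun a => (f a - g a) + (g a - f a), (hf.sub hg).add (hg.sub hf), fun a => by simp only; omega⟩

theorem FPred.lt {f g : α → ℕ} (hf : FP f) (hg : FP g) : FPred fun a => f a < g a :=
  ⟨fun a => f a + 1 - g a, (hf.add (.const 1)).sub hg, fun a => by simp only; omega⟩

theorem FPred.not {P : α → Prop} (hP : FPred P) : FPred fun a => ¬ P a := by
  obtain ⟨c, hc, h⟩ := hP
  exact ⟨fun a => 1 - c a, (FP.const 1).sub hc, fun a => by simp only [← h]; omega⟩

theorem FPred.and {P Q : α → Prop} (hP : FPred P) (hQ : FPred Q) : FPred fun a => P a ∧ Q a := by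
  obtain ⟨c, hc, h⟩ := hP
  obtain ⟨d, hd, h'⟩ := hQ
  exact ⟨fun a => c a + d a, hc.add hd, fun a => by simp only [← h, ← h']; omega⟩

/-- The program that tests whether the value of a function is a pair. -/
theorem FP.isPair_test {f : α → β} (hf : FP f) : ∃ (c : Prog) (q : Polynomial ℕ), ∀ a, ∃ t ≤ q.eval (sz a),
    Run c (enc a) (Prim.isPair.apply (enc (f a))) t := by
  obtain ⟨s, hs⟩ := hf.sz_le
  obtain ⟨p, q, h⟩ := hf
  refine ⟨.seq p (.prim .isPair), 1 + Polynomial.X + q + (1 + s), fun a => ?_⟩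
  obtain ⟨t, ht, hr⟩ := h a
  refine ⟨_, ?_, Run.seq hr (Run.prim _ _)⟩
  have := hs a
  simp only [Polynomial.eval_add, Polynomial.eval_X, Polynomial.eval_one, add_zero] at ht ⊢
  change 1 + sz a + t + (1 + sz (f a)) ≤ _
  omega

/-- A nonempty list is encoded as the pair of its head and its tail. The input paired with `l c` is
therefore literally the datum that the program for `h` expects. -/
theorem FP.listCase {l : γ → List α} {F : γ → β} {g : γ → β} {h : γ × (α × List α) → β}
    (hl : FP l) (hg : FP g) (hh : FP h) (h0 : ∀ c, l c = [] → F c = g c)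
    (h1 : ∀ c x l', l c = x :: l' → F c = h (c, x, l')) : FP F := by
  obtain ⟨c, qc, hc⟩ := hl.isPair_test
  obtain ⟨p, q, hp⟩ := hg
  obtain ⟨pl, ql, hpl⟩ := FP.id.pair hl
  obtain ⟨s, hs⟩ := (FP.id.pair hl).sz_le
  obtain ⟨p', q', hp'⟩ := hh
  refine FP.branch (c := c) (u := p) (v := .seq pl p') (qc := qc) (qu := q)
    (qv := 1 + Polynomial.X + ql + q'.comp s) (fun a => l a = []) (fun a => ?_) (fun a ha => ?_)
    (fun a ha => ?_)
  · obtain ⟨t, ht, hr⟩ := hc a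
    refine ⟨_, t, ht, hr, ?_⟩
    cases l a <;> simp [enc, Prim.apply, Data.ofList]
  · simpa only [h0 a ha, add_zero] using hp a
  · obtain ⟨x, l', hx⟩ := List.exists_cons_of_ne_nil ha
    obtain ⟨t, ht, hr⟩ := hpl a
    obtain ⟨t', ht', hr'⟩ := hp' (a, x, l')
    rw [h1 a x l' hx]
    have e : enc (a, l a) = enc (a, x, l') := by rw [hx]; rfl
    rw [e] at hr
    refine ⟨_, ?_, Run.seq hr hr'⟩
    have e' : sz (a, l a) = sz (a, x, l') := by rw [sz, e, sz]
    have := polynomial_eval_mono q' (hs a)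
    simp only [e', add_zero] at this ht' ht ⊢
    simp only [Polynomial.eval_add, Polynomial.eval_X, Polynomial.eval_one, Polynomial.eval_comp]
    change 1 + sz a + t + t' ≤ _
    omega

theorem FP.optionCase {o : γ → Option (α × δ)} {F : γ → β} {g : γ → β} {h : γ × (α × δ) → β}
    (ho : FP o) (hg : FP g) (hh : FP h) (h0 : ∀ c, o c = none → F c = g c)
    (h1 : ∀ c x, o c = Option.some x → F c = h (c, x)) : FP F := by
  obtain ⟨c, qc, hc⟩ := ho.isPair_test
  obtain ⟨p, q, hp⟩ := hg
  obtain ⟨pl, ql, hpl⟩ := FP.id.pair ho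
  obtain ⟨s, hs⟩ := (FP.id.pair ho).sz_le
  obtain ⟨p', q', hp'⟩ := hh
  refine FP.branch (c := c) (u := p) (v := .seq pl p') (qc := qc) (qu := q)
    (qv := 1 + Polynomial.X + ql + q'.comp s) (fun a => o a = none) (fun a => ?_) (fun a ha => ?_)
    (fun a ha => ?_)
  · obtain ⟨t, ht, hr⟩ := hc a
    refine ⟨_, t, ht, hr, ?_⟩
    cases o a <;> simp [enc, Prim.apply]
  · simpa only [h0 a ha, add_zero] using hp a
  · obtain ⟨x, hx⟩ := Option.ne_none_iff_exists'.1 ha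
    obtain ⟨t, ht, hr⟩ := hpl a
    obtain ⟨t', ht', hr'⟩ := hp' (a, x)
    rw [h1 a x hx]
    have e : enc (a, o a) = enc (a, x) := by rw [hx]; rfl
    rw [e] at hr
    refine ⟨_, ?_, Run.seq hr hr'⟩
    have e' : sz (a, o a) = sz (a, x) := by rw [sz, e, sz]
    have := polynomial_eval_mono q' (hs a)
    simp only [e', add_zero] at this ht' ht ⊢
    simp only [Polynomial.eval_add, Polynomial.eval_X, Polynomial.eval_one, Polynomial.eval_comp]
    change 1 + sz a + t + t' ≤ _
    omega

theorem run_loop {c : α → ℕ} {f : α → α} {pc pf : Prog} {qc qf : Polynomial ℕ}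
    (hc : ∀ a, ∃ t ≤ qc.eval (sz a), Run pc (enc a) (enc (c a)) t)
    (hf : ∀ a, ∃ t ≤ qf.eval (sz a), Run pf (enc a) (enc (f a)) t) (S k : ℕ) (a : α)
    (hS : ∀ j, sz (whileIter c f j a) ≤ S) (hk : c (whileIter c f k a) = 0) :
    ∃ t ≤ (k + 1) * (1 + S + qc.eval S + qf.eval S),
      Run (.loop pc pf) (enc a) (enc (whileIter c f k a)) t := by
  induction k generalizing a with
  | zero =>
    obtain ⟨t, ht, hr⟩ := hc a
    have h0 : sz a ≤ S := hS 0
    rw [whileIter] at hk ⊢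
    rw [hk] at hr
    refine ⟨_, ?_, Run.loop_stop hr⟩
    have := polynomial_eval_mono qc h0
    simp only at this
    change 1 + sz a + t ≤ _
    simp only [zero_add, one_mul]
    omega
  | succ k ih =>
    obtain ⟨t, ht, hr⟩ := hc a
    have h0 : sz a ≤ S := hS 0
    have h1 := polynomial_eval_mono qc h0
    have h2 := polynomial_eval_mono qf h0
    simp only at h1 h2
    rw [whileIter] at hk ⊢
    split_ifs at hk ⊢ with h
    · rw [h] at hr
      refine ⟨_, ?_, Run.loop_stop hr⟩
      change 1 + sz a + t ≤ _
      rw [Nat.succ_mul]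
      omega
    · obtain ⟨t', ht', hr'⟩ := hf a
      obtain ⟨t'', ht'', hr''⟩ := ih (f a) (fun j => by
        have := hS (j + 1)
        rwa [whileIter, if_neg h] at this) hk
      refine ⟨_, ?_, Run.loop_step hr (by simpa [enc] using h) hr' hr''⟩
      change 1 + sz a + t + t' + t'' ≤ _
      rw [Nat.succ_mul]
      omega

/-- A polynomial number of rounds is not enough, since lengths could double in each of them; `S`
bounds all intermediate states. Halted states are fixed by `whileIter`, so `N` may overshoot. -/
theorem PolyTime.loop {c : α → ℕ} {f : α → α} (hc : FP c) (hf : FP f) {m : α → ℕ}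
    {S N : Polynomial ℕ} (hS : ∀ a k, sz (whileIter c f k a) ≤ S.eval (sz a + m a))
    (hN : ∀ a, c (whileIter c f (N.eval (sz a + m a)) a) = 0) :
    PolyTime m fun a => whileIter c f (N.eval (sz a + m a)) a := by
  obtain ⟨pc, qc, hc⟩ := hc
  obtain ⟨pf, qf, hf⟩ := hf
  refine ⟨.loop pc pf, (N + 1) * (1 + S + qc.comp S + qf.comp S), fun a => ?_⟩
  simpa using run_loop hc hf _ _ a (hS a) (hN a)

/-- A fold with a context, whose accumulator grows by a bounded amount in each step. -/
theorem FP.foldl' {f : γ × (α × β) → β} (hf : FP f) {q : Polynomial ℕ}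
    (hq : ∀ c x b, sz (f (c, x, b)) ≤ sz b + q.eval (sz c + sz x)) :
    FP fun s : γ × (List α × β) => s.2.1.foldl (fun b x => f (s.1, x, b)) s.2.2 := by
  -- The loop state consists of the context, the rest of the list and the accumulator; the test is 0
  -- exactly when the list is used up.
  set c : γ × (List α × β) → ℕ := fun s => s.2.1.length.min 1 with hcdef
  set g : γ × (List α × β) → γ × (List α × β) := fun s =>
    (s.1, s.2.1.tail, s.2.1.head?.elim s.2.2 fun x => f (s.1, x, s.2.2)) with hgdef
  have hc : FP c := by
    refine FP.listCase (l := fun s : γ × (List α × β) => s.2.1) (g := fun _ => 0) (h := fun _ => 1)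
      FP.snd'.fst (.const 0) (.const 1) (fun s hs => ?_) (fun s x l hs => ?_) <;> simp [hcdef, hs]
  have hg : FP g := by
    refine FP.listCase (l := fun s : γ × (List α × β) => s.2.1) (g := fun s => s)
      (h := fun s => (s.1.1, s.2.2, f (s.1.1, s.2.1, s.1.2.2)))
      FP.snd'.fst .id ?_ (fun s hs => ?_) (fun s x l hs => ?_)
    · exact FP.fst'.fst.pair (FP.snd'.snd.pair (hf.comp
        (FP.fst'.fst.pair (FP.snd'.fst.pair FP.fst'.snd.snd))))
    · rcases s with ⟨s, l, b⟩
      simp only at hs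
      simp [hgdef, hs]
    · simp [hgdef, hs]
  have key : ∀ (k : ℕ) (s : γ) (l : List α) (b : β), whileIter c g k (s, l, b) =
      (s, l.drop k, (l.take k).foldl (fun b x => f (s, x, b)) b) := by
    intro k
    induction k with
    | zero => intro s l b; simp [whileIter]
    | succ k ih =>
      intro s l b
      rw [whileIter]
      cases l with
      | nil => simp [hcdef]
      | cons x l =>
        rw [if_neg (by simp [hcdef])]
        exact ih s l _
  have size : ∀ (s : γ) (M : ℕ) (l : List α) (b : β), (∀ x ∈ l, sz x ≤ M) →
      sz (l.foldl (fun b x => f (s, x, b)) b) ≤ sz b + l.length * q.eval (sz s + M) := by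
    intro s M l
    induction l with
    | nil => intro b _; simp
    | cons x l ih =>
      intro b hM
      have h1 := ih (f (s, x, b)) fun y hy => hM y (List.mem_cons_of_mem _ hy)
      have h2 := hq s x b
      have h3 := polynomial_eval_mono q (Nat.add_le_add_left (hM x List.mem_cons_self) (sz s))
      simp only at h3
      rw [List.foldl_cons, List.length_cons, Nat.succ_mul]
      omega
  have main := PolyTime.loop (m := fun _ => 0) hc hg
    -- The growth per step does not involve the accumulator, so the growths of at most `sz` many
    -- steps simply add up.
    (S := Polynomial.X + Polynomial.X * q) (N := Polynomial.X) (fun s k => ?_) (fun s => ?_)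
  · have h2 : FP fun s : γ × (List α × β) => (whileIter c g (Polynomial.X.eval (sz s + 0)) s).2.2 :=
      FP.snd (FP.snd main)
    convert h2 using 2 with s
    obtain ⟨s, l, b⟩ := s
    rw [key]
    simp only [Polynomial.eval_X]
    rw [List.take_of_length_le]
    have := length_le_sz l
    rw [sz_pair, sz_pair]
    omega
  · obtain ⟨s, l, b⟩ := s
    rw [key]
    have h1 := size s (sz l) (l.take k) b fun x hx => sz_le_of_mem (List.mem_of_mem_take hx)
    have h2 : sz (l.drop k) ≤ sz l := by
      have := sz_append (l.take k) (l.drop k)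
      rw [List.take_append_drop] at this
      have := sz_pos (l.take k)
      omega
    have h3 : (l.take k).length * q.eval (sz s + sz l) ≤
        sz (s, l, b) * q.eval (sz (s, l, b)) := by
      refine Nat.mul_le_mul ?_ (polynomial_eval_mono q ?_)
      · have := length_le_sz l
        rw [List.length_take, sz_pair, sz_pair]
        omega
      · rw [sz_pair, sz_pair]
        omega
    simp only [Polynomial.eval_add, Polynomial.eval_mul, Polynomial.eval_X, add_zero]
    generalize sz (s, l, b) * q.eval (sz (s, l, b)) = Q at *
    rw [sz_pair, sz_pair, sz_pair, sz_pair]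
    omega
  · obtain ⟨s, l, b⟩ := s
    rw [key]
    have := length_le_sz l
    simp only [Polynomial.eval_X, hcdef]
    rw [List.drop_of_length_le]
    · simp
    · rw [sz_pair, sz_pair]
      omega

theorem FP.foldl {f : γ × (α × β) → β} (hf : FP f) {q : Polynomial ℕ}
    (hq : ∀ c x b, sz (f (c, x, b)) ≤ sz b + q.eval (sz c + sz x)) {c : δ → γ} {l : δ → List α}
    {b : δ → β} (hc : FP c) (hl : FP l) (hb : FP b) :
    FP fun d => (l d).foldl (fun b x => f (c d, x, b)) (b d) :=
  (FP.foldl' hf hq).comp (hc.pair (hl.pair hb))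

end PolyTime

end LoopMachine

namespace TwoSpin

/-! ### The critical field -/

-- The exponent of λ_c is 6 + 5√(6/5), and 11087/966 = 6 + 5·5291/4830 is its upper bound from
-- `edgeRoot_lt`.
set_option exponentiation.threshold 20000 in
theorem log_ten_thirds_mul_lt :
    Real.log (10 / 3) * (11087 / 966) < Real.log 1002762 := by
  have h : (10 : ℕ) ^ 11087 < 3 ^ 11087 * 1002762 ^ 966 := by decide +kernel
  have h' : ((10 : ℝ) / 3) ^ 11087 < 1002762 ^ 966 := by
    rw [div_pow, div_lt_iff₀ (by positivity), mul_comm]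
    exact_mod_cast h
  have h2 := Real.log_lt_log (by positivity) h'
  rw [Real.log_pow, Real.log_pow] at h2
  push_cast at h2
  linarith

-- Here 5291/461 = 6 + 5·2525/2305 comes from `lt_edgeRoot`. Hence log λ exceeds log λ_c by at most
-- 1/12000. The factor 12461/12000 is 1 + 461/12000, whose logarithm is at most 461/12000.
set_option exponentiation.threshold 20000 in
theorem le_log_ten_thirds_mul :
    Real.log 1002762 ≤ Real.log (10 / 3) * (5291 / 461) + 1 / 12000 := by
  have h : (1002762 : ℕ) ^ 461 * 3 ^ 5291 * 12000 ≤ 10 ^ 5291 * 12461 := by decide +kernel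
  have h' : (1002762 : ℝ) ^ 461 ≤ (10 / 3) ^ 5291 * (12461 / 12000) := by
    rw [div_pow, div_mul_div_comm, le_div_iff₀ (by positivity), ← mul_assoc]
    exact_mod_cast h
  have h2 := Real.log_le_log (by positivity) h'
  rw [Real.log_mul (by positivity) (by positivity), Real.log_pow, Real.log_pow] at h2
  have h3 := Real.log_le_sub_one_of_pos (x := 12461 / 12000) (by norm_num)
  push_cast at h2
  linarith

theorem six_fifths_lt_log : 6 / 5 < Real.log (10 / 3) := by
  have h : Real.exp 1 ^ 6 < (10 / 3) ^ 5 :=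
    (pow_lt_pow_left₀ Real.exp_one_lt_d9 (Real.exp_pos _).le (by norm_num)).trans (by norm_num)
  have := Real.log_lt_log (by positivity) h
  rw [Real.log_pow, Real.log_pow, Real.log_exp] at this
  push_cast at this
  linarith

theorem log_lt_five_fourths : Real.log (10 / 3) < 5 / 4 := by
  have h : (10 / 3 : ℝ) ^ 4 < Real.exp 1 ^ 5 :=
    lt_trans (by norm_num) (pow_lt_pow_left₀ Real.exp_one_gt_d9 (by norm_num) (by norm_num))
  have := Real.log_lt_log (by positivity) h
  rw [Real.log_pow, Real.log_pow, Real.log_exp] at this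
  push_cast at this
  linarith

/-- The square root of the product of the edge parameters. -/
noncomputable def edgeRoot : ℝ := Real.sqrt (6 / 5)

theorem edgeRoot_sq : edgeRoot * edgeRoot = 6 / 5 := Real.mul_self_sqrt (by norm_num)

theorem edgeRoot_pos : 0 < edgeRoot := Real.sqrt_pos.2 (by norm_num)

theorem edgeRoot_lt : edgeRoot < 5291 / 4830 := by
  rw [edgeRoot, Real.sqrt_lt' (by norm_num)]; norm_num

theorem lt_edgeRoot : 2525 / 2305 < edgeRoot := by
  rw [edgeRoot, Real.lt_sqrt (by norm_num)]; norm_num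

theorem criticalField_lt : criticalField 0.6 2 < 1002762 := by
  have h1 : (0.6 : ℝ) * 2 = 6 / 5 := by norm_num
  have h2 := edgeRoot_sq
  have h3 := lt_edgeRoot
  -- Rationalising the denominator with βγ - 1 = 1/5 gives Δ_c = 11 + 10√(6/5).
  have h4 : (criticalDegree 0.6 2 + 1) / 2 = 6 + 5 * edgeRoot := by
    rw [criticalDegree, h1, ← edgeRoot]
    have : edgeRoot - 1 ≠ 0 := by linarith
    field_simp
    linarith
  have h5 : (2 / 0.6 : ℝ) = 10 / 3 := by norm_num
  rw [criticalField, h4, h5]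
  rw [← Real.log_lt_log_iff (by positivity) (by norm_num), Real.log_rpow (by norm_num)]
  have := log_ten_thirds_mul_lt
  nlinarith [edgeRoot_lt, six_fifths_lt_log]

/-! ### The contraction estimate -/

/-- The decrease of the logarithm of the ratio at a vertex caused by a neighbour of ratio `x`. -/
noncomputable def logFactor (x : ℝ) : ℝ := Real.log ((x + 2) / (3 / 5 * x + 1))

/-- The derivative of `-logFactor` with respect to `log x`. -/
noncomputable def sensitivity (x : ℝ) : ℝ := x / ((3 * x + 5) * (x + 2))

/-- A function that is zero at the critical ratio `√(10/3)` and positive elsewhere. -/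
noncomputable def deviation (x : ℝ) : ℝ := 3 / 5 * x + 2 / x - 2 * edgeRoot

/-- The density, with respect to `log x`, of the metric in which the recursion contracts. -/
noncomputable def density (x : ℝ) : ℝ := Real.log 1002762 - Real.log x + deviation x

/-- With y = e^u the right side is 2 cosh u - 2 = 4 sinh²(u/2), which is at least u². -/
theorem sq_log_le {y : ℝ} (hy : 0 < y) : Real.log y ^ 2 ≤ y + 1 / y - 2 := by
  have h1 : Real.cosh (Real.log y) = (y + 1 / y) / 2 := by
    rw [Real.cosh_eq, Real.exp_neg, Real.exp_log hy, one_div]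
  have h2 : Real.cosh (Real.log y) = 1 + 2 * Real.sinh (Real.log y / 2) ^ 2 := by
    have := Real.cosh_two_mul (Real.log y / 2)
    rw [mul_div_cancel₀ _ two_ne_zero] at this
    rw [this, Real.cosh_sq]; ring
  have h3 : (Real.log y / 2) ^ 2 ≤ Real.sinh (Real.log y / 2) ^ 2 := by
    rw [sq_le_sq]
    rcases le_total 0 (Real.log y / 2) with h | h
    · rw [abs_of_nonneg h, abs_of_nonneg (Real.sinh_nonneg_iff.2 h)]
      exact Real.self_le_sinh_iff.2 h
    · rw [abs_of_nonpos h, abs_of_nonpos (Real.sinh_nonpos_iff.2 h), neg_le_neg_iff]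
      exact Real.sinh_le_self_iff.2 h
  nlinarith

theorem log_two_add_log : Real.log 2 + Real.log (5 / 3) = Real.log (10 / 3) := by
  rw [← Real.log_mul (by norm_num) (by norm_num)]; norm_num

theorem half_lt_log : 1 / 2 < Real.log (5 / 3) := by
  rw [Real.lt_log_iff_exp_lt (by norm_num)]
  have h : Real.exp (1 / 2) ^ 2 < (5 / 3) ^ 2 := by
    rw [← Real.exp_nat_mul]
    norm_num
    linarith [Real.exp_one_lt_d9]
  exact lt_of_pow_lt_pow_left₀ 2 (by norm_num) h

theorem log_lt_logFactor {x : ℝ} (hx : 0 < x) : Real.log (5 / 3) < logFactor x := by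
  apply Real.log_lt_log (by norm_num)
  rw [div_lt_div_iff₀ (by norm_num) (by positivity)]
  linarith

theorem logFactor_lt_log {x : ℝ} (hx : 0 < x) : logFactor x < Real.log 2 := by
  apply Real.log_lt_log (by positivity)
  rw [div_lt_iff₀ (by positivity)]
  linarith

theorem log_five_edgeRoot : Real.log (5 * edgeRoot / 3) = Real.log (10 / 3) / 2 := by
  have h : (5 * edgeRoot / 3) ^ 2 = 10 / 3 := by nlinarith [edgeRoot_sq]
  rw [← h, Real.log_pow]; push_cast; ring

theorem hasDerivAt_logFactor {x : ℝ} (hx : 0 < x) :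
    HasDerivAt logFactor (-(1 / ((3 * x + 5) * (x + 2)))) x := by
  have h1 : HasDerivAt (fun x : ℝ => x + 2) 1 x := (hasDerivAt_id x).add_const 2
  have h2 : HasDerivAt (fun x : ℝ => 3 / 5 * x + 1) (3 / 5) x := by
    simpa using ((hasDerivAt_id x).const_mul (3 / 5 : ℝ)).add_const 1
  have h3 := (h1.fun_div h2 (by positivity)).log (by positivity)
  refine h3.congr_deriv ?_
  field_simp
  ring

/-- Since 1/`sensitivity` = 3x + 10/x + 11, this function is (`logFactor` - `sensitivity`·(`density`
+ `deviation`)) / `sensitivity`. Dividing by `sensitivity` makes the derivative factor. -/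
theorem hasDerivAt_balance {x : ℝ} (hx : 0 < x) :
    HasDerivAt (fun x => logFactor x * (3 * x + 10 / x + 11) - Real.log 1002762 + Real.log x -
      2 * deviation x) ((3 / 5 - 2 / x ^ 2) * (5 * logFactor x - 2)) x := by
  have h1 := hasDerivAt_logFactor hx
  have h2 : HasDerivAt (fun x : ℝ => x⁻¹) (-(x ^ 2)⁻¹) x := hasDerivAt_inv hx.ne'
  have h3 : HasDerivAt (fun x : ℝ => 3 * x + 10 / x + 11) (3 * 1 + 10 * (-(x ^ 2)⁻¹)) x :=
    (((hasDerivAt_id x).const_mul 3).add (h2.const_mul 10)).add_const 11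
  have h4 : HasDerivAt deviation (3 / 5 * 1 + 2 * (-(x ^ 2)⁻¹)) x :=
    (((hasDerivAt_id x).const_mul (3 / 5)).add (h2.const_mul 2)).sub_const _
  have h5 := (((h1.mul h3).sub_const (Real.log 1002762)).add (Real.hasDerivAt_log hx.ne')).sub
    (h4.const_mul 2)
  refine HasDerivAt.congr_deriv h5 ?_
  field_simp
  ring

/-- The derivative changes sign only at √(10/3), because 5·`logFactor` > 5 log(5/3) > 2. The minimum
there is log λ_c - log λ, which is negative but tiny. -/
theorem balance_ge {x : ℝ} (hx : 0 < x) : -(1 / 10000) ≤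
    logFactor x * (3 * x + 10 / x + 11) - Real.log 1002762 + Real.log x - 2 * deviation x := by
  set H : ℝ → ℝ := fun x => logFactor x * (3 * x + 10 / x + 11) - Real.log 1002762 + Real.log x -
    2 * deviation x with hH
  set c : ℝ := 5 * edgeRoot / 3 with hc
  have hk := edgeRoot_sq
  have hk0 := edgeRoot_pos
  have hc0 : 0 < c := by positivity
  have hcc : c * c = 10 / 3 := by rw [hc]; nlinarith
  have hcdev : deviation c = 0 := by
    have : 2 / c = edgeRoot := by
      rw [div_eq_iff hc0.ne', hc]; linarith
    rw [deviation, this, hc]; ring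
  have hbase : -(1 / 10000) ≤ H c := by
    have h1 : logFactor c = Real.log (10 / 3) / 2 := by
      rw [logFactor, ← log_five_edgeRoot]
      congr 1
      rw [div_eq_iff (by positivity), hc]
      linarith
    have h2 : 3 * c + 10 / c + 11 = 10 * edgeRoot + 11 := by
      rw [deviation] at hcdev
      have : 10 / c = 5 * (2 / c) := by ring
      rw [this]
      linarith
    have h3 : Real.log c = Real.log (10 / 3) / 2 := log_five_edgeRoot
    simp only [hH, h1, h2, h3, hcdev]
    nlinarith [lt_edgeRoot, six_fifths_lt_log, le_log_ten_thirds_mul]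
  have hg : ∀ y, 0 < y → 0 < 5 * logFactor y - 2 := fun y hy => by
    linarith [log_lt_logFactor hy, half_lt_log]
  have hcont : ∀ s ⊆ Set.Ioi (0 : ℝ), ContinuousOn H s := fun s hs y hy =>
    (hasDerivAt_balance (hs hy)).continuousAt.continuousWithinAt
  refine hbase.trans ?_
  change H c ≤ H x
  rcases le_total c x with h | h
  · have := monotoneOn_of_deriv_nonneg (convex_Ici c) (f := H)
      (hcont _ fun y hy => lt_of_lt_of_le hc0 hy) ?_ ?_
    · exact this (Set.mem_Ici.2 le_rfl) (Set.mem_Ici.2 h) h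
    · intro y hy
      rw [interior_Ici] at hy
      exact (hasDerivAt_balance (hc0.trans hy)).differentiableAt.differentiableWithinAt
    · intro y hy
      rw [interior_Ici] at hy
      have hy0 : 0 < y := hc0.trans hy
      rw [(hasDerivAt_balance hy0).deriv]
      refine mul_nonneg ?_ (hg y hy0).le
      rw [sub_nonneg, div_le_iff₀ (by positivity)]
      nlinarith [Set.mem_Ioi.1 hy]
  · have := antitoneOn_of_deriv_nonpos (convex_Ioc 0 c) (f := H)
      (hcont _ fun y hy => hy.1) ?_ ?_
    · exact this ⟨hx, h⟩ ⟨hc0, le_rfl⟩ h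
    · intro y hy
      rw [interior_Ioc] at hy
      exact (hasDerivAt_balance hy.1).differentiableAt.differentiableWithinAt
    · intro y hy
      rw [interior_Ioc] at hy
      rw [(hasDerivAt_balance hy.1).deriv]
      refine mul_nonpos_of_nonpos_of_nonneg ?_ (hg y hy.1).le
      rw [sub_nonpos, le_div_iff₀ (by have := hy.1; positivity)]
      nlinarith [hy.1, hy.2]

/-- For y = x/√(10/3) the deviation is √(6/5)·(y + 1/y - 2), so `sq_log_le` applies. -/
theorem sq_log_le_deviation {x : ℝ} (hx : 0 < x) :
    (Real.log x - Real.log (10 / 3) / 2) ^ 2 ≤ deviation x := by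
  have hk0 := edgeRoot_pos
  rw [← log_five_edgeRoot, ← Real.log_div hx.ne' (by positivity)]
  have h := sq_log_le (y := x / (5 * edgeRoot / 3)) (by positivity)
  have h1 : deviation x = edgeRoot *
      (x / (5 * edgeRoot / 3) + 1 / (x / (5 * edgeRoot / 3)) - 2) := by
    rw [deviation]
    field_simp
    linear_combination (-25) * edgeRoot_sq
  rw [h1]
  have := sq_nonneg (Real.log (x / (5 * edgeRoot / 3)))
  nlinarith [lt_edgeRoot]

theorem deviation_nonneg {x : ℝ} (hx : 0 < x) : 0 ≤ deviation x :=
  (sq_nonneg _).trans (sq_log_le_deviation hx)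

theorem sensitivity_pos {x : ℝ} (hx : 0 < x) : 0 < sensitivity x := by
  rw [sensitivity]; positivity

/-- For y = exp(`logFactor x` - log(10/3)/2), the product `sensitivity`·`deviation` is a multiple of
y + 1/y - 2. The inverse multiple (11 - 10√(6/5))/√(6/5) ≈ 0.042 is below 1/20. -/
theorem sq_logFactor_le {x : ℝ} (hx : 0 < x) :
    20 * (logFactor x - Real.log (10 / 3) / 2) ^ 2 ≤ sensitivity x * deviation x := by
  have hk0 := edgeRoot_pos
  have hk := edgeRoot_sq
  rw [← log_five_edgeRoot, logFactor, ← Real.log_div (by positivity) (by positivity)]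
  have h := sq_log_le (y := (x + 2) / (3 / 5 * x + 1) / (5 * edgeRoot / 3)) (by positivity)
  have h1 : (x + 2) / (3 / 5 * x + 1) / (5 * edgeRoot / 3) +
      1 / ((x + 2) / (3 / 5 * x + 1) / (5 * edgeRoot / 3)) - 2 =
      (11 - 10 * edgeRoot) / edgeRoot * (sensitivity x * deviation x) := by
    rw [sensitivity, deviation]
    field_simp
    ring_nf
    have e2 : edgeRoot ^ 2 = 6 / 5 := by rw [sq, hk]
    simp only [e2]
    ring
  rw [h1] at h
  have h2 : (11 - 10 * edgeRoot) / edgeRoot ≤ 1 / 20 := by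
    rw [div_le_iff₀ hk0]
    linarith [lt_edgeRoot]
  have h3 : 0 ≤ sensitivity x * deviation x :=
    mul_nonneg (sensitivity_pos hx).le (deviation_nonneg hx)
  nlinarith

/-- Of the two copies of `deviation` in `balance_ge`, one is part of the density and the other pays
for the square. As `sensitivity` ≤ 1/20, the defect 1/10000 shrinks to 1/200000. -/
theorem sensitivity_mul_density_le {x : ℝ} (hx : 0 < x) :
    20 * (logFactor x - Real.log (10 / 3) / 2) ^ 2 + sensitivity x * density x ≤
      logFactor x + 1 / 200000 := by
  have h1 := balance_ge hx
  have h2 := sq_logFactor_le hx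
  have h3 := sensitivity_pos hx
  have h4 : sensitivity x * (3 * x + 10 / x + 11) = 1 := by
    rw [sensitivity]
    field_simp
    ring
  have h5 : 20 ≤ 3 * x + 10 / x + 11 := by
    have := deviation_nonneg hx
    rw [deviation] at this
    have e : 10 / x = 5 * (2 / x) := by ring
    rw [e]
    linarith [lt_edgeRoot]
  have h6 : sensitivity x ≤ 1 / 20 := by nlinarith
  have h7 := mul_le_mul_of_nonneg_left h1 h3.le
  have h8 : sensitivity x * (logFactor x * (3 * x + 10 / x + 11) - Real.log 1002762 +
      Real.log x - 2 * deviation x) = logFactor x - sensitivity x * density x -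
      sensitivity x * deviation x := by
    rw [density]
    linear_combination logFactor x * h4
  rw [h8] at h7
  linarith

/-- The degree is an integer, so the contraction survives slightly above the critical field. -/
theorem degree_gap (D : ℕ) : (1 / 10000 + 1 / 200000 * (D : ℝ)) * (D + 20) ≤
    20 * (D * (Real.log (10 / 3) / 2) - (Real.log 1002762 - Real.log (10 / 3) / 2)) ^ 2 := by
  have h1 := log_ten_thirds_mul_lt
  have h2 := le_log_ten_thirds_mul
  have h3 := six_fifths_lt_log
  have h4 := log_lt_five_fourths
  set l := Real.log (10 / 3)
  set m := Real.log 1002762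
  -- The expression squared vanishes near D = 21.954, close to Δ_c; D = 22 is the tight case.
  rcases Nat.lt_or_ge D 22 with h | h
  · have hD : (D : ℝ) ≤ 21 := by exact_mod_cast Nat.lt_succ_iff.1 h
    have hD0 : (0 : ℝ) ≤ D := Nat.cast_nonneg D
    have : D * (l / 2) - (m - l / 2) ≤ -(1 / 2) := by nlinarith
    nlinarith
  · obtain ⟨y, rfl⟩ := Nat.exists_eq_add_of_le h
    push_cast
    have hy : (0 : ℝ) ≤ y := Nat.cast_nonneg y
    -- At D = 22 the value is at least (23/2 - 5291/461)·(6/5) - 1/12000, just above 27/1000. Each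
    -- further unit of D adds log(10/3)/2 > 3/5.
    have h5 : 27 / 1000 + y * (3 / 5) ≤ (22 + y) * (l / 2) - (m - l / 2) := by nlinarith
    have h6 : (27 / 1000 + y * (3 / 5)) ^ 2 ≤ ((22 + y) * (l / 2) - (m - l / 2)) ^ 2 :=
      pow_le_pow_left₀ (by positivity) h5 2
    rcases Nat.eq_zero_or_pos y with rfl | hy1
    · norm_num at h6 ⊢
      linarith
    · have hy1 : (1 : ℝ) ≤ y := by exact_mod_cast hy1
      nlinarith

/-- Let e_i be the difference between `logFactor (x i)` and its value at √(10/3). The gains are 20 Σ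
e_i² from the arguments and (A + Σ e_i)² from the deviation of F. With D terms their sum is at least
20A²/(D + 20), which `degree_gap` compares with the total loss. -/
theorem sum_density_add_le {ι : Type*} (N : Finset ι) (x : ι → ℝ) (hx : ∀ i ∈ N, 0 < x i)
    (a b : ℕ) {F : ℝ} (hF : 0 < F) (hs : Real.log 1002762 - Real.log F =
      a * Real.log (5 / 3) + b * Real.log 2 + ∑ i ∈ N, logFactor (x i)) :
    ∑ i ∈ N, sensitivity (x i) * density (x i) + 1 / 10000 ≤ density F := by
  set l := Real.log (10 / 3) with hl
  set D : ℕ := a + b + N.card with hD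
  set s := Real.log 1002762 - Real.log F with hsdef
  set A : ℝ := D * (l / 2) - (Real.log 1002762 - l / 2) with hA
  -- The common value of the e_i at the minimum. Replacing squares by their tangents there makes
  -- everything linear in the sums.
  set κ : ℝ := -A / (D + 20) with hκ
  have hD0 : (0 : ℝ) ≤ D := Nat.cast_nonneg D
  have tilt : ∀ e : ℝ, 40 * κ * e - 20 * κ ^ 2 ≤ 20 * e ^ 2 := fun e => by
    nlinarith [sq_nonneg (e - κ)]
  have hN : ∑ i ∈ N, sensitivity (x i) * density (x i) ≤
      ∑ i ∈ N, (logFactor (x i) + 1 / 200000 - (40 * κ * (logFactor (x i) - l / 2) - 20 * κ ^ 2)) :=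
    Finset.sum_le_sum fun i hi => by
      have := sensitivity_mul_density_le (hx i hi)
      have := tilt (logFactor (x i) - l / 2)
      linarith
  have hN' : ∑ i ∈ N, (logFactor (x i) + 1 / 200000 -
      (40 * κ * (logFactor (x i) - l / 2) - 20 * κ ^ 2)) =
      (1 - 40 * κ) * ∑ i ∈ N, logFactor (x i) + N.card * (1 / 200000 + 20 * κ * l + 20 * κ ^ 2) := by
    rw [Finset.mul_sum, ← nsmul_eq_mul, ← Finset.sum_const, ← Finset.sum_add_distrib]
    exact Finset.sum_congr rfl fun i _ => by ring
  have h2 := log_two_add_log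
  have h53 := half_lt_log
  have hgap : Real.log 2 - Real.log (5 / 3) ≤ 1 / 5 := by
    rw [← Real.log_div (by norm_num) (by norm_num)]
    have := Real.log_le_sub_one_of_pos (x := 2 / (5 / 3)) (by norm_num)
    linarith
  have hgap' : 0 ≤ Real.log 2 - Real.log (5 / 3) :=
    sub_nonneg.2 (Real.log_le_log (by norm_num) (by norm_num))
  -- A pinned neighbour adds nothing to the sum of sensitivities, so its whole logarithm is
  -- available. That exceeds 1/2, while 20e² ≤ 1/5 because |e| ≤ 1/10.
  have hpa : 40 * κ * (Real.log (5 / 3) - l / 2) - 20 * κ ^ 2 ≤ Real.log (5 / 3) :=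
    (tilt _).trans (by rw [hl, ← h2]; nlinarith)
  have hpb : 40 * κ * (Real.log 2 - l / 2) - 20 * κ ^ 2 ≤ Real.log 2 :=
    (tilt _).trans (by rw [hl, ← h2]; nlinarith)
  have ha := mul_le_mul_of_nonneg_left hpa (Nat.cast_nonneg (α := ℝ) a)
  have hb := mul_le_mul_of_nonneg_left hpb (Nat.cast_nonneg (α := ℝ) b)
  have hdev := sq_log_le_deviation hF
  have hlogF : Real.log F - l / 2 = -(A + (s - D * (l / 2))) := by rw [hA, hsdef]; ring
  rw [hlogF] at hdev
  have hmin : -40 * κ * (A + (s - D * (l / 2))) - 400 * κ ^ 2 ≤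
      (-(A + (s - D * (l / 2)))) ^ 2 := by
    nlinarith [sq_nonneg (A + (s - D * (l / 2)) + 20 * κ)]
  have hfin : 1 / 10000 + 1 / 200000 * (D : ℝ) ≤ -40 * κ * A - κ ^ 2 * (20 * D + 400) := by
    have e : -40 * κ * A - κ ^ 2 * (20 * D + 400) = 20 * A ^ 2 / (D + 20) := by
      rw [hκ]
      field_simp
      ring
    rw [e, le_div_iff₀ (by positivity)]
    exact degree_gap D
  have hDcast : (D : ℝ) = a + b + N.card := by rw [hD]; push_cast; ring
  have hsum : ∑ i ∈ N, logFactor (x i) = s - a * Real.log (5 / 3) - b * Real.log 2 := by linarith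
  rw [hN', hsum] at hN
  have ha0 : (0 : ℝ) ≤ a := Nat.cast_nonneg a
  have hb0 : (0 : ℝ) ≤ b := Nat.cast_nonneg b
  have hdens : density F = s + deviation F := by rw [density]
  rw [hdens]
  rw [hDcast] at hmin hfin hdev
  clear_value A κ s D
  linarith

open Filter Topology

/-- The term 2/F of the deviation grows like (5/3)^D and beats any polynomial in D. -/
theorem density_eventually_ge : ∀ᶠ D : ℕ in atTop, ∀ F : ℝ, 0 < F →
    F ≤ 1002762 * (3 / 5) ^ D → 2 * ((D : ℝ) + 1) * D ≤ density F := by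
  have h := tendsto_pow_const_div_const_pow_of_one_lt 2 (r := (5 / 3 : ℝ)) (by norm_num)
  -- This yields 7D² ≤ 2/F, and 7D² covers 2(D + 1)D plus the subtracted 2√(6/5) < 3.
  have h' := h.eventually_lt_const (u := 2 / (7 * 1002762)) (by norm_num)
  filter_upwards [h', eventually_ge_atTop 1] with D hD hD1 F hF hle
  rw [div_lt_iff₀ (by positivity)] at hD
  have hD1 : (1 : ℝ) ≤ D := by exact_mod_cast hD1
  have hpow : (5 / 3 : ℝ) ^ D * (3 / 5) ^ D = 1 := by rw [← mul_pow]; norm_num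
  have hinv : 2 / 1002762 * (5 / 3 : ℝ) ^ D ≤ 2 / F := by
    rw [le_div_iff₀ hF]
    calc 2 / 1002762 * (5 / 3 : ℝ) ^ D * F
        ≤ 2 / 1002762 * (5 / 3 : ℝ) ^ D * (1002762 * (3 / 5) ^ D) := by gcongr
      _ = 2 * ((5 / 3 : ℝ) ^ D * (3 / 5) ^ D) := by ring
      _ = 2 := by rw [hpow, mul_one]
  have hlog : Real.log F ≤ Real.log 1002762 := by
    apply Real.log_le_log hF
    have : (3 / 5 : ℝ) ^ D ≤ 1 := pow_le_one₀ (by norm_num) (by norm_num)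
    linarith
  rw [density, deviation]
  have := edgeRoot_lt
  nlinarith

/-- Bounds for the ratio at a vertex in terms of its degree. -/
theorem ratio_bounds {ι : Type*} (N : Finset ι) (x : ι → ℝ) (hx : ∀ i ∈ N, 0 < x i)
    (a b : ℕ) {F : ℝ} (hF : 0 < F) (hs : Real.log 1002762 - Real.log F =
      a * Real.log (5 / 3) + b * Real.log 2 + ∑ i ∈ N, logFactor (x i)) :
    1002762 * (1 / 2) ^ (a + b + N.card) ≤ F ∧ F ≤ 1002762 * (3 / 5) ^ (a + b + N.card) := by
  have h1 : ∑ i ∈ N, logFactor (x i) ≤ N.card * Real.log 2 := by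
    rw [← nsmul_eq_mul]
    exact Finset.sum_le_card_nsmul _ _ _ fun i hi => (logFactor_lt_log (hx i hi)).le
  have h2 : N.card * Real.log (5 / 3) ≤ ∑ i ∈ N, logFactor (x i) := by
    rw [← nsmul_eq_mul]
    exact Finset.card_nsmul_le_sum _ _ _ fun i hi => (log_lt_logFactor (hx i hi)).le
  have h3 : Real.log (5 / 3) ≤ Real.log 2 := Real.log_le_log (by norm_num) (by norm_num)
  have e1 : Real.log (1 / 2) = - Real.log 2 := by rw [one_div, Real.log_inv]
  have e2 : Real.log (3 / 5) = - Real.log (5 / 3) := by rw [← Real.log_inv]; norm_num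
  have ha : (0 : ℝ) ≤ a := Nat.cast_nonneg a
  have hb : (0 : ℝ) ≤ b := Nat.cast_nonneg b
  constructor
  · rw [← Real.log_le_log_iff (by positivity) hF, Real.log_mul (by norm_num) (by positivity),
      Real.log_pow, e1]
    push_cast
    nlinarith
  · rw [← Real.log_le_log_iff hF (by positivity), Real.log_mul (by norm_num) (by positivity),
      Real.log_pow, e2]
    push_cast
    nlinarith

/-- In large degree the density of F alone exceeds 2(D+1) times the sum, each summand being at most
1. In the finitely many remaining degrees the density of F is at most M, and the gain 1/10000
absorbs a factor up to 1 + 1/(10000M). The factor (2(D+1))^{1/k} tends to 1 as k grows. -/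
theorem exists_rate : ∃ k : ℕ, 0 < k ∧ ∀ {ι : Type} (N : Finset ι) (x : ι → ℝ),
    (∀ i ∈ N, 0 < x i) → ∀ (a b : ℕ) (F : ℝ), 0 < F → Real.log 1002762 - Real.log F =
      a * Real.log (5 / 3) + b * Real.log 2 + ∑ i ∈ N, logFactor (x i) →
    (2 * ((a + b + N.card : ℕ) + 1 : ℝ)) ^ (1 / (k : ℝ)) *
      ∑ i ∈ N, sensitivity (x i) * density (x i) ≤ density F := by
  obtain ⟨D₁, hD₁⟩ := eventually_atTop.1 density_eventually_ge
  set M : ℝ := D₁ + 1002762 + 2 * 2 ^ D₁ with hM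
  have hlim : Tendsto (fun k : ℕ => (2 * ((D₁ : ℝ) + 1)) ^ (1 / (k : ℝ))) atTop (𝓝 1) := by
    have h1 : Tendsto (fun k : ℕ => 1 / (k : ℝ)) atTop (𝓝 0) := tendsto_one_div_atTop_nhds_zero_nat
    have h2 := (Real.continuous_const_rpow (a := 2 * ((D₁ : ℝ) + 1))
      (by positivity)).tendsto 0
    rw [Real.rpow_zero] at h2
    exact h2.comp h1
  have hM0 : 0 < M := by positivity
  have hev := hlim.eventually_lt_const (u := 1 + 1 / (10000 * M))
    (by have : 0 < 1 / (10000 * M) := by positivity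
        linarith)
  obtain ⟨k, hk, hk0⟩ := (hev.and (eventually_gt_atTop 0)).exists
  refine ⟨k, hk0, fun {ι} N x hx a b F hF hs => ?_⟩
  set D := a + b + N.card with hD
  have hslack := sum_density_add_le N x hx a b hF hs
  obtain ⟨hlow, hupp⟩ := ratio_bounds N x hx a b hF hs
  rw [← hD] at hlow hupp
  have hk1 : 1 / (k : ℝ) ≤ 1 := by
    rw [div_le_one (by exact_mod_cast hk0)]
    exact_mod_cast hk0
  have hk2 : 0 ≤ 1 / (k : ℝ) := by positivity
  rcases le_or_gt D₁ D with h | h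
  · have h1 : ∑ i ∈ N, sensitivity (x i) * density (x i) ≤ D := by
      have : ∑ i ∈ N, sensitivity (x i) * density (x i) ≤ N.card • (1 : ℝ) := by
        refine Finset.sum_le_card_nsmul _ _ _ fun i hi => ?_
        have h1 := sensitivity_mul_density_le (hx i hi)
        have h2 := logFactor_lt_log (hx i hi)
        have h3 : Real.log 2 ≤ 9 / 10 := by linarith [Real.log_two_lt_d9]
        have := sq_nonneg (logFactor (x i) - Real.log (10 / 3) / 2)
        linarith
      refine this.trans ?_
      rw [nsmul_eq_mul, mul_one]
      exact_mod_cast (by omega : N.card ≤ D)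
    have h2 : (2 * ((D : ℝ) + 1)) ^ (1 / (k : ℝ)) ≤ 2 * ((D : ℝ) + 1) := by
      conv_rhs => rw [← Real.rpow_one (2 * ((D : ℝ) + 1))]
      refine Real.rpow_le_rpow_of_exponent_le ?_ hk1
      have : (0 : ℝ) ≤ D := Nat.cast_nonneg D
      linarith
    calc (2 * ((D : ℝ) + 1)) ^ (1 / (k : ℝ)) * ∑ i ∈ N, sensitivity (x i) * density (x i)
        ≤ (2 * ((D : ℝ) + 1)) ^ (1 / (k : ℝ)) * D := by gcongr
      _ ≤ 2 * ((D : ℝ) + 1) * D := by gcongr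
      _ ≤ density F := hD₁ D h F hF hupp
  · have h1 : density F ≤ M := by
      have hD1 : (D : ℝ) ≤ D₁ := by exact_mod_cast h.le
      have hs1 : Real.log 1002762 - Real.log F ≤ D₁ := by
        have h3 := Real.log_le_log (by positivity) hlow
        rw [Real.log_mul (by norm_num) (by positivity), Real.log_pow, one_div, Real.log_inv] at h3
        have h4 : Real.log 2 ≤ 1 := by linarith [Real.log_two_lt_d9]
        have : (D : ℝ) * Real.log 2 ≤ D := by nlinarith [Nat.cast_nonneg (α := ℝ) D]
        linarith
      have hF1 : F ≤ 1002762 := by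
        have : (3 / 5 : ℝ) ^ D ≤ 1 := pow_le_one₀ (by norm_num) (by norm_num)
        linarith
      have hF2 : 2 / F ≤ 2 * 2 ^ D₁ := by
        rw [div_le_iff₀ hF]
        have e1 : (2 : ℝ) ^ D * (1 / 2) ^ D = 1 := by rw [← mul_pow]; norm_num
        have e2 : (2 : ℝ) ^ D ≤ 2 ^ D₁ := pow_le_pow_right₀ (by norm_num) h.le
        have e3 : (2 : ℝ) ^ D * (1002762 * (1 / 2) ^ D) ≤ 2 ^ D₁ * F := by gcongr
        have e4 : (2 : ℝ) ^ D * (1002762 * (1 / 2) ^ D) = 1002762 := by linear_combination 1002762 * e1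
        linarith
      rw [density, deviation, hM]
      linarith [edgeRoot_pos]
    set c := (2 * ((D : ℝ) + 1)) ^ (1 / (k : ℝ)) with hc
    have hc1 : 1 ≤ c := Real.one_le_rpow (by linarith [Nat.cast_nonneg (α := ℝ) D]) hk2
    have hc2 : c < 1 + 1 / (10000 * M) := by
      refine lt_of_le_of_lt (Real.rpow_le_rpow (by positivity) ?_ hk2) hk
      have : (D : ℝ) ≤ D₁ := by exact_mod_cast h.le
      linarith
    have h3 : (c - 1) * M ≤ 1 / 10000 := by
      have : (c - 1) * M ≤ 1 / (10000 * M) * M := by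
        apply mul_le_mul_of_nonneg_right _ hM0.le
        linarith
      refine this.trans (le_of_eq ?_)
      field_simp
    nlinarith

/-- The quadratic part vanishes at √(10/3), where the logarithmic part is large; away from it the
quadratic part suffices. This permits comparing arbitrary errors with the metric at the leaves of
the recursion. -/
theorem mul_density_ge {x : ℝ} (hx : 0 < x) (hx1 : x ≤ 1002762) : 2 / 5 ≤ x * density x := by
  have h1 : Real.log x ≤ Real.log 1002762 := Real.log_le_log hx hx1
  have e : x * density x = x * (Real.log 1002762 - Real.log x) +
      (3 / 5 * x ^ 2 + 2 - 2 * edgeRoot * x) := by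
    rw [density, deviation]
    field_simp
  rw [e]
  have hk := edgeRoot_lt
  rcases le_or_gt x 1 with h | h
  · have : 0 ≤ x * (Real.log 1002762 - Real.log x) := mul_nonneg hx.le (by linarith)
    nlinarith
  · rcases le_or_gt x 3 with h' | h'
    · have h2 : 2 ≤ Real.log 1002762 - Real.log x := by
        rw [← Real.log_div (by norm_num) hx.ne', Real.le_log_iff_exp_le (by positivity)]
        have h3 : Real.exp 2 = Real.exp 1 * Real.exp 1 := by rw [← Real.exp_add]; norm_num
        have h4 := Real.exp_one_lt_d9
        have h5 := Real.exp_pos 1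
        rw [h3, le_div_iff₀ hx]
        have : Real.exp 1 * Real.exp 1 ≤ 9 := by nlinarith
        nlinarith
      nlinarith [sq_nonneg (x - 3 / 2)]
    · have : 0 ≤ x * (Real.log 1002762 - Real.log x) := mul_nonneg hx.le (by linarith)
      nlinarith

theorem mul_density_le {x : ℝ} (hx : 0 < x) (hx1 : x ≤ 1002762) : x * density x ≤ 10 ^ 12 := by
  have h1 : Real.log 1002762 - Real.log x ≤ 1002762 / x - 1 := by
    rw [← Real.log_div (by norm_num) hx.ne']
    exact Real.log_le_sub_one_of_pos (by positivity)
  have e : x * density x = x * (Real.log 1002762 - Real.log x) +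
      (3 / 5 * x ^ 2 + 2 - 2 * edgeRoot * x) := by
    rw [density, deviation]
    field_simp
  have h2 := mul_le_mul_of_nonneg_left h1 hx.le
  have e2 : x * (1002762 / x - 1) = 1002762 - x := by field_simp
  rw [e]
  have := mul_pos edgeRoot_pos hx
  nlinarith

/-! ### Subset expansion and the recursion for marginal ratios -/

open Classical in
/-- The number of edges of `G` inside `S`. -/
noncomputable def innerEdges {n : ℕ} (G : SimpleGraph (Fin n)) (S : Finset (Fin n)) : ℕ :=
  ∑ p : Fin n × Fin n, if p.1 < p.2 ∧ G.Adj p.1 p.2 ∧ p.1 ∈ S ∧ p.2 ∈ S then 1 else 0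

/-- The weight of `S` in the subset expansion of the partition function. -/
noncomputable def subsetWeight {n : ℕ} (G : SimpleGraph (Fin n)) (μ : Fin n → ℝ)
    (S : Finset (Fin n)) : ℝ :=
  (∏ i ∈ S, μ i) * (6 / 5) ^ innerEdges G S

/-- The subset expansion of the partition function, normalised by the weight of the constant
configuration `1`. -/
noncomputable def subsetSum {n : ℕ} (G : SimpleGraph (Fin n)) (μ : Fin n → ℝ) : ℝ :=
  ∑ S ∈ Finset.univ.powerset, subsetWeight G μ S

open Classical in
/-- The fields after `v` has been deleted and its first `m` neighbours have been rescaled. -/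
noncomputable def pin {n : ℕ} (G : SimpleGraph (Fin n)) (μ : Fin n → ℝ) (v : Fin n) (m : ℕ) :
    Fin n → ℝ :=
  fun j => if j = v then 0 else if G.Adj v j ∧ (j : ℕ) < m then 6 / 5 * μ j else μ j

/-- The marginal ratio at `v`. -/
noncomputable def ratio {n : ℕ} (G : SimpleGraph (Fin n)) (μ : Fin n → ℝ) (v : Fin n) : ℝ :=
  μ v * subsetSum G (pin G μ v n) / subsetSum G (pin G μ v 0)

/-- The factor contributed by a neighbour of ratio `r`. -/
noncomputable def factor (r : ℝ) : ℝ := (1 + 6 / 5 * r) / (1 + r)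

section

variable {n : ℕ} {G : SimpleGraph (Fin n)}

open Classical in
theorem innerEdges_insert {v : Fin n} {S : Finset (Fin n)} (hv : v ∉ S) :
    innerEdges G (insert v S) = innerEdges G S + (S.filter fun j => G.Adj v j).card := by
  have h1 : (S.filter fun j => G.Adj v j).card =
      ∑ p : Fin n × Fin n, ((if p.1 = v ∧ v < p.2 ∧ G.Adj v p.2 ∧ p.2 ∈ S then 1 else 0) +
        if p.2 = v ∧ p.1 < v ∧ G.Adj v p.1 ∧ p.1 ∈ S then 1 else 0) := by
    rw [Finset.sum_add_distrib, Fintype.sum_prod_type, Fintype.sum_prod_type_right]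
    simp only [ite_and, Finset.sum_ite_irrel, Finset.sum_const_zero, Finset.sum_ite_eq',
      Finset.mem_univ, if_true]
    have e : (S.filter fun j => G.Adj v j) = Finset.univ.filter fun j => G.Adj v j ∧ j ∈ S := by
      ext j; simp [and_comm]
    rw [← Finset.sum_add_distrib, e, Finset.card_filter]
    refine Finset.sum_congr rfl fun j _ => ?_
    by_cases h : G.Adj v j
    · rcases lt_or_gt_of_ne h.ne with h' | h' <;> simp [h, h', h'.not_gt]
    · simp [h]
  rw [h1, innerEdges, innerEdges, ← Finset.sum_add_distrib]
  refine Finset.sum_congr rfl fun p _ => ?_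
  obtain ⟨i, j⟩ := p
  simp only [Finset.mem_insert]
  by_cases hi : i = v <;> by_cases hj : j = v
  · subst hi; subst hj; simp [hv]
  · subst hi; simp [hv, hj]
  · subst hj; simp [hv, hi, G.adj_comm]
  · simp [hi, hj]

theorem subsetWeight_congr {μ ν : Fin n → ℝ} {S : Finset (Fin n)} (h : ∀ i ∈ S, μ i = ν i) :
    subsetWeight G μ S = subsetWeight G ν S := by
  rw [subsetWeight, subsetWeight, Finset.prod_congr rfl h]

theorem subsetSum_pin (μ : Fin n → ℝ) (v : Fin n) (m : ℕ) : subsetSum G (pin G μ v m) =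
    ∑ S ∈ (Finset.univ.erase v).powerset, subsetWeight G (pin G μ v m) S := by
  rw [subsetSum, ← Finset.insert_erase (Finset.mem_univ v),
    Finset.sum_powerset_insert (Finset.notMem_erase v _),
    Finset.insert_erase (Finset.mem_univ v), add_eq_left]
  refine Finset.sum_eq_zero fun S _ => ?_
  rw [subsetWeight, Finset.prod_eq_zero (Finset.mem_insert_self v S) (by simp [pin]), zero_mul]

/-- Split by whether v lies in S. If it does, each neighbour of v in S adds an edge, which amounts
to rescaling the fields of all neighbours by 6/5. -/
theorem subsetSum_eq (μ : Fin n → ℝ) (v : Fin n) : subsetSum G μ =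
    subsetSum G (pin G μ v 0) + μ v * subsetSum G (pin G μ v n) := by
  classical
  rw [subsetSum_pin, subsetSum_pin, subsetSum, ← Finset.insert_erase (Finset.mem_univ v),
    Finset.sum_powerset_insert (Finset.notMem_erase v _),
    Finset.insert_erase (Finset.mem_univ v), Finset.mul_sum]
  have hne : ∀ S ∈ (Finset.univ.erase v).powerset, ∀ i ∈ S, i ≠ v := fun S hS i hi =>
    (Finset.mem_erase.1 (Finset.mem_powerset.1 hS hi)).1
  congr 1
  · refine Finset.sum_congr rfl fun S hS => subsetWeight_congr fun i hi => ?_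
    simp [pin, hne S hS i hi]
  · refine Finset.sum_congr rfl fun S hS => ?_
    have hv : v ∉ S := fun h => hne S hS v h rfl
    have h1 : ∏ i ∈ S, pin G μ v n i =
        (∏ i ∈ S, μ i) * (6 / 5) ^ (S.filter fun j => G.Adj v j).card := by
      rw [← Finset.prod_const, Finset.prod_filter, ← Finset.prod_mul_distrib]
      refine Finset.prod_congr rfl fun i hi => ?_
      simp only [pin, hne S hS i hi, if_false, i.2, and_true]
      split_ifs <;> ring
    rw [subsetWeight, subsetWeight, h1, Finset.prod_insert hv, innerEdges_insert hv, pow_add]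
    ring

theorem subsetSum_pos {μ : Fin n → ℝ} (hμ : ∀ i, 0 ≤ μ i) : 0 < subsetSum G μ := by
  have h1 : ∀ S, 0 ≤ subsetWeight G μ S := fun S =>
    mul_nonneg (Finset.prod_nonneg fun i _ => hμ i) (by positivity)
  have h2 : subsetWeight G μ ∅ = 1 := by simp [subsetWeight, innerEdges]
  have h3 := Finset.single_le_sum (s := Finset.univ.powerset) (f := subsetWeight G μ)
    (fun S _ => h1 S) (Finset.empty_mem_powerset _)
  rw [subsetSum]
  linarith

theorem pin_nonneg {μ : Fin n → ℝ} (hμ : ∀ i, 0 ≤ μ i) (v : Fin n) (m : ℕ) (i : Fin n) :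
    0 ≤ pin G μ v m i := by
  have := hμ i
  rw [pin]
  split_ifs <;> positivity

theorem ratio_nonneg {μ : Fin n → ℝ} (hμ : ∀ i, 0 ≤ μ i) (v : Fin n) : 0 ≤ ratio G μ v :=
  div_nonneg (mul_nonneg (hμ v) (subsetSum_pos (pin_nonneg hμ v n)).le)
    (subsetSum_pos (pin_nonneg hμ v 0)).le

theorem subsetSum_eq_mul {μ : Fin n → ℝ} (hμ : ∀ i, 0 ≤ μ i) (v : Fin n) :
    subsetSum G μ = subsetSum G (pin G μ v 0) * (1 + ratio G μ v) := by
  have := (subsetSum_pos (G := G) (pin_nonneg (G := G) hμ v 0)).ne'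
  rw [subsetSum_eq μ v, ratio]
  field_simp

-- Rescaling one more neighbour u changes the sum from Z(1 + r) to Z(1 + 6r/5), where r is the ratio
-- at u and Z the sum with u deleted. The quotients for successive neighbours telescope.
open Classical in
theorem subsetSum_pin_succ {μ : Fin n → ℝ} (hμ : ∀ i, 0 ≤ μ i) {u v : Fin n} (h : G.Adj v u) :
    subsetSum G (pin G μ v (u + 1)) =
      subsetSum G (pin G μ v u) * factor (ratio G (pin G μ v u) u) := by
  set ν := pin G μ v u with hν
  set ν' := pin G μ v (u + 1) with hν'
  have hν0 : ∀ i, 0 ≤ ν i := pin_nonneg hμ v u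
  have hne : u ≠ v := h.ne'
  have h1 : ∀ j, j ≠ u → ν' j = ν j := fun j hj => by
    have : (j : ℕ) ≠ u := fun h => hj (Fin.ext h)
    have : (G.Adj v j ∧ (j : ℕ) < u + 1) ↔ (G.Adj v j ∧ (j : ℕ) < u) :=
      and_congr_right fun _ => by omega
    exact if_congr Iff.rfl rfl (if_congr this rfl rfl)
  have h2 : ν' u = 6 / 5 * ν u := by simp [hν, hν', pin, hne, h]
  have h3 : ∀ m, pin G ν' u m = pin G ν u m := fun m => by
    funext j
    by_cases hj : j = u
    · simp [pin, hj]
    · simp only [pin, hj, if_false, h1 j hj]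
  have hpos := subsetSum_pos (G := G) (pin_nonneg (G := G) hν0 u 0)
  have hr := ratio_nonneg (G := G) hν0 u
  rw [subsetSum_eq_mul hν0 u, subsetSum_eq ν' u, h3, h3, h2, factor]
  have e : ν u * subsetSum G (pin G ν u n) = ratio G ν u * subsetSum G (pin G ν u 0) := by
    rw [ratio, div_mul_cancel₀ _ hpos.ne']
  have : 1 + ratio G ν u ≠ 0 := by positivity
  rw [mul_assoc (6 / 5 : ℝ), e]
  field_simp

open Classical in
theorem subsetSum_pin_eq_prod {μ : Fin n → ℝ} (hμ : ∀ i, 0 ≤ μ i) (v : Fin n) (m : ℕ) (hm : m ≤ n) :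
    subsetSum G (pin G μ v m) = subsetSum G (pin G μ v 0) *
      ∏ w with G.Adj v w ∧ (w : ℕ) < m, factor (ratio G (pin G μ v w) w) := by
  induction m with
  | zero => simp
  | succ m ih =>
    set u : Fin n := ⟨m, hm⟩ with hu
    by_cases h : G.Adj v u
    · have e : (Finset.univ.filter fun w : Fin n => G.Adj v w ∧ (w : ℕ) < m + 1) =
          insert u (Finset.univ.filter fun w : Fin n => G.Adj v w ∧ (w : ℕ) < m) := by
        ext w
        simp only [Finset.mem_filter, Finset.mem_univ, true_and, Finset.mem_insert, Fin.ext_iff, hu]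
        constructor
        · rintro ⟨h1, h2⟩
          by_cases h3 : (w : ℕ) = m
          · exact .inl h3
          · exact .inr ⟨h1, by omega⟩
        · rintro (h1 | ⟨h1, h2⟩)
          · have : w = u := Fin.ext h1
            exact ⟨this ▸ h, by omega⟩
          · exact ⟨h1, by omega⟩
      rw [e, Finset.prod_insert (by simp [hu])]
      have := subsetSum_pin_succ hμ h
      rw [show (u : ℕ) = m from rfl] at this
      rw [this, ih (by omega)]
      ring
    · have e : (Finset.univ.filter fun w : Fin n => G.Adj v w ∧ (w : ℕ) < m + 1) =
          Finset.univ.filter fun w : Fin n => G.Adj v w ∧ (w : ℕ) < m := by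
        ext w
        simp only [Finset.mem_filter, Finset.mem_univ, true_and]
        refine and_congr_right fun h1 => ?_
        have : (w : ℕ) ≠ m := fun h2 => h (by rwa [show u = w from Fin.ext h2.symm])
        omega
      have e' : pin G μ v (m + 1) = pin G μ v m := by
        funext j
        have : (G.Adj v j ∧ (j : ℕ) < m + 1) ↔ (G.Adj v j ∧ (j : ℕ) < m) := by
          refine and_congr_right fun h1 => ?_
          have : (j : ℕ) ≠ m := fun h2 => h (by rwa [show u = j from Fin.ext h2.symm])
          omega
        simp only [pin, this]
      rw [e, e', ih (by omega)]

open Classical in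
/-- The recursion for the marginal ratios. -/
theorem ratio_eq_prod {μ : Fin n → ℝ} (hμ : ∀ i, 0 ≤ μ i) (v : Fin n) :
    ratio G μ v = μ v * ∏ w with G.Adj v w, factor (ratio G (pin G μ v w) w) := by
  have h := subsetSum_pin_eq_prod (G := G) hμ v n le_rfl
  have hpos := (subsetSum_pos (G := G) (pin_nonneg (G := G) hμ v 0)).ne'
  simp only [Fin.is_lt, and_true] at h
  rw [ratio, h]
  field_simp

/-- The fields after the first `m` vertices have been deleted. -/
def deleteBelow (μ : Fin n → ℝ) (m : ℕ) : Fin n → ℝ := fun j => if (j : ℕ) < m then 0 else μ j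

theorem deleteBelow_nonneg {μ : Fin n → ℝ} (hμ : ∀ i, 0 ≤ μ i) (m : ℕ) (i : Fin n) :
    0 ≤ deleteBelow μ m i := by
  have := hμ i
  rw [deleteBelow]
  split_ifs <;> positivity

/-- Each deletion of a vertex splits off a factor 1 + ratio, until only the empty set has nonzero
weight. -/
theorem subsetSum_eq_prod {μ : Fin n → ℝ} (hμ : ∀ i, 0 ≤ μ i) :
    subsetSum G μ = ∏ i : Fin n, (1 + ratio G (deleteBelow μ i) i) := by
  have key : ∀ m, m ≤ n → subsetSum G μ = subsetSum G (deleteBelow μ m) *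
      ∏ i ∈ Finset.univ.filter (fun i : Fin n => (i : ℕ) < m), (1 + ratio G (deleteBelow μ i) i) := by
    intro m
    induction m with
    | zero =>
      have e : deleteBelow μ 0 = μ := by funext j; simp [deleteBelow]
      simp [e]
    | succ m ih =>
      intro hm
      set u : Fin n := ⟨m, hm⟩ with hu
      have e : (Finset.univ.filter fun w : Fin n => (w : ℕ) < m + 1) =
          insert u (Finset.univ.filter fun w : Fin n => (w : ℕ) < m) := by
        ext w
        simp only [Finset.mem_filter, Finset.mem_univ, true_and, Finset.mem_insert, Fin.ext_iff, hu]
        omega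
      have e' : pin G (deleteBelow μ m) u 0 = deleteBelow μ (m + 1) := by
        funext j
        simp only [pin, deleteBelow, Fin.ext_iff, hu]
        split_ifs <;> first | rfl | omega
      rw [ih (by omega), subsetSum_eq_mul (deleteBelow_nonneg hμ m) u, e', e,
        Finset.prod_insert (by simp [hu])]
      ring
  have h := key n le_rfl
  simp only [Fin.is_lt, Finset.filter_true] at h
  have h0 : subsetSum G (deleteBelow μ n) = 1 := by
    have e : deleteBelow μ n = fun _ => 0 := by funext j; simp [deleteBelow]
    rw [e, subsetSum, Finset.sum_eq_single ∅]
    · simp [subsetWeight, innerEdges]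
    · intro S _ hS
      obtain ⟨i, hi⟩ := Finset.nonempty_iff_ne_empty.2 hS
      rw [subsetWeight, Finset.prod_eq_zero hi rfl, zero_mul]
    · simp
  rw [h, h0, one_mul]

/-! ### The partition function -/

open Classical in
theorem monoEdges_eq (σ : Fin n → Fin 2) (s : Fin 2) : monoEdges G σ s =
    ∑ p : Fin n × Fin n, if p.1 < p.2 ∧ G.Adj p.1 p.2 ∧ σ p.1 = s ∧ σ p.2 = s then 1 else 0 := by
  rw [← Finset.card_filter, monoEdges, ← Set.ncard_coe_finset]
  symm
  refine Set.ncard_congr (fun p _ => s(p.1, p.2)) ?_ ?_ ?_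
  · rintro ⟨i, j⟩ h
    simp only [Finset.coe_filter, Finset.mem_univ, true_and, Set.mem_ofPred_eq] at h
    simp only [Set.mem_ofPred_eq, SimpleGraph.mem_edgeSet, Sym2.mem_iff]
    exact ⟨h.2.1, by rintro v (rfl | rfl) <;> tauto⟩
  · rintro ⟨i, j⟩ ⟨i', j'⟩ h h' he
    simp only [Finset.coe_filter, Finset.mem_univ, true_and, Set.mem_ofPred_eq] at h h'
    rw [Sym2.eq_iff] at he
    rcases he with ⟨rfl, rfl⟩ | ⟨rfl, rfl⟩
    · rfl
    · exact absurd h.1 (lt_asymm h'.1)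
  · intro e
    induction e using Sym2.ind with
    | _ i j =>
      simp only [Set.mem_ofPred_eq, SimpleGraph.mem_edgeSet, Sym2.mem_iff, Finset.coe_filter,
        Finset.mem_univ, true_and]
      rintro ⟨h1, h2⟩
      have hi := h2 i (.inl rfl)
      have hj := h2 j (.inr rfl)
      rcases lt_or_gt_of_ne h1.ne with h | h
      · exact ⟨(i, j), ⟨h, h1, hi, hj⟩, rfl⟩
      · exact ⟨(j, i), ⟨h, h1.symm, hj, hi⟩, Sym2.eq_swap⟩

open Classical in
/-- The number of neighbours of a vertex. -/
noncomputable def deg (G : SimpleGraph (Fin n)) (v : Fin n) : ℕ :=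
  (Finset.univ.filter fun w => G.Adj v w).card

open Classical in
theorem sum_deg_eq (S : Finset (Fin n)) : ∑ v ∈ S, deg G v = ∑ p : Fin n × Fin n,
    if p.1 < p.2 ∧ G.Adj p.1 p.2 then (if p.1 ∈ S then 1 else 0) + (if p.2 ∈ S then 1 else 0)
      else 0 := by
  have h1 : ∑ v ∈ S, deg G v = ∑ p : Fin n × Fin n,
      ((if p.1 < p.2 ∧ G.Adj p.1 p.2 ∧ p.1 ∈ S then 1 else 0) +
        if p.2 < p.1 ∧ G.Adj p.2 p.1 ∧ p.1 ∈ S then 1 else 0) := by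
    rw [Fintype.sum_prod_type, ← Finset.sum_filter_add_sum_filter_not Finset.univ (· ∈ S)]
    rw [Finset.filter_univ_mem, Finset.sum_eq_zero (s := Finset.filter (fun x => x ∉ S) _), add_zero]
    · refine Finset.sum_congr rfl fun v hv => ?_
      rw [deg, Finset.card_filter]
      refine Finset.sum_congr rfl fun w _ => ?_
      simp only [hv, and_true, G.adj_comm w v]
      by_cases h : G.Adj v w
      · rcases lt_or_gt_of_ne h.ne with h' | h' <;> simp [h, h', h'.le]
      · simp [h]
    · intro v hv
      have := (Finset.mem_filter.1 hv).2
      simp [this]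
  rw [h1, Finset.sum_add_distrib]
  have h2 : ∑ p : Fin n × Fin n, (if p.2 < p.1 ∧ G.Adj p.2 p.1 ∧ p.1 ∈ S then 1 else 0) =
      ∑ p : Fin n × Fin n, (if p.1 < p.2 ∧ G.Adj p.1 p.2 ∧ p.2 ∈ S then 1 else 0) :=
    (Equiv.prodComm (Fin n) (Fin n)).sum_comp
      (fun p => if p.1 < p.2 ∧ G.Adj p.1 p.2 ∧ p.2 ∈ S then 1 else 0)
  rw [h2, ← Finset.sum_add_distrib]
  refine Finset.sum_congr rfl fun p _ => ?_
  by_cases h : p.1 < p.2 ∧ G.Adj p.1 p.2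
  · simp [h.1, h.2]
  · have h' : ∀ q : Prop, ¬ (p.1 < p.2 ∧ G.Adj p.1 p.2 ∧ q) := fun q hq => h ⟨hq.1, hq.2.1⟩
    simp only [h, h', if_false]

/-- The degree sum over S counts edges inside S twice and edges leaving S once. -/
theorem monoEdges_one_add (S : Finset (Fin n)) (σ : Fin n → Fin 2) (hσ : ∀ v, σ v = 0 ↔ v ∈ S) :
    monoEdges G σ 1 + ∑ v ∈ S, deg G v = innerEdges G Finset.univ + innerEdges G S := by
  classical
  have hσ' : ∀ v, σ v = 1 ↔ v ∉ S := fun v => by rw [← hσ]; omega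
  rw [monoEdges_eq, sum_deg_eq, innerEdges, innerEdges, ← Finset.sum_add_distrib,
    ← Finset.sum_add_distrib]
  refine Finset.sum_congr rfl fun p _ => ?_
  by_cases h : p.1 < p.2 ∧ G.Adj p.1 p.2
  · by_cases h1 : p.1 ∈ S <;> by_cases h2 : p.2 ∈ S <;> simp [h.1, h.2, hσ', h1, h2]
  · have h' : ∀ q : Prop, ¬ (p.1 < p.2 ∧ G.Adj p.1 p.2 ∧ q) := fun q hq => h ⟨hq.1, hq.2.1⟩
    simp only [h, h', if_false]

/-- The initial fields. -/
noncomputable def baseField (G : SimpleGraph (Fin n)) (v : Fin n) : ℝ := 1002762 / 2 ^ deg G v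

theorem partitionFunction_eq : partitionFunction 0.6 2 (fun _ => 1002762) G =
    2 ^ innerEdges G Finset.univ * subsetSum G (baseField G) := by
  classical
  rw [partitionFunction, subsetSum, Finset.mul_sum, Finset.powerset_univ]
  refine Finset.sum_bij' (fun σ _ => Finset.univ.filter fun v => σ v = 0)
    (fun S _ v => if v ∈ S then 0 else 1) (by simp) (by simp) ?_ ?_ ?_
  · intro σ _
    funext v
    simp only [Finset.mem_filter, Finset.mem_univ, true_and]
    split_ifs with h
    · exact h.symm
    · omega
  · intro S _
    ext v
    simp
  · intro σ _
    set S := Finset.univ.filter fun v => σ v = 0 with hS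
    have hσ : ∀ v, σ v = 0 ↔ v ∈ S := fun v => by simp [hS]
    have h1 := monoEdges_one_add (G := G) S σ hσ
    have h0 : monoEdges G σ 0 = innerEdges G S := by
      rw [monoEdges_eq, innerEdges]
      simp only [hσ]
    have h2 : (2 : ℝ) ^ monoEdges G σ 1 * 2 ^ (∑ v ∈ S, deg G v) =
        2 ^ innerEdges G Finset.univ * 2 ^ innerEdges G S := by
      rw [← pow_add, ← pow_add, h1]
    have h3 : ∏ v, (if σ v = 0 then (1002762 : ℝ) else 1) = ∏ v ∈ S, 1002762 := by
      rw [hS, Finset.prod_filter]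
    have h4 : ∏ v ∈ S, baseField G v = (∏ v ∈ S, 1002762) / 2 ^ (∑ v ∈ S, deg G v) := by
      rw [← Finset.prod_pow_eq_pow_sum, ← Finset.prod_div_distrib]
      rfl
    have h5 : (6 / 5 : ℝ) ^ innerEdges G S = 0.6 ^ innerEdges G S * 2 ^ innerEdges G S := by
      rw [← mul_pow]; norm_num
    rw [weight, subsetWeight, h0, h3, h4, h5]
    field_simp
    linear_combination h2
end

/-! ### The truncated recursion and the fields that occur in it -/

open Classical in
/-- The recursion for the marginal ratios, with branching budget `B`. Where the budget is used up,
the value is interpolated between the true ratio (at `t = 0`) and the field (at `t = 1`). -/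
noncomputable def interp {n : ℕ} (G : SimpleGraph (Fin n)) (t : ℝ) (B : ℕ) (μ : Fin n → ℝ)
    (v : Fin n) : ℝ :=
  if h : B = 0 then (1 - t) * ratio G μ v + t * μ v
  else μ v * ∏ w with G.Adj v w, factor (interp G t (B / (2 * deg G v)) (pin G μ v w) w)
termination_by B
decreasing_by
  rcases Nat.eq_zero_or_pos (deg G v) with h0 | h0
  · rw [h0]; simpa using Nat.pos_of_ne_zero h
  · exact Nat.div_lt_self (Nat.pos_of_ne_zero h) (by omega)

open Classical in
/-- The number of deleted neighbours of a vertex. -/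
noncomputable def zeroNbrs {n : ℕ} (G : SimpleGraph (Fin n)) (μ : Fin n → ℝ) (v : Fin n) : ℕ :=
  (Finset.univ.filter fun w => G.Adj v w ∧ μ w = 0).card

/-- The field at `v` is the initial field, rescaled on behalf of all but at least `e` of the
deleted neighbours. -/
def Slot {n : ℕ} (G : SimpleGraph (Fin n)) (μ : Fin n → ℝ) (v : Fin n) (e : ℕ) : Prop :=
  ∃ a, a + e ≤ zeroNbrs G μ v ∧ μ v = baseField G v * (6 / 5) ^ a

/-- The fields that occur in the recursion. -/
def Admissible {n : ℕ} (G : SimpleGraph (Fin n)) (μ : Fin n → ℝ) : Prop :=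
  ∀ v, μ v ≠ 0 → Slot G μ v 0

section

variable {n : ℕ} {G : SimpleGraph (Fin n)} {μ : Fin n → ℝ}

theorem baseField_pos (v : Fin n) : 0 < baseField G v := by
  rw [baseField]; positivity

theorem Slot.pos {v : Fin n} {e : ℕ} (h : Slot G μ v e) : 0 < μ v := by
  obtain ⟨a, -, h⟩ := h
  have := baseField_pos (G := G) v
  rw [h]; positivity

theorem Admissible.nonneg (h : Admissible G μ) (v : Fin n) : 0 ≤ μ v := by
  by_cases hv : μ v = 0
  · exact hv.ge
  · exact (h v hv).pos.le

theorem pin_eq_zero {v j : Fin n} {m : ℕ} (h : μ j = 0) : pin G μ v m j = 0 := by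
  simp [pin, h]

theorem pin_self (v : Fin n) (m : ℕ) : pin G μ v m v = 0 := by
  simp [pin]

theorem zeroNbrs_le_pin (v j : Fin n) (m : ℕ) : zeroNbrs G μ j ≤ zeroNbrs G (pin G μ v m) j := by
  classical
  refine Finset.card_le_card fun w hw => ?_
  simp only [Finset.mem_filter, Finset.mem_univ, true_and] at hw ⊢
  exact ⟨hw.1, pin_eq_zero hw.2⟩

theorem zeroNbrs_lt_pin {v j : Fin n} (m : ℕ) (h : G.Adj v j) (hv : μ v ≠ 0) :
    zeroNbrs G μ j + 1 ≤ zeroNbrs G (pin G μ v m) j := by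
  classical
  refine Finset.card_lt_card ((Finset.ssubset_iff_of_subset fun w hw => ?_).2 ⟨v, ?_, ?_⟩)
  · simp only [Finset.mem_filter, Finset.mem_univ, true_and] at hw ⊢
    exact ⟨hw.1, pin_eq_zero hw.2⟩
  · simp [h.symm, pin_self]
  · simp [hv]

theorem Admissible.pin (h : Admissible G μ) {v : Fin n} (hv : μ v ≠ 0) (m : ℕ) :
    Admissible G (pin G μ v m) := by
  classical
  intro j hj
  have hjv : j ≠ v := by rintro rfl; exact hj (pin_self _ _)
  have hj0 : μ j ≠ 0 := fun h0 => hj (pin_eq_zero h0)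
  obtain ⟨a, ha, hμ⟩ := h j hj0
  by_cases hc : G.Adj v j ∧ (j : ℕ) < m
  · refine ⟨a + 1, ?_, ?_⟩
    · have := zeroNbrs_lt_pin (μ := μ) m hc.1 hv
      omega
    · rw [TwoSpin.pin, if_neg hjv, if_pos hc, hμ, pow_succ]; ring
  · refine ⟨a, ha.trans (zeroNbrs_le_pin v j m), ?_⟩
    rw [TwoSpin.pin, if_neg hjv, if_neg hc, hμ]

theorem pin_apply_self {v w : Fin n} (h : G.Adj v w) : pin G μ v w w = μ w := by
  simp [pin, h.ne']

/-- The parent v is now a deleted neighbour of w on whose behalf w was not rescaled. It is the one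
spared by `e = 1`: twice the ratio at w is the original ratio with the edge to the parent removed.
-/
theorem Admissible.slot_pin (h : Admissible G μ) {v w : Fin n} (hv : μ v ≠ 0) (hw : μ w ≠ 0)
    (hvw : G.Adj v w) : Slot G (TwoSpin.pin G μ v w) w 1 := by
  obtain ⟨a, ha, hμ⟩ := h w hw
  refine ⟨a, ?_, by rw [pin_apply_self hvw, hμ]⟩
  have := zeroNbrs_lt_pin (μ := μ) w hvw hv
  omega

theorem admissible_deleteBelow (m : ℕ) : Admissible G (deleteBelow (baseField G) m) := by
  intro v hv
  refine ⟨0, by simp, ?_⟩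
  rw [deleteBelow] at hv ⊢
  split_ifs at hv ⊢ with h
  · exact absurd rfl hv
  · simp

theorem one_le_factor {r : ℝ} (hr : 0 ≤ r) : 1 ≤ factor r := by
  rw [factor, le_div_iff₀ (by positivity)]; linarith

theorem factor_zero : factor 0 = 1 := by simp [factor]

theorem log_factor {r : ℝ} (hr : 0 < r) : Real.log (factor r) = Real.log 2 - logFactor (2 * r) := by
  rw [factor, logFactor, ← Real.log_div (by norm_num) (by positivity)]
  congr 1
  field_simp
  ring

theorem le_ratio (hμ : ∀ i, 0 ≤ μ i) (v : Fin n) : μ v ≤ ratio G μ v := by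
  classical
  rw [ratio_eq_prod hμ]
  refine le_mul_of_one_le_right (hμ v) ?_
  rw [← Finset.prod_const_one (s := Finset.univ.filter fun w => G.Adj v w)]
  exact Finset.prod_le_prod (fun _ _ => zero_le_one) fun w _ =>
    one_le_factor (ratio_nonneg (pin_nonneg hμ v w) w)

open Classical in
/-- The ratio at a vertex, in terms of the ratios at its neighbours. -/
theorem log_step {v : Fin n} {a e : ℕ} (ha : a + e ≤ zeroNbrs G μ v)
    (hv : μ v = baseField G v * (6 / 5) ^ a) {r : Fin n → ℝ}
    (hr0 : ∀ w, G.Adj v w → μ w = 0 → r w = 0) (hr : ∀ w, G.Adj v w → μ w ≠ 0 → 0 < r w) :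
    Real.log 1002762 - Real.log (2 ^ e * (μ v * ∏ w with G.Adj v w, factor (r w))) =
      a * Real.log (5 / 3) + (zeroNbrs G μ v - a - e : ℕ) * Real.log 2 +
        ∑ w with G.Adj v w ∧ μ w ≠ 0, logFactor (2 * r w) ∧
    zeroNbrs G μ v + (Finset.univ.filter fun w => G.Adj v w ∧ μ w ≠ 0).card = deg G v := by
  have hcard : zeroNbrs G μ v + (Finset.univ.filter fun w => G.Adj v w ∧ μ w ≠ 0).card =
      deg G v := by
    rw [zeroNbrs, deg, ← Finset.filter_filter, ← Finset.filter_filter,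
      Finset.card_filter_add_card_filter_not]
  refine ⟨?_, hcard⟩
  have hprod : ∏ w with G.Adj v w, factor (r w) =
      ∏ w with G.Adj v w ∧ μ w ≠ 0, factor (r w) := by
    rw [← Finset.filter_filter]
    symm
    refine Finset.prod_filter_of_ne fun w hw hne h0 => hne ?_
    rw [hr0 w (Finset.mem_filter.1 hw).2 h0, factor_zero]
  have hpos : ∀ w ∈ Finset.univ.filter fun w => G.Adj v w ∧ μ w ≠ 0, 0 < r w := fun w hw =>
    hr w (Finset.mem_filter.1 hw).2.1 (Finset.mem_filter.1 hw).2.2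
  have hfpos : ∀ w ∈ Finset.univ.filter fun w => G.Adj v w ∧ μ w ≠ 0, factor (r w) ≠ 0 :=
    fun w hw => (zero_lt_one.trans_le (one_le_factor (hpos w hw).le)).ne'
  have hsum : ∑ w with G.Adj v w ∧ μ w ≠ 0, Real.log (factor (r w)) =
      (Finset.univ.filter fun w => G.Adj v w ∧ μ w ≠ 0).card * Real.log 2 -
        ∑ w with G.Adj v w ∧ μ w ≠ 0, logFactor (2 * r w) := by
    rw [← nsmul_eq_mul, ← Finset.sum_const, ← Finset.sum_sub_distrib]
    exact Finset.sum_congr rfl fun w hw => log_factor (hpos w hw)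
  have hP : (∏ w with G.Adj v w ∧ μ w ≠ 0, factor (r w)) ≠ 0 := Finset.prod_ne_zero_iff.2 hfpos
  -- In the original scale a deleted neighbour contributes 3/5 = (6/5)/2 if it caused a rescaling
  -- and 1/2 otherwise; the factor 2^e removes e of the latter.
  have h65 : Real.log (6 / 5) = Real.log 2 - Real.log (5 / 3) := by
    rw [← Real.log_div (by norm_num) (by norm_num)]; norm_num
  rw [hprod, hv, baseField, Real.log_mul (by positivity) (mul_ne_zero (by positivity) hP),
    Real.log_mul (by positivity) hP, Real.log_mul (by positivity) (by positivity),
    Real.log_div (by norm_num) (by positivity), Real.log_pow, Real.log_pow, Real.log_pow,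
    Real.log_prod hfpos, hsum, h65, ← hcard, Nat.sub_sub, Nat.cast_sub ha]
  push_cast
  ring

theorem factor_pos {r : ℝ} (hr : 0 ≤ r) : 0 < factor r :=
  zero_lt_one.trans_le (one_le_factor hr)

open Classical in
theorem ratio_le {v : Fin n} {e : ℕ} (h : Slot G μ v e) (hμ : ∀ i, 0 ≤ μ i) :
    2 ^ e * ratio G μ v ≤ 1002762 := by
  obtain ⟨a, ha, hv⟩ := id h
  have hpos : ∀ w, G.Adj v w → μ w ≠ 0 → 0 < ratio G (pin G μ v w) w := fun w hvw hw => by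
    refine lt_of_lt_of_le ?_ (le_ratio (pin_nonneg hμ v w) w)
    rw [pin_apply_self hvw]
    exact lt_of_le_of_ne (hμ w) (Ne.symm hw)
  have hzero : ∀ w, G.Adj v w → μ w = 0 → ratio G (pin G μ v w) w = 0 := fun w hvw hw => by
    rw [ratio, pin_apply_self hvw, hw, zero_mul, zero_div]
  obtain ⟨h1, -⟩ := log_step (G := G) ha hv hzero hpos
  rw [← ratio_eq_prod hμ] at h1
  have hr : 0 < ratio G μ v := h.pos.trans_le (le_ratio hμ v)
  obtain ⟨-, h2⟩ := ratio_bounds _ _ (fun w hw => by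
    have := hpos w (Finset.mem_filter.1 hw).2.1 (Finset.mem_filter.1 hw).2.2
    linarith) _ _ (by positivity) h1
  refine h2.trans ?_
  have := pow_le_one₀ (n := a + (zeroNbrs G μ v - a - e) +
    (Finset.univ.filter fun w => G.Adj v w ∧ μ w ≠ 0).card)
    (by norm_num : (0 : ℝ) ≤ 3 / 5) (by norm_num)
  linarith

theorem interp_zero_right (t : ℝ) (v : Fin n) :
    interp G t 0 μ v = (1 - t) * ratio G μ v + t * μ v := by
  rw [interp, dif_pos rfl]

open Classical in
theorem interp_of_ne (t : ℝ) {B : ℕ} (hB : B ≠ 0) (v : Fin n) : interp G t B μ v =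
    μ v * ∏ w with G.Adj v w, factor (interp G t (B / (2 * deg G v)) (pin G μ v w) w) := by
  rw [interp, dif_neg hB]

theorem interp_eq_zero (t : ℝ) (B : ℕ) {v : Fin n} (hv : μ v = 0) : interp G t B μ v = 0 := by
  rcases eq_or_ne B 0 with rfl | hB
  · rw [interp_zero_right, ratio, hv]; simp
  · rw [interp_of_ne t hB, hv, zero_mul]

theorem div_budget_lt {B : ℕ} (hB : B ≠ 0) (d : ℕ) : B / (2 * d) < B := by
  rcases Nat.eq_zero_or_pos d with h0 | h0
  · rw [h0]; simpa using Nat.pos_of_ne_zero hB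
  · exact Nat.div_lt_self (Nat.pos_of_ne_zero hB) (by omega)

theorem interp_at_zero (hμ : ∀ i, 0 ≤ μ i) (B : ℕ) (v : Fin n) :
    interp G 0 B μ v = ratio G μ v := by
  induction B using Nat.strong_induction_on generalizing μ v with
  | _ B ih =>
    rcases eq_or_ne B 0 with rfl | hB
    · rw [interp_zero_right]; ring
    · rw [interp_of_ne 0 hB, ratio_eq_prod hμ]
      congr 1
      exact Finset.prod_congr rfl fun w _ => by
        rw [ih _ (div_budget_lt hB _) (pin_nonneg hμ v w)]

theorem interp_nonneg (hμ : ∀ i, 0 ≤ μ i) {t : ℝ} (h0 : 0 ≤ t) (h1 : t ≤ 1) (B : ℕ) (v : Fin n) :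
    0 ≤ interp G t B μ v := by
  induction B using Nat.strong_induction_on generalizing μ v with
  | _ B ih =>
    rcases eq_or_ne B 0 with rfl | hB
    · rw [interp_zero_right]
      exact add_nonneg (mul_nonneg (by linarith) (ratio_nonneg hμ v)) (mul_nonneg h0 (hμ v))
    · rw [interp_of_ne t hB]
      exact mul_nonneg (hμ v) (Finset.prod_nonneg fun w _ =>
        (factor_pos (ih _ (div_budget_lt hB _) (pin_nonneg hμ v w) w)).le)

theorem interp_pos (hμ : ∀ i, 0 ≤ μ i) {t : ℝ} (h0 : 0 ≤ t) (h1 : t ≤ 1) (B : ℕ) {v : Fin n}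
    (hv : μ v ≠ 0) : 0 < interp G t B μ v := by
  have hv' : 0 < μ v := lt_of_le_of_ne (hμ v) hv.symm
  rcases eq_or_ne B 0 with rfl | hB
  · rw [interp_zero_right]
    have := le_ratio (G := G) hμ v
    nlinarith
  · rw [interp_of_ne t hB]
    exact mul_pos hv' (Finset.prod_pos fun w _ =>
      factor_pos (interp_nonneg (pin_nonneg hμ v w) h0 h1 _ w))

/-! ### Error estimate along the interpolation -/

theorem hasDerivAt_prod_of_log {ι : Type*} [DecidableEq ι] (s : Finset ι) {f : ι → ℝ → ℝ}
    {l : ι → ℝ} {t : ℝ} (h : ∀ i ∈ s, HasDerivAt (f i) (f i t * l i) t) :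
    HasDerivAt (fun t => ∏ i ∈ s, f i t) ((∏ i ∈ s, f i t) * ∑ i ∈ s, l i) t := by
  induction s using Finset.induction_on with
  | empty => simpa using hasDerivAt_const t (1 : ℝ)
  | insert i s hi ih =>
    have h1 := h i (Finset.mem_insert_self i s)
    have h2 := ih fun j hj => h j (Finset.mem_insert_of_mem hj)
    simp only [Finset.prod_insert hi, Finset.sum_insert hi]
    refine (h1.fun_mul h2).congr_deriv ?_
    ring

theorem hasDerivAt_factor {r : ℝ → ℝ} {r' t : ℝ} (h : HasDerivAt r r' t) (h0 : 0 ≤ r t) :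
    HasDerivAt (fun t => factor (r t))
      (factor (r t) * (r' / ((1 + r t) * (5 + 6 * r t)))) t := by
  have h1 : HasDerivAt (fun t => 1 + 6 / 5 * r t) (6 / 5 * r') t :=
    (h.const_mul (6 / 5)).const_add 1
  have h2 : HasDerivAt (fun t => 1 + r t) r' t := h.const_add 1
  have hne : 1 + r t ≠ 0 := by positivity
  refine (h1.fun_div h2 hne).congr_deriv ?_
  rw [factor]
  have : 5 + 6 * r t ≠ 0 := by positivity
  field_simp
  ring

/-- The degree d may exceed the D of `IsRate` by one, because the edge to the parent is not counted
there. -/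
theorem budget_rpow_le {B d D k : ℕ} (hd : 0 < d) (hD : d ≤ D + 1) :
    ((B : ℝ) + 1) ^ (1 / (k : ℝ)) ≤
      (2 * ((D : ℝ) + 1)) ^ (1 / (k : ℝ)) * (((B / (2 * d) : ℕ) : ℝ) + 1) ^ (1 / (k : ℝ)) := by
  rw [← Real.mul_rpow (by positivity) (by positivity)]
  refine Real.rpow_le_rpow (by positivity) ?_ (by positivity)
  have h1 : B + 1 ≤ 2 * d * (B / (2 * d) + 1) := by
    have := Nat.lt_mul_div_succ B (by omega : 0 < 2 * d)
    omega
  have h2 : 2 * d * (B / (2 * d) + 1) ≤ 2 * (D + 1) * (B / (2 * d) + 1) :=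
    Nat.mul_le_mul_right _ (by omega)
  exact_mod_cast h1.trans h2

end

/-- The property of the exponent `k` provided by `exists_rate`. -/
def IsRate (k : ℕ) : Prop := ∀ {ι : Type} (N : Finset ι) (x : ι → ℝ),
    (∀ i ∈ N, 0 < x i) → ∀ (a b : ℕ) (F : ℝ), 0 < F → Real.log 1002762 - Real.log F =
      a * Real.log (5 / 3) + b * Real.log 2 + ∑ i ∈ N, logFactor (x i) →
    (2 * ((a + b + N.card : ℕ) + 1 : ℝ)) ^ (1 / (k : ℝ)) *
      ∑ i ∈ N, sensitivity (x i) * density (x i) ≤ density F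

section

variable {n : ℕ} {G : SimpleGraph (Fin n)} {μ : Fin n → ℝ}

/-- One step of the recursion contracts the metric. -/
theorem abs_step_le {k : ℕ} (hk : IsRate k) {v : Fin n} {e : ℕ} (he : e ≤ 1)
    (h : Slot G μ v e) {r r' : Fin n → ℝ} {B : ℕ} {C : ℝ} (hC : 0 < C)
    (hr0 : ∀ w, G.Adj v w → μ w = 0 → r w = 0 ∧ r' w = 0)
    (hr : ∀ w, G.Adj v w → μ w ≠ 0 → 0 < r w ∧ 2 * |r' w| ≤ 2 * r w * density (2 * r w) *
      (C / (((B / (2 * deg G v) : ℕ) : ℝ) + 1) ^ (1 / (k : ℝ)))) {x : ℝ}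
    (hx : x = open scoped Classical in
      2 ^ e * (μ v * ∏ w with G.Adj v w, factor (r w))) :
    x * |open scoped Classical in ∑ w with G.Adj v w, r' w / ((1 + r w) * (5 + 6 * r w))| ≤
      x * density x * (C / ((B : ℝ) + 1) ^ (1 / (k : ℝ))) := by
  classical
  obtain ⟨a, ha, hv⟩ := id h
  obtain ⟨h1, hcard⟩ := log_step (G := G) ha hv (fun w h1 h2 => (hr0 w h1 h2).1)
    (fun w h1 h2 => (hr w h1 h2).1)
  set N := Finset.univ.filter fun w => G.Adj v w ∧ μ w ≠ 0 with hN
  set E := C / ((B : ℝ) + 1) ^ (1 / (k : ℝ)) with hE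
  set E' := C / (((B / (2 * deg G v) : ℕ) : ℝ) + 1) ^ (1 / (k : ℝ)) with hE'
  have hxpos : 0 < x := by
    rw [hx]
    refine mul_pos (by positivity) (mul_pos h.pos (Finset.prod_pos fun w hw => ?_))
    have hw := (Finset.mem_filter.1 hw).2
    by_cases h0 : μ w = 0
    · rw [(hr0 w hw h0).1, factor_zero]; norm_num
    · exact factor_pos (hr w hw h0).1.le
  have hNmem : ∀ w ∈ N, G.Adj v w ∧ μ w ≠ 0 := fun w hw => (Finset.mem_filter.1 hw).2
  have hlog : Real.log 1002762 - Real.log x = a * Real.log (5 / 3) +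
      (zeroNbrs G μ v - a - e : ℕ) * Real.log 2 + ∑ w ∈ N, logFactor (2 * r w) := by
    rw [hx]; convert h1
  have hrate := hk N (fun w => 2 * r w)
    (fun w hw => by have := (hr w (hNmem w hw).1 (hNmem w hw).2).1; positivity) _ _ x hxpos hlog
  have hEpos : 0 < E := by positivity
  have hE'pos : 0 < E' := by positivity
  have hterm : ∀ w ∈ N, |r' w / ((1 + r w) * (5 + 6 * r w))| ≤
      sensitivity (2 * r w) * density (2 * r w) * E' := fun w hw => by
    obtain ⟨h2, h3⟩ := hr w (hNmem w hw).1 (hNmem w hw).2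
    rw [abs_div, abs_of_pos (by positivity : 0 < (1 + r w) * (5 + 6 * r w)), div_le_iff₀ (by positivity)]
    have e1 : sensitivity (2 * r w) * density (2 * r w) * E' * ((1 + r w) * (5 + 6 * r w)) =
        2 * r w * density (2 * r w) * E' / 2 := by
      rw [sensitivity]
      field_simp
      ring
    rw [e1]
    linarith
  have hsum : |∑ w with G.Adj v w, r' w / ((1 + r w) * (5 + 6 * r w))| ≤
      (∑ w ∈ N, sensitivity (2 * r w) * density (2 * r w)) * E' := by
    have e1 : ∑ w with G.Adj v w, r' w / ((1 + r w) * (5 + 6 * r w)) =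
        ∑ w ∈ N, r' w / ((1 + r w) * (5 + 6 * r w)) := by
      rw [hN, ← Finset.filter_filter]
      symm
      refine Finset.sum_filter_of_ne fun w hw hne h0 => hne ?_
      rw [(hr0 w (Finset.mem_filter.1 hw).2 h0).2, zero_div]
    rw [e1, Finset.sum_mul]
    exact (Finset.abs_sum_le_sum_abs _ _).trans (Finset.sum_le_sum hterm)
  rw [mul_assoc]
  refine mul_le_mul_of_nonneg_left (hsum.trans ?_) hxpos.le
  set T := ∑ w ∈ N, sensitivity (2 * r w) * density (2 * r w) with hT
  -- Without undeleted neighbours the derivative is zero, and the rate inequality only says that the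
  -- density is nonnegative.
  rcases N.eq_empty_or_nonempty with h0 | h0
  · have hT0 : T = 0 := by rw [hT, h0, Finset.sum_empty]
    rw [hT0, mul_zero] at hrate
    rw [hT0, zero_mul]
    exact mul_nonneg hrate hEpos.le
  · have hT0 : 0 ≤ T := Finset.sum_nonneg fun w hw =>
      nonneg_of_mul_nonneg_left ((abs_nonneg _).trans (hterm w hw)) hE'pos
    have hd : 0 < deg G v := by
      have := h0.card_pos
      omega
    have hB := budget_rpow_le (B := B) (k := k) (D := a + (zeroNbrs G μ v - a - e) + N.card) hd
      (by omega)
    set c := (2 * (((a + (zeroNbrs G μ v - a - e) + N.card : ℕ) : ℝ) + 1)) ^ (1 / (k : ℝ)) with hc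
    have hEE : E' ≤ c * E := by
      rw [hE, hE', ← mul_div_assoc, div_le_div_iff₀ (by positivity) (by positivity)]
      nlinarith
    calc T * E' ≤ T * (c * E) := mul_le_mul_of_nonneg_left hEE hT0
      _ = c * T * E := by ring
      _ ≤ density x * E := mul_le_mul_of_nonneg_right hrate hEpos.le

/-- Children always satisfy the slot condition with `e = 1`, while roots need `e = 0`; the induction
carries both. At exhausted budget the derivative is bounded by the ratio itself, and every step
above gains what the division of the budget loses. -/
theorem interp_deriv {k : ℕ} (hk : IsRate k) {t : ℝ} (h0 : 0 ≤ t) (h1 : t ≤ 1) (B : ℕ)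
    (hμ : Admissible G μ) (v : Fin n) : ∃ r' : ℝ, HasDerivAt (fun t => interp G t B μ v) r' t ∧
      (μ v = 0 → r' = 0) ∧ ∀ e ≤ 1, Slot G μ v e → 2 ^ e * |r'| ≤
        2 ^ e * interp G t B μ v * density (2 ^ e * interp G t B μ v) *
          (3000000 / ((B : ℝ) + 1) ^ (1 / (k : ℝ))) := by
  classical
  induction B using Nat.strong_induction_on generalizing μ v with
  | _ B ih =>
    have hnn := hμ.nonneg
    rcases eq_or_ne B 0 with rfl | hB
    · have hle := le_ratio (G := G) hnn v
      have hd : HasDerivAt (fun t => interp G t 0 μ v) (μ v - ratio G μ v) t := by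
        simp only [interp_zero_right]
        have e1 := ((hasDerivAt_id t).const_sub 1).mul_const (ratio G μ v)
        have e2 := (hasDerivAt_id t).mul_const (μ v)
        refine (e1.add e2).congr_deriv ?_
        ring
      refine ⟨_, hd, fun h => by simp [ratio, h], fun e _ hs => ?_⟩
      have hpos := interp_pos (G := G) hnn h0 h1 0 hs.pos.ne'
      have hub := ratio_le hs hnn
      have hile : interp G t 0 μ v ≤ ratio G μ v := by
        rw [interp_zero_right]; nlinarith
      have hp : (0 : ℝ) < 2 ^ e := by positivity
      -- The constant 3000000 is chosen so that (2/5)·3000000 ≥ 1002762, the bound for the scaled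
      -- ratio.
      have hW := mul_density_ge (x := 2 ^ e * interp G t 0 μ v) (by positivity)
        ((mul_le_mul_of_nonneg_left hile hp.le).trans hub)
      have hv := hs.pos
      rw [abs_of_nonpos (by linarith)]
      simp only [Nat.cast_zero, zero_add, Real.one_rpow, div_one]
      nlinarith
    · choose! r' hr' using fun (w : Fin n) (hw : μ v ≠ 0) =>
        ih _ (div_budget_lt hB (deg G v)) (hμ.pin hw w) w
      by_cases hv : μ v = 0
      · refine ⟨0, ?_, fun _ => rfl, fun e _ hs => absurd hv hs.pos.ne'⟩
        simp only [interp_eq_zero _ _ hv]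
        exact hasDerivAt_const t 0
      · have hprod := hasDerivAt_prod_of_log (Finset.univ.filter fun w => G.Adj v w)
          (f := fun w t => factor (interp G t (B / (2 * deg G v)) (pin G μ v w) w)) (t := t)
          fun w _ => hasDerivAt_factor (hr' w hv).1
            (interp_nonneg (pin_nonneg hnn v w) h0 h1 _ w)
        have hd : HasDerivAt (fun t => interp G t B μ v) (interp G t B μ v *
            ∑ w with G.Adj v w, r' w / ((1 + interp G t (B / (2 * deg G v)) (pin G μ v w) w) *
              (5 + 6 * interp G t (B / (2 * deg G v)) (pin G μ v w) w))) t := by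
          simp only [interp_of_ne _ hB]
          refine (hprod.const_mul (μ v)).congr_deriv ?_
          ring
        refine ⟨_, hd, fun h => absurd h hv, fun e he hs => ?_⟩
        rw [abs_mul, abs_of_nonneg (interp_nonneg hnn h0 h1 B v), ← mul_assoc]
        refine abs_step_le hk he hs (by norm_num) (fun w hw hw0 => ?_) (fun w hw hw0 => ?_) ?_
        · have : pin G μ v w w = 0 := pin_eq_zero hw0
          exact ⟨interp_eq_zero _ _ this, (hr' w hv).2.1 this⟩
        · refine ⟨interp_pos (pin_nonneg hnn v w) h0 h1 _ (by rwa [pin_apply_self hw]), ?_⟩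
          have := (hr' w hv).2.2 1 le_rfl (hμ.slot_pin hv hw0 hw)
          simpa using this
        · rw [interp_of_ne t hB]

theorem interp_le_of_slot (hμ : Admissible G μ) {t : ℝ} (h0 : 0 ≤ t) (h1 : t ≤ 1) (B : ℕ)
    {v : Fin n} {e : ℕ} (h : Slot G μ v e) : 2 ^ e * interp G t B μ v ≤ 1002762 := by
  classical
  have hnn := hμ.nonneg
  have hp : (0 : ℝ) < 2 ^ e := by positivity
  rcases eq_or_ne B 0 with rfl | hB
  · have hile : interp G t 0 μ v ≤ ratio G μ v := by
      have := le_ratio (G := G) hnn v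
      rw [interp_zero_right]; nlinarith
    exact (mul_le_mul_of_nonneg_left hile hp.le).trans (ratio_le h hnn)
  · obtain ⟨a, ha, hv⟩ := id h
    have hpos : ∀ w, G.Adj v w → μ w ≠ 0 →
        0 < interp G t (B / (2 * deg G v)) (pin G μ v w) w := fun w hvw hw =>
      interp_pos (pin_nonneg hnn v w) h0 h1 _ (by rwa [pin_apply_self hvw])
    obtain ⟨h2, -⟩ := log_step (G := G) ha hv
      (fun w _ hw => interp_eq_zero t (B / (2 * deg G v)) (pin_eq_zero hw)) hpos
    rw [← interp_of_ne t hB] at h2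
    obtain ⟨-, h3⟩ := ratio_bounds _ _ (fun w hw => by
      have := hpos w (Finset.mem_filter.1 hw).2.1 (Finset.mem_filter.1 hw).2.2
      linarith) _ _ (mul_pos hp (interp_pos hnn h0 h1 B h.pos.ne')) h2
    refine h3.trans ?_
    have := pow_le_one₀ (n := a + (zeroNbrs G μ v - a - e) +
      (Finset.univ.filter fun w => G.Adj v w ∧ μ w ≠ 0).card)
      (by norm_num : (0 : ℝ) ≤ 3 / 5) (by norm_num)
    linarith

/-- The truncated recursion approximates the marginal ratio, with an error that is polynomially
small in the budget. -/
theorem abs_interp_sub_ratio_le {k : ℕ} (hk : IsRate k) (B : ℕ) (hμ : Admissible G μ)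
    (v : Fin n) : |interp G 1 B μ v - ratio G μ v| ≤
      3000000 * 10 ^ 12 / ((B : ℝ) + 1) ^ (1 / (k : ℝ)) := by
  rw [← interp_at_zero hμ.nonneg B v]
  have key : ∀ t : ℝ, 0 ≤ t → t ≤ 1 → ∃ r', HasDerivAt (fun t => interp G t B μ v) r' t ∧
      |r'| ≤ 3000000 * 10 ^ 12 / ((B : ℝ) + 1) ^ (1 / (k : ℝ)) := by
    intro t h0 h1
    obtain ⟨r', h2, h3, h4⟩ := interp_deriv hk h0 h1 B hμ v
    refine ⟨r', h2, ?_⟩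
    have hEpos : (0 : ℝ) < 3000000 / ((B : ℝ) + 1) ^ (1 / (k : ℝ)) := by positivity
    by_cases hv : μ v = 0
    · rw [h3 hv, abs_zero]; positivity
    · have h5 := h4 0 (by norm_num) (hμ v hv)
      have h6 := interp_le_of_slot hμ h0 h1 B (hμ v hv)
      simp only [pow_zero, one_mul] at h5 h6
      have h7 := mul_density_le (interp_pos (G := G) hμ.nonneg h0 h1 B hv) h6
      refine h5.trans ((mul_le_mul_of_nonneg_right h7 hEpos.le).trans (le_of_eq ?_))
      ring
  choose! r' hr' using key
  have := norm_image_sub_le_of_norm_deriv_le_segment_01' (f := fun t => interp G t B μ v)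
    (f' := r') (fun t ht => (hr' t ht.1 ht.2).1.hasDerivWithinAt)
    (fun t ht => (hr' t ht.1 ht.2.le).2)
  simpa using this

/-- As 1 + r_i ≥ 1, absolute errors bound relative ones, and the relative error of the product is at
most e^{nη} - 1 ≤ 2nη. -/
theorem abs_prod_sub_prod_le {η : ℝ} {r s : Fin n → ℝ} (hr : ∀ i, 0 ≤ r i)
    (hs : ∀ i, |s i - r i| ≤ η) (hη : n * η ≤ 1) :
    |∏ i, (1 + s i) - ∏ i, (1 + r i)| ≤ 2 * (n * η) * ∏ i, (1 + r i) := by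
  have hpos : 0 < ∏ i, (1 + r i) := Finset.prod_pos fun i _ => by linarith [hr i]
  set q : Fin n → ℝ := fun i => (s i - r i) / (1 + r i) with hq
  have h1 : ∏ i, (1 + s i) = (∏ i, (1 + r i)) * ∏ i, (1 + q i) := by
    rw [← Finset.prod_mul_distrib]
    refine Finset.prod_congr rfl fun i _ => ?_
    have := hr i
    rw [hq]
    field_simp
    ring
  have h2 : ∑ i, ‖q i‖ ≤ n * η := by
    have : ∑ i, ‖q i‖ ≤ (Finset.univ : Finset (Fin n)).card • η :=
      Finset.sum_le_card_nsmul _ _ _ fun i _ => by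
        rw [hq, Real.norm_eq_abs, abs_div, abs_of_pos (by linarith [hr i] : 0 < 1 + r i)]
        exact (div_le_self (abs_nonneg _) (by linarith [hr i])).trans (hs i)
    simpa using this
  have h3 := Finset.norm_prod_one_add_sub_one_le Finset.univ q
  have h4 : Real.exp (∑ i, ‖q i‖) - 1 ≤ 2 * (n * η) := by
    have h0 : 0 ≤ ∑ i, ‖q i‖ := Finset.sum_nonneg fun i _ => norm_nonneg _
    have h5 := Real.abs_exp_sub_one_le (x := n * η) (by rw [abs_of_nonneg (h0.trans h2)]; exact hη)
    rw [abs_of_nonneg (h0.trans h2)] at h5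
    have h6 := Real.exp_le_exp.2 h2
    have := le_abs_self (Real.exp (n * η) - 1)
    linarith
  have e : ∏ i, (1 + s i) - ∏ i, (1 + r i) = (∏ i, (1 + r i)) * (∏ i, (1 + q i) - 1) := by
    rw [h1]; ring
  rw [e, abs_mul, abs_of_pos hpos, mul_comm]
  exact mul_le_mul_of_nonneg_right ((Real.norm_eq_abs _ ▸ h3).trans h4) hpos.le

/-- With a polynomial budget the approximation of the partition function is as good as wanted. -/
theorem abs_approx_sub_partitionFunction_le {k : ℕ} (hk0 : 0 < k) (hk : IsRate k) {N B : ℕ}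
    (hN : 0 < N) (hB : B = (6 * 10 ^ 18 * n * N) ^ k) :
    |2 ^ innerEdges G Finset.univ *
        ∏ i : Fin n, (1 + interp G 1 B (deleteBelow (baseField G) i) i) -
      partitionFunction 0.6 2 (fun _ => 1002762) G| ≤
      1 / N * partitionFunction 0.6 2 (fun _ => 1002762) G := by
  have hbase : ∀ i, 0 ≤ baseField G i := fun i => (baseField_pos i).le
  have hNr : (1 : ℝ) ≤ N := by exact_mod_cast hN
  -- 6·10^18 is twice 3000000·10^12, the error constant of `abs_interp_sub_ratio_le`; the k-th power
  -- undoes the exponent 1/k.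
  have hroot : 6 * 10 ^ 18 * (n : ℝ) * N ≤ ((B : ℝ) + 1) ^ (1 / (k : ℝ)) := by
    have h1 : ((6 * 10 ^ 18 * (n : ℝ) * N) ^ k) ^ (1 / (k : ℝ)) = 6 * 10 ^ 18 * (n : ℝ) * N := by
      rw [one_div]
      exact Real.pow_rpow_inv_natCast (by positivity) hk0.ne'
    rw [← h1]
    refine Real.rpow_le_rpow (by positivity) ?_ (by positivity)
    have : (B : ℝ) = (6 * 10 ^ 18 * (n : ℝ) * N) ^ k := by rw [hB]; norm_num
    linarith
  set ρ := ((B : ℝ) + 1) ^ (1 / (k : ℝ)) with hρ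
  have hρ0 : 0 < ρ := by positivity
  have hη : n * (3000000 * 10 ^ 12 / ρ) ≤ 1 / (2 * N) := by
    rw [mul_div_assoc', div_le_div_iff₀ hρ0 (by positivity)]
    linarith
  have hη1 : 1 / (2 * (N : ℝ)) ≤ 1 := by
    rw [div_le_one (by positivity)]; linarith
  have h1 := abs_prod_sub_prod_le (fun i => ratio_nonneg (G := G) (deleteBelow_nonneg hbase i) i)
    (fun i => abs_interp_sub_ratio_le hk B (admissible_deleteBelow (G := G) i) i)
    (hη.trans hη1)
  rw [← subsetSum_eq_prod hbase] at h1
  have hpos := subsetSum_pos (G := G) hbase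
  rw [partitionFunction_eq, ← mul_sub, abs_mul, abs_of_pos (by positivity)]
  have h2 : 2 * (n * (3000000 * 10 ^ 12 / ρ)) ≤ 1 / N := by
    have : 1 / (N : ℝ) = 2 * (1 / (2 * N)) := by field_simp
    rw [this]; linarith
  calc _ ≤ 2 ^ innerEdges G Finset.univ * (1 / (N : ℝ) * subsetSum G (baseField G)) := by
        gcongr
        exact h1.trans (mul_le_mul_of_nonneg_right h2 hpos.le)
    _ = _ := by ring

end

end TwoSpin

namespace LoopMachine

open Data Enc

/-! ### Folds, list access and loops in polynomial time -/

section

variable {α β γ δ η : Type} [Enc α] [Enc β] [Enc γ] [Enc δ] [Enc η]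

/-- The growth is measured by the length of a polynomial-time function `h`, typically the item that
is added, so no explicit polynomial is needed. -/
theorem FP.foldl_of_growth {f : γ × (α × β) → β} (hf : FP f) {h : γ × α → η} (hh : FP h) (K : ℕ)
    (hq : ∀ c x b, sz (f (c, x, b)) ≤ sz b + K * sz (h (c, x)) + K) {c : δ → γ} {l : δ → List α}
    {b : δ → β} (hc : FP c) (hl : FP l) (hb : FP b) :
    FP fun d => (l d).foldl (fun b x => f (c d, x, b)) (b d) := by
  obtain ⟨q, hqq⟩ := hh.sz_le
  refine FP.foldl hf (q := Polynomial.C K * q.comp (Polynomial.X + 1) + Polynomial.C K)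
    (fun c x b => (hq c x b).trans ?_) hc hl hb
  have := Nat.mul_le_mul_left K (hqq (c, x))
  rw [sz_pair c x] at this
  simp only [Polynomial.eval_add, Polynomial.eval_mul, Polynomial.eval_C, Polynomial.eval_comp,
    Polynomial.eval_X, Polynomial.eval_one]
  omega

theorem FP.prod_map {h : γ × α → ℕ} (hh : FP h) {c : δ → γ} {l : δ → List α} (hc : FP c)
    (hl : FP l) : FP fun d => ((l d).map fun x => h (c d, x)).prod := by
  have h1 : FP fun s : γ × (α × ℕ) => s.2.2 * h (s.1, s.2.1) :=
    FP.snd'.snd.mul (hh.comp (FP.fst'.pair FP.snd'.fst))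
  have h2 := FP.foldl_of_growth h1 hh 1 (fun c x b => by
    have := natSize_mul_le b (h (c, x))
    simp only [sz_nat]
    omega) hc hl (FP.const (α := δ) 1)
  convert h2 using 2 with d
  rw [List.prod_eq_foldl, List.foldl_map]

theorem FP.sum_map {h : γ × α → ℕ} (hh : FP h) {c : δ → γ} {l : δ → List α} (hc : FP c)
    (hl : FP l) : FP fun d => ((l d).map fun x => h (c d, x)).sum := by
  have h1 : FP fun s : γ × (α × ℕ) => s.2.2 + h (s.1, s.2.1) :=
    FP.snd'.snd.add (hh.comp (FP.fst'.pair FP.snd'.fst))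
  have h2 := FP.foldl_of_growth h1 hh 1 (fun c x b => by
    have := natSize_add_le b (h (c, x))
    simp only [sz_nat]
    omega) hc hl (FP.const (α := δ) 0)
  convert h2 using 2 with d
  rw [List.sum_eq_foldl, List.foldl_map]

/-- The counter starts at the index plus one and picks the entry when it is 1; truncated subtraction
keeps it at 0 afterwards. -/
theorem foldl_countdown {α : Type} (l : List α) (k : ℕ) (r : α) :
    (l.foldl (fun (b : ℕ × α) x => (b.1 - 1, if b.1 = 1 then x else b.2)) (k, r)).2 =
      if k = 0 then r else l.getD (k - 1) r := by
  induction l generalizing k r with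
  | nil => simp
  | cons x l ih =>
    rw [List.foldl_cons, ih]
    rcases k with _ | _ | k <;> simp

theorem FP.getD {l : γ → List α} {i : γ → ℕ} (hl : FP l) (hi : FP i) (d : α) :
    FP fun c => (l c).getD (i c) d := by
  have h1 : FP fun s : ℕ × (α × (ℕ × α)) =>
      (s.2.2.1 - 1, if s.2.2.1 = 1 then s.2.1 else s.2.2.2) :=
    (FP.snd'.snd.fst.sub (.const 1)).pair
      ((FPred.eq FP.snd'.snd.fst (.const 1)).ite FP.snd'.fst FP.snd'.snd.snd)
  have h2 := FP.foldl_of_growth h1 (h := fun s => s.2) FP.snd' 1 (fun c x b => by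
    have := Nat.size_le_size (Nat.sub_le b.1 1)
    obtain ⟨k, r⟩ := b
    simp only [sz_pair, sz_nat] at this ⊢
    split_ifs <;> omega) (FP.const (α := γ) 0) hl ((hi.add (.const 1)).pair (.const d))
  convert h2.snd using 2 with c
  rw [foldl_countdown]
  simp

/-- A while loop whose potential decreases. -/
theorem PolyTime.loop_of_potential {c : α → ℕ} {f : α → α} (hc : FP c) (hf : FP f) {P : α → ℕ}
    (hP : ∀ a, sz a ≤ P a) (hdec : ∀ a, c a ≠ 0 → P (f a) < P a) :
    (∀ a, c (whileIter c f (sz a + P a) a) = 0) ∧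
      PolyTime P fun a => whileIter c f (sz a + P a) a := by
  have h1 : ∀ k a, P (whileIter c f k a) ≤ P a := by
    intro k
    induction k with
    | zero => intro a; rfl
    | succ k ih =>
      intro a
      rw [whileIter]
      split_ifs with h
      · rfl
      · exact (ih _).trans (hdec a h).le
  have h2 : ∀ k a, P a ≤ k → c (whileIter c f k a) = 0 := by
    intro k
    induction k with
    | zero =>
      intro a h
      by_contra h'
      have := hdec a h'
      omega
    | succ k ih =>
      intro a h
      rw [whileIter]
      split_ifs with h'
      · exact h'
      · exact ih _ (by have := hdec a h'; omega)
  refine ⟨fun a => h2 _ a (by omega), ?_⟩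
  have := PolyTime.loop hc hf (m := P) (S := Polynomial.X) (N := Polynomial.X)
    (fun a k => ((hP _).trans (h1 k a)).trans (by simp)) (fun a => h2 _ a (by simp))
  simpa using this

end

/-! ### The algorithm -/

/-- An entry of a matrix given by its rows. -/
def entry (A : List (List ℕ)) (i j : ℕ) : ℕ := (A.getD i []).getD j 0

/-- The matrix, and a list of the vertices. -/
abbrev Context := List (List ℕ) × List ℕ

/-- A pending task: either to evaluate the ratio at `v` after the deletions described by a path,
with budget `B`, or (`none`) to multiply a factor into a product. -/
abbrev Task := Option (List (ℕ × ℕ) × (ℕ × ℕ))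

/-- The state of the evaluation: context, pending tasks, and a stack of fractions. -/
abbrev State := Context × (List Task × List (ℕ × ℕ))

/-- The numerator of the rescaling of the field at `v` by one deletion. -/
def scaleNum (A : List (List ℕ)) (v : ℕ) (e : ℕ × ℕ) : ℕ :=
  if v = e.1 then 0 else if ¬ entry A e.1 v = 0 ∧ v < e.2 then 6 else 1

/-- The denominator of the rescaling of the field at `v` by one deletion. -/
def scaleDen (A : List (List ℕ)) (v : ℕ) (e : ℕ × ℕ) : ℕ :=
  if v = e.1 then 1 else if ¬ entry A e.1 v = 0 ∧ v < e.2 then 5 else 1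

/-- The field at `v` after the deletions described by a path, as a fraction. -/
def fieldFrac (A : List (List ℕ)) (path : List (ℕ × ℕ)) (v : ℕ) : ℕ × ℕ :=
  (1002762 * (path.map (scaleNum A v)).prod,
    ((A.getD v []).map (· + 1)).prod * (path.map (scaleDen A v)).prod)

/-- The number of neighbours of a vertex. -/
def degree (C : Context) (v : ℕ) : ℕ := (C.2.map fun w => if entry C.1 v w = 0 then 0 else 1).sum

/-- The tasks for the neighbours of `v`, put in front of `todo`. -/
def pushChildren (C : Context) (path : List (ℕ × ℕ)) (v B : ℕ) (todo : List Task) : List Task :=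
  C.2.foldl (fun l w => if entry C.1 v w = 0 then l else some ((v, w) :: path, (w, B)) :: none :: l)
    todo

/-- Multiplication of a product by the factor of a neighbour. -/
def mulFactor (b a : ℕ × ℕ) : ℕ × ℕ := (b.1 * (6 * a.1 + 5 * a.2), b.2 * (5 * a.1 + 5 * a.2))

/-- The multiplication task on the stack. -/
def mulTop : List (ℕ × ℕ) → List (ℕ × ℕ)
  | a :: b :: l => mulFactor b a :: l
  | _ => []

/-- One step of the evaluation. -/
def step : State → State
  | (C, [], vals) => (C, [], vals)
  | (C, none :: todo, vals) => (C, todo, mulTop vals)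
  | (C, some (path, v, B) :: todo, vals) =>
    (C, if B = 0 then todo else pushChildren C path v (B / (2 * degree C v)) todo,
      fieldFrac C.1 path v :: vals)

/-- The number of pending tasks. -/
def pending (s : State) : ℕ := s.2.1.length.min 1

section

variable {α β : Type} [Enc α] [Enc β]

theorem FP.entry {A : α → List (List ℕ)} {i j : α → ℕ} (hA : FP A) (hi : FP i) (hj : FP j) :
    FP fun a => entry (A a) (i a) (j a) :=
  FP.getD (FP.getD hA hi []) hj 0

theorem FP.scaleTest : FPred fun s : (List (List ℕ) × ℕ) × (ℕ × ℕ) =>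
    ¬ LoopMachine.entry s.1.1 s.2.1 s.1.2 = 0 ∧ s.1.2 < s.2.2 :=
  (FPred.eq (FP.entry FP.fst'.fst FP.snd'.fst FP.fst'.snd) (.const 0)).not.and
    (FPred.lt FP.fst'.snd FP.snd'.snd)

theorem FP.scaleNum : FP fun s : (List (List ℕ) × ℕ) × (ℕ × ℕ) => scaleNum s.1.1 s.1.2 s.2 :=
  (FPred.eq FP.fst'.snd FP.snd'.fst).ite (.const 0) (FP.scaleTest.ite (.const 6) (.const 1))

theorem FP.scaleDen : FP fun s : (List (List ℕ) × ℕ) × (ℕ × ℕ) => scaleDen s.1.1 s.1.2 s.2 :=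
  (FPred.eq FP.fst'.snd FP.snd'.fst).ite (.const 1) (FP.scaleTest.ite (.const 5) (.const 1))

theorem FP.fieldFrac {A : α → List (List ℕ)} {path : α → List (ℕ × ℕ)} {v : α → ℕ} (hA : FP A)
    (hp : FP path) (hv : FP v) : FP fun a => fieldFrac (A a) (path a) (v a) :=
  ((FP.const 1002762).mul (FP.scaleNum.prod_map (hA.pair hv) hp)).pair
    ((FP.prod_map (h := fun s : ℕ × ℕ => s.2 + 1) (FP.snd'.add (.const 1)) (FP.const 0)
      (FP.getD hA hv [])).mul (FP.scaleDen.prod_map (hA.pair hv) hp))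

theorem FP.degree {C : α → Context} {v : α → ℕ} (hC : FP C) (hv : FP v) :
    FP fun a => degree (C a) (v a) :=
  FP.sum_map (h := fun s : (Context × ℕ) × ℕ =>
      if LoopMachine.entry s.1.1.1 s.1.2 s.2 = 0 then 0 else 1)
    ((FPred.eq (FP.entry FP.fst'.fst.fst FP.fst'.snd FP.snd') (.const 0)).ite (.const 0) (.const 1))
    (hC.pair hv) hC.snd

theorem FP.noTask : FP fun _ : α => (none : Task) := FP.const _

theorem FP.pushChildren {C : α → Context} {path : α → List (ℕ × ℕ)} {v B : α → ℕ}
    {todo : α → List Task} (hC : FP C) (hp : FP path) (hv : FP v) (hB : FP B) (ht : FP todo) :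
    FP fun a => pushChildren (C a) (path a) (v a) (B a) (todo a) := by
  have h1 : FP fun s : (Context × (List (ℕ × ℕ) × (ℕ × ℕ))) × (ℕ × List Task) =>
      if LoopMachine.entry s.1.1.1 s.1.2.2.1 s.2.1 = 0 then s.2.2 else
        some ((s.1.2.2.1, s.2.1) :: s.1.2.1, (s.2.1, s.1.2.2.2)) :: none :: s.2.2 :=
    (FPred.eq (FP.entry FP.fst'.fst.fst FP.fst'.snd.snd.fst FP.snd'.fst) (.const 0)).ite
      FP.snd'.snd
      (((((FP.fst'.snd.snd.fst.pair FP.snd'.fst).cons FP.fst'.snd.fst).pair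
        (FP.snd'.fst.pair FP.fst'.snd.snd.snd)).optSome).cons (FP.noTask.cons FP.snd'.snd))
  have h2 : FP fun s : (Context × (List (ℕ × ℕ) × (ℕ × ℕ))) × ℕ =>
      (some ((s.1.2.2.1, s.2) :: s.1.2.1, (s.2, s.1.2.2.2)) : Task) :=
    ((((FP.fst'.snd.snd.fst.pair FP.snd').cons FP.fst'.snd.fst).pair
        (FP.snd'.pair FP.fst'.snd.snd.snd)).optSome)
  exact FP.foldl_of_growth h1 h2 3 (fun c x b => by
    simp only
    split_ifs
    · omega
    · rw [sz_cons, sz_cons, sz_none]; omega) (hC.pair (hp.pair (hv.pair hB))) hC.snd ht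

theorem FP.mulFactor {a b : α → ℕ × ℕ} (hb : FP b) (ha : FP a) :
    FP fun x => mulFactor (b x) (a x) :=
  (hb.fst.mul (((FP.const 6).mul ha.fst).add ((FP.const 5).mul ha.snd))).pair
    (hb.snd.mul (((FP.const 5).mul ha.fst).add ((FP.const 5).mul ha.snd)))

theorem FP.mulTop : FP mulTop := by
  have h1 : FP fun s : List (ℕ × ℕ) × ((ℕ × ℕ) × List (ℕ × ℕ)) => LoopMachine.mulTop (s.2.1 :: s.2.2) := by
    refine FP.listCase (l := fun s : List (ℕ × ℕ) × ((ℕ × ℕ) × List (ℕ × ℕ)) => s.2.2)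
      (g := fun _ => []) (h := fun s => LoopMachine.mulFactor s.2.1 s.1.2.1 :: s.2.2) FP.snd'.snd (.const [])
      ((FP.mulFactor FP.snd'.fst FP.fst'.snd.fst).cons FP.snd'.snd) ?_ ?_
    · intro c h
      simp only [h, LoopMachine.mulTop]
    · intro c x l h
      simp only [h, LoopMachine.mulTop]
  refine FP.listCase (l := fun s : List (ℕ × ℕ) => s) (g := fun _ => []) FP.id (.const []) h1 ?_ ?_
  · rintro _ rfl; rfl
  · rintro _ x l rfl; rfl

theorem FP.step : FP step := by
  have h1 : FP fun s : State × (Task × List Task) => LoopMachine.step (s.1.1, s.2.1 :: s.2.2, s.1.2.2) := by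
    refine FP.optionCase (o := fun s : State × (Task × List Task) => s.2.1)
      (g := fun s => (s.1.1, s.2.2, LoopMachine.mulTop s.1.2.2))
      (h := fun s => (s.1.1.1, if s.2.2.2 = 0 then s.1.2.2 else LoopMachine.pushChildren s.1.1.1 s.2.1 s.2.2.1
          (s.2.2.2 / (2 * LoopMachine.degree s.1.1.1 s.2.2.1)) s.1.2.2,
        LoopMachine.fieldFrac s.1.1.1.1 s.2.1 s.2.2.1 :: s.1.1.2.2)) FP.snd'.fst
      (FP.fst'.fst.pair (FP.snd'.snd.pair (FP.mulTop.comp FP.fst'.snd.snd))) ?_ ?_ ?_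
    · have hC : FP fun s : (State × (Task × List Task)) × (List (ℕ × ℕ) × (ℕ × ℕ)) => s.1.1.1 :=
        FP.fst'.fst.fst
      exact hC.pair (((FPred.eq FP.snd'.snd.snd (.const 0)).ite FP.fst'.snd.snd
        (FP.pushChildren hC FP.snd'.fst FP.snd'.snd.fst
          (FP.snd'.snd.snd.div ((FP.const 2).mul (FP.degree hC FP.snd'.snd.fst))) FP.fst'.snd.snd)).pair
        ((FP.fieldFrac hC.fst FP.snd'.fst FP.snd'.snd.fst).cons FP.fst'.fst.snd.snd))
    · intro c h
      simp only [h, LoopMachine.step]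
    · rintro c ⟨p, v, B⟩ h
      simp only [h, LoopMachine.step]
  refine FP.listCase (l := fun s : State => s.2.1) (g := fun s => s) FP.snd'.fst .id h1 ?_ ?_
  · rintro ⟨C, l, vals⟩ h
    subst h
    rfl
  · rintro ⟨C, l, vals⟩ x l' h
    subst h
    rfl

theorem FP.pending : FP pending := by
  refine FP.listCase (l := fun s : State => s.2.1) (g := fun _ => 0) (h := fun _ => 1)
    FP.snd'.fst (.const 0) (.const 1) ?_ ?_
  · intro c h; simp [LoopMachine.pending, h]
  · intro c x l h; simp [LoopMachine.pending, h]

end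

/-! ### The potential -/

/-- The potential of a task. -/
def taskPotential (C : Context) : Task → ℕ
  | none => 6
  | some (path, v, B) =>
    12 * ((sz path + sz v + sz B + 4 * sz C * (B + 1)) * (1 + 4 * sz C * B))

/-- The potential of a fraction. -/
def fracPotential (a : ℕ × ℕ) : ℕ := 2 * max (Nat.size a.1) (Nat.size a.2) + 4

/-- The potential of a state: it bounds the length of the state and decreases in each step. -/
def potential (s : State) : ℕ :=
  sz s.1 + (s.2.1.map (taskPotential s.1)).sum + (s.2.2.map fracPotential).sum + 10

theorem sz_le_taskPotential (C : Context) (t : Task) : sz t + 1 ≤ taskPotential C t := by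
  rcases t with _ | ⟨p, v, B⟩
  · rw [sz_none, taskPotential]; omega
  · rw [sz_some, taskPotential, sz_pair, sz_pair]
    have h1 := sz_pos p
    have h2 : sz p + sz v + sz B ≤ (sz p + sz v + sz B + 4 * sz C * (B + 1)) * (1 + 4 * sz C * B) :=
      le_trans (by omega) (Nat.le_mul_of_pos_right _ (by omega))
    omega

theorem sz_le_potential (s : State) : sz s ≤ potential s := by
  obtain ⟨C, todo, vals⟩ := s
  have h1 : sz todo ≤ (todo.map (taskPotential C)).sum + 1 := by
    induction todo with
    | nil => simp [sz_nil]
    | cons t l ih =>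
      have := sz_le_taskPotential C t
      rw [sz_cons, List.map_cons, List.sum_cons]
      omega
  have h2 : sz vals ≤ (vals.map fracPotential).sum + 1 := by
    induction vals with
    | nil => simp [sz_nil]
    | cons t l ih =>
      obtain ⟨x, y⟩ := t
      rw [sz_cons, List.map_cons, List.sum_cons, fracPotential, sz_pair x y, sz_nat, sz_nat]
      simp only
      omega
  rw [sz_pair C, sz_pair todo, potential]
  simp only
  omega

theorem natSize_prod_map_le {α : Type} (l : List α) (f : α → ℕ) :
    Nat.size (l.map f).prod ≤ (l.map fun x => Nat.size (f x)).sum + 1 := by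
  induction l with
  | nil => simp
  | cons x l ih =>
    have := natSize_mul_le (f x) (l.map f).prod
    rw [List.map_cons, List.prod_cons, List.map_cons, List.sum_cons]
    omega

theorem sz_getD_le (A : List (List ℕ)) (v : ℕ) : sz (A.getD v []) ≤ sz A := by
  rw [List.getD_eq_getElem?_getD]
  rcases h : A[v]? with _ | r
  · have := sz_pos A
    rw [Option.getD_none, sz_nil]; omega
  · exact sz_le_of_mem (List.mem_of_getElem? h)

theorem sum_map_le_length_mul {α : Type} (l : List α) (f : α → ℕ) (k : ℕ) (h : ∀ x, f x ≤ k) :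
    (l.map f).sum ≤ l.length * k := by
  induction l with
  | nil => simp
  | cons x l ih =>
    have := h x
    rw [List.map_cons, List.sum_cons, List.length_cons, Nat.succ_mul]; omega

theorem fracPotential_fieldFrac_le (C : Context) (path : List (ℕ × ℕ)) (v : ℕ) :
    fracPotential (fieldFrac C.1 path v) ≤ 2 * sz C + 6 * sz path + 44 := by
  have h1 : ∀ e, Nat.size (scaleNum C.1 v e) ≤ 3 := fun e => by
    rw [scaleNum, Nat.size_le]; split_ifs <;> norm_num
  have h2 : ∀ e, Nat.size (scaleDen C.1 v e) ≤ 3 := fun e => by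
    rw [scaleDen, Nat.size_le]; split_ifs <;> norm_num
  have h3 := (natSize_prod_map_le path (scaleNum C.1 v)).trans
    (Nat.succ_le_succ (sum_map_le_length_mul path _ 3 h1))
  have h4 := (natSize_prod_map_le path (scaleDen C.1 v)).trans
    (Nat.succ_le_succ (sum_map_le_length_mul path _ 3 h2))
  have h5 := natSize_prod_map_le (C.1.getD v []) (· + 1)
  have h6 : ∀ l : List ℕ, (l.map fun x => Nat.size (x + 1)).sum + 1 ≤ sz l := by
    intro l
    induction l with
    | nil => simp [sz_nil]
    | cons x l ih =>
      have : Nat.size (x + 1) ≤ Nat.size x + 1 := by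
        rw [Nat.size_le, pow_succ]
        have := Nat.lt_size_self x
        omega
      rw [List.map_cons, List.sum_cons, sz_cons, sz_nat]
      omega
  have h7 := h6 (C.1.getD v [])
  have h8 := sz_getD_le C.1 v
  have h9 : sz C.1 ≤ sz C := by
    obtain ⟨A, idx⟩ := C
    rw [sz_pair]; simp only; omega
  have h10 := natSize_mul_le 1002762 (path.map (scaleNum C.1 v)).prod
  have h11 : Nat.size 1002762 ≤ 20 := by rw [Nat.size_le]; norm_num
  have h12 := natSize_mul_le ((C.1.getD v []).map (· + 1)).prod (path.map (scaleDen C.1 v)).prod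
  have h13 := length_le_sz path
  rw [fracPotential, fieldFrac]
  simp only
  omega

/-- Bit lengths add under multiplication. The excess 4 is paid by the potential 6 of the
multiplication task that disappears. -/
theorem fracPotential_mulFactor_le (a b : ℕ × ℕ) :
    fracPotential (mulFactor b a) ≤ fracPotential b + fracPotential a + 4 := by
  obtain ⟨x, y⟩ := a
  obtain ⟨z, w⟩ := b
  set m := max (Nat.size x) (Nat.size y) with hm
  have hx : x < 2 ^ m := (Nat.lt_size_self x).trans_le
    (Nat.pow_le_pow_right (by norm_num) (le_max_left _ _))
  have hy : y < 2 ^ m := (Nat.lt_size_self y).trans_le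
    (Nat.pow_le_pow_right (by norm_num) (le_max_right _ _))
  have h1 : Nat.size (6 * x + 5 * y) ≤ m + 4 := by
    rw [Nat.size_le, pow_add]; omega
  have h2 : Nat.size (5 * x + 5 * y) ≤ m + 4 := by
    rw [Nat.size_le, pow_add]; omega
  have h3 := natSize_mul_le z (6 * x + 5 * y)
  have h4 := natSize_mul_le w (5 * x + 5 * y)
  simp only [fracPotential, mulFactor]
  omega

theorem sum_mulTop_le (vals : List (ℕ × ℕ)) : ((mulTop vals).map fracPotential).sum ≤
    (vals.map fracPotential).sum + 4 := by
  rcases vals with _ | ⟨a, _ | ⟨b, l⟩⟩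
  · simp [mulTop]
  · simp [mulTop]
  · have := fracPotential_mulFactor_le a b
    simp only [mulTop, List.map_cons, List.sum_cons]
    omega

theorem sum_pushChildren_le (C : Context) (path : List (ℕ × ℕ)) (v B : ℕ) (todo : List Task) :
    ((pushChildren C path v B todo).map (taskPotential C)).sum ≤
      (todo.map (taskPotential C)).sum + degree C v *
        (12 * ((sz path + sz v + 2 * sz C + 2 + sz B + 4 * sz C * (B + 1)) * (1 + 4 * sz C * B)) + 6) := by
  have hmem : ∀ w ∈ C.2, sz w ≤ sz C := fun w hw => (sz_le_of_mem hw).trans (by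
    obtain ⟨A, idx⟩ := C
    rw [sz_pair]; simp only; omega)
  set R := 12 * ((sz path + sz v + 2 * sz C + 2 + sz B + 4 * sz C * (B + 1)) *
    (1 + 4 * sz C * B)) + 6 with hR
  rw [pushChildren, degree]
  generalize C.2 = l at hmem
  induction l generalizing todo with
  | nil => simp
  | cons w l ih =>
    have hw := hmem w List.mem_cons_self
    have ih := ih (if entry C.1 v w = 0 then todo else
      some ((v, w) :: path, (w, B)) :: none :: todo) fun w hw => hmem w (List.mem_cons_of_mem _ hw)
    rw [List.foldl_cons, List.map_cons, List.sum_cons]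
    refine ih.trans ?_
    split_ifs with h
    · rw [zero_add]
    · rw [List.map_cons, List.map_cons, List.sum_cons, List.sum_cons, add_mul, one_mul]
      have : taskPotential C (some ((v, w) :: path, (w, B))) ≤
          12 * ((sz path + sz v + 2 * sz C + 2 + sz B + 4 * sz C * (B + 1)) *
            (1 + 4 * sz C * B)) := by
        rw [taskPotential, sz_cons, sz_pair]
        gcongr 12 * (?_ * _)
        omega
      rw [taskPotential]
      omega

theorem degree_le (C : Context) (v : ℕ) : degree C v ≤ sz C := by
  have h1 := sum_map_le_length_mul C.2 (fun w => if entry C.1 v w = 0 then 0 else 1) 1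
    (fun w => by split_ifs <;> omega)
  have h2 := length_le_sz C.2
  have h3 : sz C.2 ≤ sz C := by
    obtain ⟨A, idx⟩ := C
    rw [sz_pair]; simp only; omega
  rw [degree]
  omega

/-- The children's budgets add up to at most half of B, so the factor 1 + 4SB, summed over the
children, drops to at most S + 2SB. The remaining Y(1 + S) pays for the new fraction and the
multiplication tasks. -/
theorem potential_step_lt (s : State) (h : pending s ≠ 0) : potential (step s) < potential s := by
  obtain ⟨C, todo, vals⟩ := s
  rcases todo with _ | ⟨_ | ⟨path, v, B⟩, todo⟩
  · simp [pending] at h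
  · have := sum_mulTop_le vals
    simp only [step, potential, List.map_cons, List.sum_cons, taskPotential]
    omega
  · have hval := fracPotential_fieldFrac_le C path v
    have hC := sz_pos C
    rcases Nat.eq_zero_or_pos B with rfl | hB
    · simp only [step, potential, List.map_cons, List.sum_cons, taskPotential, if_true]
      omega
    · set d := degree C v with hd
      set S := sz C with hS
      have hch := sum_pushChildren_le C path v (B / (2 * d)) todo
      have hdS : d ≤ S := degree_le C v
      have hdB : 2 * d * (B / (2 * d)) ≤ B := Nat.mul_div_le B (2 * d)
      have hB2 : d ≠ 0 → B / (2 * d) + 1 ≤ B := by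
        intro hd0
        have : B / (2 * d) < B := Nat.div_lt_self hB (by omega)
        omega
      have hszB : sz (B / (2 * d)) ≤ sz B := by
        have := Nat.size_le_size (Nat.div_le_self B (2 * d))
        simp only [sz_nat]; omega
      simp only [step, potential, List.map_cons, List.sum_cons, taskPotential, hB.ne', if_false]
      rw [← hd, ← hS] at *
      set B' := B / (2 * d) with hB'
      set Y := sz path + sz v + sz B + 4 * S * (B + 1) with hY
      set Y' := sz path + sz v + 2 * S + 2 + sz B' + 4 * S * (B' + 1) with hY'
      have key : d * (12 * (Y' * (1 + 4 * S * B')) + 6) ≤ 12 * (Y * (S + 2 * S * B)) + 6 * S := by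
        rcases Nat.eq_zero_or_pos d with h0 | h0
        · rw [h0]; omega
        -- Each level lowers the budget by at least one and so frees 4S, which covers the longer
        -- path of the children.
        · have e1 : 4 * S * (B' + 1) + 4 * S ≤ 4 * S * (B + 1) := by
            have := Nat.mul_le_mul_left (4 * S) (hB2 h0.ne')
            rw [Nat.mul_add (4 * S) B 1]; omega
          have e2 : Y' ≤ Y := by omega
          have e3 : d * (1 + 4 * S * B') ≤ S + 2 * S * B := by
            have := Nat.mul_le_mul_left (2 * S) hdB
            nlinarith
          calc d * (12 * (Y' * (1 + 4 * S * B')) + 6) =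
              12 * (Y' * (d * (1 + 4 * S * B'))) + 6 * d := by ring
            _ ≤ 12 * (Y * (S + 2 * S * B)) + 6 * S := by gcongr
      have e4 : S + 2 * S * B + (1 + S) ≤ 1 + 4 * S * B := by nlinarith
      have e5 : Y * (S + 2 * S * B) + Y * (1 + S) ≤ Y * (1 + 4 * S * B) := by
        rw [← Nat.mul_add]; exact Nat.mul_le_mul_left Y e4
      have e6 : Y * 2 ≤ Y * (1 + S) := Nat.mul_le_mul_left Y (by omega)
      have e7 : sz path + 4 * S ≤ Y := by
        have : 4 * S * 1 ≤ 4 * S * (B + 1) := Nat.mul_le_mul_left _ (by omega)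
        omega
      omega

/-- The evaluation loop. -/
def evalLoop (s : State) : State := whileIter pending step (sz s + potential s) s

theorem pending_evalLoop (s : State) : pending (evalLoop s) = 0 :=
  (PolyTime.loop_of_potential FP.pending FP.step sz_le_potential potential_step_lt).1 s

theorem PolyTime.evalLoop : PolyTime potential evalLoop :=
  (PolyTime.loop_of_potential FP.pending FP.step sz_le_potential potential_step_lt).2

/-- The loop computes any halted state that the evaluation reaches. -/
theorem evalLoop_eq {s s' : State} {i : ℕ} (h : whileIter pending step i s = s')
    (hs' : pending s' = 0) : LoopMachine.evalLoop s = s' := by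
  have h1 := whileIter_add pending step i (sz s + potential s) s
  have h2 := whileIter_add pending step (sz s + potential s) i s
  rw [h, whileIter_of_halted step hs'] at h1
  rw [Nat.add_comm, h1] at h2
  rw [h2]
  exact (whileIter_of_halted step (pending_evalLoop s) i).symm

theorem sum_map_le_length_mul_of_mem {α : Type} {l : List α} {f : α → ℕ} {k : ℕ}
    (h : ∀ x ∈ l, f x ≤ k) : (l.map f).sum ≤ l.length * k := by
  induction l with
  | nil => simp
  | cons x l ih =>
    have := h x List.mem_cons_self
    have := ih fun y hy => h y (List.mem_cons_of_mem _ hy)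
    rw [List.map_cons, List.sum_cons, List.length_cons, Nat.succ_mul]; omega

theorem potential_le (C : Context) (todo : List Task) (M T : ℕ) (hT : sz (C, todo, ([] : List (ℕ × ℕ))) ≤ T)
    (hM : ∀ p v B, some (p, v, B) ∈ todo → B ≤ M) :
    potential (C, todo, []) ≤ T + T * (12 * ((T + 4 * T * (M + 1)) * (1 + 4 * T * M)) + 6) + 10 := by
  rw [sz_pair C, sz_pair todo] at hT
  have h1 : (todo.map (taskPotential C)).sum ≤
      todo.length * (12 * ((T + 4 * T * (M + 1)) * (1 + 4 * T * M)) + 6) := by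
    refine sum_map_le_length_mul_of_mem fun t ht => ?_
    have h2 := sz_le_of_mem ht
    rcases t with _ | ⟨p, v, B⟩
    · rw [taskPotential]; omega
    · have h3 := hM p v B ht
      rw [sz_some, sz_pair p, sz_pair v] at h2
      rw [taskPotential]
      have h4 : sz p + sz v + sz B ≤ T := by omega
      have h5 : sz C ≤ T := by omega
      calc 12 * ((sz p + sz v + sz B + 4 * sz C * (B + 1)) * (1 + 4 * sz C * B))
          ≤ 12 * ((T + 4 * T * (M + 1)) * (1 + 4 * T * M)) := by gcongr
        _ ≤ _ := Nat.le_add_right _ _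
  have h6 := length_le_sz todo
  have h7 : todo.length ≤ T := by omega
  have h8 := Nat.mul_le_mul_right (12 * ((T + 4 * T * (M + 1)) * (1 + 4 * T * M)) + 6) h7
  rw [potential]
  simp only [List.map_nil, List.sum_nil]
  omega

/-! ### The complete algorithm and its running time -/

/-- The list `0, …, N - 1`, where `N` is the number of rows. -/
def vertices (A : List (List ℕ)) : List ℕ :=
  (A.foldl (fun (b : ℕ × List ℕ) _ => (b.1 - 1, (A.length - (A.length - b.1) - 1) :: b.2))
    (A.length, [])).2

/-- The deletions of the vertices below `i`. -/
def rootPath (idx : List ℕ) (i : ℕ) : List (ℕ × ℕ) :=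
  idx.foldl (fun l j => if j < i then (j, 0) :: l else l) []

/-- The tasks to evaluate all factors of the partition function. -/
def rootTasks (idx : List ℕ) (B : ℕ) (l : List ℕ) (todo : List Task) : List Task :=
  l.foldl (fun l i => some (rootPath idx i, (i, B)) :: l) todo

/-- The branching budget. -/
def budget (k : ℕ) (x : List (List ℕ) × (ℕ × ℕ)) : ℕ :=
  (6 * 10 ^ 18 * x.1.length * (x.2.2 / x.2.1 + 1)) ^ k

/-- The initial state of the evaluation. -/
def initState (k : ℕ) (x : List (List ℕ) × (ℕ × ℕ)) : State :=
  ((x.1, vertices x.1), (rootTasks (vertices x.1) (budget k x) (vertices x.1) [], []))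

/-- The weight of the constant configuration `1`. -/
def edgeWeight (C : Context) : ℕ :=
  (C.2.map fun i => (C.2.map fun j => if i < j then entry C.1 i j + 1 else 1).prod).prod

/-- The approximation of the partition function, as a fraction. -/
def output (s : State) : ℕ × ℕ :=
  (edgeWeight s.1 * (s.2.2.map fun a => a.1 + a.2).prod, (s.2.2.map fun a => a.2).prod)

/-- The approximation algorithm. -/
def approximate (k : ℕ) (x : List (List ℕ) × (ℕ × ℕ)) : ℕ × ℕ := output (evalLoop (initState k x))

section

variable {α β : Type} [Enc α] [Enc β]

theorem FP.length {l : α → List β} (hl : FP l) : FP fun a => (l a).length := by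
  have := FP.sum_map (h := fun _ : ℕ × β => 1) (.const 1) (FP.const (α := α) 0) hl
  simpa using this

theorem FP.vertices : FP vertices := by
  have h1 : FP fun s : ℕ × (List ℕ × (ℕ × List ℕ)) =>
      (s.2.2.1 - 1, (s.1 - (s.1 - s.2.2.1) - 1) :: s.2.2.2) :=
    (FP.snd'.snd.fst.sub (.const 1)).pair
      (((FP.fst'.sub (FP.fst'.sub FP.snd'.snd.fst)).sub (.const 1)).cons FP.snd'.snd.snd)
  refine FP.snd (FP.foldl_of_growth h1 (h := fun s : ℕ × List ℕ => s.1) FP.fst' 1 (fun c x b => ?_)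
    (FP.length .id) FP.id ((FP.length .id).pair (.const [])))
  obtain ⟨k, l⟩ := b
  have h2 := Nat.size_le_size (Nat.sub_le k 1)
  -- The new entry equals k - 1 when 1 ≤ k ≤ c. Written as c - (c - k) - 1, it is bounded by the
  -- context c for every accumulator, as the growth condition of the fold demands.
  have h3 := Nat.size_le_size (show c - (c - k) - 1 ≤ c by omega)
  rw [sz_pair, sz_pair, sz_cons]
  simp only [sz_nat]
  omega

theorem FP.rootPath {idx : α → List ℕ} {i : α → ℕ} (hidx : FP idx) (hi : FP i) :
    FP fun a => rootPath (idx a) (i a) := by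
  have h1 : FP fun s : ℕ × (ℕ × List (ℕ × ℕ)) =>
      if s.2.1 < s.1 then (s.2.1, 0) :: s.2.2 else s.2.2 :=
    (FPred.lt FP.snd'.fst FP.fst').ite ((FP.snd'.fst.pair (.const 0)).cons FP.snd'.snd) FP.snd'.snd
  refine FP.foldl_of_growth h1 (h := fun s : ℕ × ℕ => (s.2, 0)) (FP.snd'.pair (.const 0)) 1
    (fun c x b => ?_) hi hidx (.const [])
  simp only
  split_ifs
  · rw [sz_cons]; omega
  · omega

theorem FP.budget (k : ℕ) : FP (budget k) :=
  (((FP.const (6 * 10 ^ 18)).mul (FP.length FP.fst')).mul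
    ((FP.snd'.snd.div FP.snd'.fst).add (.const 1))).pow k

theorem FP.initState (k : ℕ) : FP (initState k) := by
  have h1 : FP fun s : (List ℕ × ℕ) × (ℕ × List Task) =>
      some (LoopMachine.rootPath s.1.1 s.2.1, (s.2.1, s.1.2)) :: s.2.2 :=
    (((FP.rootPath FP.fst'.fst FP.snd'.fst).pair (FP.snd'.fst.pair FP.fst'.snd)).optSome).cons
      FP.snd'.snd
  have h2 : FP fun s : (List ℕ × ℕ) × ℕ =>
      (some (LoopMachine.rootPath s.1.1 s.2, (s.2, s.1.2)) : Task) :=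
    ((FP.rootPath FP.fst'.fst FP.snd').pair (FP.snd'.pair FP.fst'.snd)).optSome
  have hv : FP fun x : List (List ℕ) × (ℕ × ℕ) => LoopMachine.vertices x.1 := FP.vertices.comp FP.fst'
  refine (FP.fst'.pair hv).pair (FP.pair ?_ (.const []))
  refine FP.foldl_of_growth h1 h2 1 (fun c x b => ?_) (hv.pair (FP.budget k)) hv (.const [])
  simp only
  rw [sz_cons]; omega

theorem FP.edgeWeight : FP edgeWeight := by
  have h1 : FP fun s : (Context × ℕ) × ℕ =>
      if s.1.2 < s.2 then LoopMachine.entry s.1.1.1 s.1.2 s.2 + 1 else 1 :=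
    (FPred.lt FP.fst'.snd FP.snd').ite
      ((FP.entry FP.fst'.fst.fst FP.fst'.snd FP.snd').add (.const 1)) (.const 1)
  have h2 : FP fun s : Context × ℕ => (s.1.2.map fun j =>
      if s.2 < j then LoopMachine.entry s.1.1 s.2 j + 1 else 1).prod :=
    h1.prod_map FP.id FP.fst'.snd
  exact h2.prod_map FP.id FP.snd'

theorem FP.output : FP output :=
  ((FP.edgeWeight.comp FP.fst').mul (FP.prod_map (h := fun s : ℕ × (ℕ × ℕ) => s.2.1 + s.2.2)
    (FP.snd'.fst.add FP.snd'.snd) (FP.const 0) FP.snd'.snd)).pair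
    (FP.prod_map (h := fun s : ℕ × (ℕ × ℕ) => s.2.2) FP.snd'.snd (FP.const 0) FP.snd'.snd)

end

theorem mem_rootTasks {idx : List ℕ} {B : ℕ} {l : List ℕ} {todo : List Task} {t : Task}
    (h : t ∈ rootTasks idx B l todo) : (∃ i, t = some (rootPath idx i, (i, B))) ∨ t ∈ todo := by
  induction l generalizing todo with
  | nil => exact .inr h
  | cons i l ih =>
    rcases ih h with h | h
    · exact .inl h
    · rcases List.mem_cons.1 h with h | h
      · exact .inl ⟨i, h⟩
      · exact .inr h

/-- The budget is polynomial in ⌊1/ε⌋, which may be exponential in the bit length of ε; hence the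
extra parameter. -/
theorem polyTime_approximate (k : ℕ) : PolyTime (fun x => x.2.2 / x.2.1) (approximate k) := by
  refine FP.output.comp_polyTime (f := fun x => evalLoop (initState k x))
    (PolyTime.evalLoop.comp ((FP.initState k).polyTime _) ?_)
  obtain ⟨q, hq⟩ := (FP.initState k).sz_le
  let M : Polynomial ℕ := (Polynomial.C (6 * 10 ^ 18) * Polynomial.X * (Polynomial.X + 1)) ^ k
  refine ⟨q + q * (12 * ((q + 4 * q * (M + 1)) * (1 + 4 * q * M)) + 6) + 10, fun x => ?_⟩
  set m := sz x + x.2.2 / x.2.1 with hm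
  have h1 : sz (initState k x) ≤ q.eval m :=
    (hq x).trans (polynomial_eval_mono q (Nat.le_add_right _ _))
  have h2 : budget k x ≤ M.eval m := by
    have h3 : x.1.length ≤ m := by
      refine le_trans ?_ (Nat.le_add_right (sz x) _)
      have := length_le_sz x.1
      obtain ⟨A, y⟩ := x
      rw [sz_pair]
      simp only at this ⊢
      omega
    simp only [M, Polynomial.eval_pow, Polynomial.eval_mul, Polynomial.eval_C, Polynomial.eval_X,
      Polynomial.eval_add, Polynomial.eval_one, budget]
    gcongr
    omega
  have h4 := potential_le (x.1, vertices x.1)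
    (rootTasks (vertices x.1) (budget k x) (vertices x.1) []) (M.eval m) (q.eval m) h1
    (fun p v B hB => by
      rcases mem_rootTasks hB with ⟨i, h⟩ | h
      · simp only [Option.some.injEq, Prod.mk.injEq] at h
        rw [h.2.2]; exact h2
      · simp at h)
  refine h4.trans (le_of_eq ?_)
  simp only [Polynomial.eval_add, Polynomial.eval_mul, Polynomial.eval_one, Polynomial.eval_ofNat]

/-! ### Correctness -/

/-- The evaluation leads from one state to another. -/
def Reaches (s s' : State) : Prop := ∃ i, whileIter pending step i s = s'

theorem Reaches.refl (s : State) : Reaches s s := ⟨0, rfl⟩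

theorem Reaches.trans {s s' s'' : State} (h : Reaches s s') (h' : Reaches s' s'') :
    Reaches s s'' := by
  obtain ⟨i, rfl⟩ := h
  obtain ⟨j, rfl⟩ := h'
  exact ⟨i + j, whileIter_add _ _ _ _ _⟩

theorem Reaches.step {C : Context} {t : Task} {todo : List Task} {vals : List (ℕ × ℕ)} :
    Reaches (C, t :: todo, vals) (LoopMachine.step (C, t :: todo, vals)) :=
  ⟨1, by simp [whileIter, pending]⟩

section

variable {n : ℕ} (G : SimpleGraph (Fin n))

open Classical in
/-- The adjacency matrix. -/
noncomputable def rows : List (List ℕ) :=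
  (List.finRange n).map fun i => (List.finRange n).map fun j => if G.Adj i j then 1 else 0

theorem length_rows : (rows G).length = n := by simp [rows]

theorem encodeGraph_eq : encodeGraph G = enc (rows G) := by
  simp only [encodeGraph, rows, enc, List.map_map, Function.comp_def]

open Classical in
theorem rows_getD (v : Fin n) :
    (rows G).getD v [] = (List.finRange n).map fun j => if G.Adj v j then 1 else 0 := by
  rw [List.getD_eq_getElem _ _ (by simp [rows])]
  simp [rows]

open Classical in
theorem entry_rows (v w : Fin n) : entry (rows G) v w = if G.Adj v w then 1 else 0 := by
  rw [entry, rows_getD, List.getD_eq_getElem _ _ (by simp)]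
  simp

theorem vertices_foldl (N : ℕ) (A : List (List ℕ)) (l : List ℕ) (h : A.length ≤ N) :
    (A.foldl (fun (b : ℕ × List ℕ) _ => (b.1 - 1, (N - (N - b.1) - 1) :: b.2)) (A.length, l)).2 =
      List.range A.length ++ l := by
  induction A generalizing l with
  | nil => simp
  | cons a A ih =>
    rw [List.length_cons] at h
    rw [List.foldl_cons, List.length_cons, List.range_succ]
    have e1 : A.length + 1 - 1 = A.length := by omega
    have e2 : N - (N - (A.length + 1)) - 1 = A.length := by omega
    simp only [e1, e2]
    rw [ih _ (by omega)]
    simp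

theorem vertices_rows : vertices (rows G) = (List.finRange n).map Fin.val := by
  rw [vertices, vertices_foldl _ _ _ le_rfl, length_rows, List.append_nil]
  simp

theorem degree_eq (v : Fin n) :
    degree (rows G, (List.finRange n).map Fin.val) v = TwoSpin.deg G v := by
  classical
  rw [degree, TwoSpin.deg, Finset.card_filter, Fin.sum_univ_def, List.map_map]
  congr 1
  refine List.map_congr_left fun w _ => ?_
  simp only [Function.comp_apply, entry_rows]
  split_ifs <;> simp_all

/-- The fields after the deletions described by a path. -/
noncomputable def pathField (path : List (ℕ × ℕ)) (v : Fin n) : ℝ :=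
  TwoSpin.baseField G v *
    (path.map fun e => (scaleNum (rows G) v e : ℝ) / scaleDen (rows G) v e).prod

theorem scaleDen_pos (A : List (List ℕ)) (v : ℕ) (e : ℕ × ℕ) : 0 < scaleDen A v e := by
  rw [scaleDen]; split_ifs <;> norm_num

theorem pathField_cons (v w : Fin n) (path : List (ℕ × ℕ)) :
    pathField G (((v : ℕ), (w : ℕ)) :: path) = TwoSpin.pin G (pathField G path) v w := by
  classical
  funext j
  rw [pathField, List.map_cons, List.prod_cons, TwoSpin.pin, pathField]
  simp only [scaleNum, scaleDen, entry_rows, Fin.ext_iff]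
  by_cases h1 : (j : ℕ) = v
  · simp [h1]
  · by_cases h2 : G.Adj v j
    · by_cases h3 : (j : ℕ) < w
      · simp only [h1, h2, h3, if_true, if_false]; norm_num; ring
      · simp [h1, h2, h3]
    · simp [h1, h2]

theorem fieldFrac_eq (path : List (ℕ × ℕ)) (v : Fin n) : 0 < (fieldFrac (rows G) path v).2 ∧
    ((fieldFrac (rows G) path v).1 : ℝ) / (fieldFrac (rows G) path v).2 = pathField G path v := by
  classical
  have h1 : (((rows G).getD v []).map (· + 1)).prod = 2 ^ TwoSpin.deg G v := by
    rw [rows_getD, List.map_map, ← Fin.prod_univ_def, TwoSpin.deg, ← Finset.prod_const,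
      Finset.prod_filter]
    refine Finset.prod_congr rfl fun j _ => ?_
    simp only [Function.comp_apply]
    split_ifs <;> rfl
  have h2 : 0 < (path.map (scaleDen (rows G) v)).prod :=
    List.prod_pos fun x hx => by
      obtain ⟨e, -, rfl⟩ := List.mem_map.1 hx
      exact scaleDen_pos _ _ _
  have h3 : (path.map fun e => (scaleNum (rows G) v e : ℝ) / scaleDen (rows G) v e).prod =
      ((path.map (scaleNum (rows G) v)).prod : ℝ) / (path.map (scaleDen (rows G) v)).prod := by
    clear h2
    induction path with
    | nil => simp
    | cons e path ih =>
      simp only [List.map_cons, List.prod_cons, ih]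
      push_cast
      rw [div_mul_div_comm]
  rw [fieldFrac]
  simp only [h1]
  refine ⟨by positivity, ?_⟩
  rw [pathField, h3, TwoSpin.baseField, div_mul_div_comm]
  push_cast
  rfl

theorem mem_rootPath {idx : List ℕ} {i : ℕ} {e : ℕ × ℕ} :
    e ∈ rootPath idx i ↔ e.2 = 0 ∧ e.1 ∈ idx ∧ e.1 < i := by
  have key : ∀ (l : List ℕ) (p : List (ℕ × ℕ)),
      e ∈ l.foldl (fun l j => if j < i then (j, 0) :: l else l) p ↔
        (e.2 = 0 ∧ e.1 ∈ l ∧ e.1 < i) ∨ e ∈ p := by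
    intro l
    induction l with
    | nil => simp
    | cons j l ih =>
      intro p
      rw [List.foldl_cons, ih]
      obtain ⟨x, y⟩ := e
      by_cases hj : j < i
      · simp only [hj, if_true, List.mem_cons, Prod.mk.injEq]
        constructor
        · rintro (h | ⟨rfl, rfl⟩ | h)
          · exact .inl ⟨h.1, .inr h.2.1, h.2.2⟩
          · exact .inl ⟨rfl, .inl rfl, hj⟩
          · exact .inr h
        · rintro (⟨h1, h2 | h2, h3⟩ | h)
          · exact .inr (.inl ⟨h2, h1⟩)
          · exact .inl ⟨h1, h2, h3⟩
          · exact .inr (.inr h)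
      · simp only [hj, if_false, List.mem_cons]
        constructor
        · rintro (h | h)
          · exact .inl ⟨h.1, .inr h.2.1, h.2.2⟩
          · exact .inr h
        · rintro (⟨h1, h2 | h2, h3⟩ | h)
          · exact absurd (h2 ▸ h3) hj
          · exact .inl ⟨h1, h2, h3⟩
          · exact .inr h
  rw [rootPath, key]
  simp

theorem pathField_rootPath (i : ℕ) : pathField G (rootPath ((List.finRange n).map Fin.val) i) =
    TwoSpin.deleteBelow (TwoSpin.baseField G) i := by
  funext j
  rw [pathField, TwoSpin.deleteBelow]
  split_ifs with h
  · rw [List.prod_eq_zero, mul_zero]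
    refine List.mem_map.2 ⟨((j : ℕ), 0), mem_rootPath.2 ⟨rfl, ?_, h⟩, ?_⟩
    · exact List.mem_map.2 ⟨j, List.mem_finRange j, rfl⟩
    · simp [scaleNum]
  · rw [List.prod_eq_one, mul_one]
    intro x hx
    obtain ⟨e, he, rfl⟩ := List.mem_map.1 hx
    obtain ⟨h1, -, h2⟩ := mem_rootPath.1 he
    have h3 : (j : ℕ) ≠ e.1 := by omega
    simp [scaleNum, scaleDen, h3, h1]

theorem factor_div {a b : ℕ} (hb : 0 < b) :
    TwoSpin.factor ((a : ℝ) / b) = (6 * a + 5 * b) / (5 * a + 5 * b) := by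
  have hb' : (0 : ℝ) < b := by exact_mod_cast hb
  have ha' : (0 : ℝ) ≤ a := Nat.cast_nonneg a
  rw [TwoSpin.factor]
  have h1 : (a : ℝ) + b ≠ 0 := by positivity
  field_simp
  ring

/-- The evaluation of a task computes the value of the truncated recursion. -/
theorem reaches_eval (B : ℕ) (path : List (ℕ × ℕ)) (v : Fin n) (todo : List Task)
    (vals : List (ℕ × ℕ)) : ∃ a b : ℕ,
      Reaches ((rows G, (List.finRange n).map Fin.val), some (path, ((v : ℕ), B)) :: todo, vals)
        ((rows G, (List.finRange n).map Fin.val), todo, (a, b) :: vals) ∧ 0 < b ∧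
      (a : ℝ) / b = TwoSpin.interp G 1 B (pathField G path) v := by
  classical
  induction B using Nat.strong_induction_on generalizing path v todo vals with
  | _ B ih =>
    set C : Context := (rows G, (List.finRange n).map Fin.val) with hC
    obtain ⟨hpos, hval⟩ := fieldFrac_eq G path v
    set f := fieldFrac (rows G) path v with hf
    rcases eq_or_ne B 0 with rfl | hB
    · refine ⟨f.1, f.2, Reaches.step, hpos, ?_⟩
      rw [hval, TwoSpin.interp_zero_right]; ring
    · set B' := B / (2 * TwoSpin.deg G v) with hB'
      -- Tasks pushed later run first. The induction therefore lets the rest of the list run on top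
      -- of the two tasks of `w`, and then those tasks finish.
      have key : ∀ (l : List (Fin n)) (todo : List Task) (a b : ℕ), 0 < b → ∃ a' b' : ℕ,
          Reaches (C, (l.map Fin.val).foldl (fun l w => if entry (rows G) v w = 0 then l else
            some (((v : ℕ), w) :: path, (w, B')) :: none :: l) todo, (a, b) :: vals)
            (C, todo, (a', b') :: vals) ∧ 0 < b' ∧ (a' : ℝ) / b' = a / b * (l.map fun w =>
              if G.Adj v w then TwoSpin.factor (TwoSpin.interp G 1 B'
                (TwoSpin.pin G (pathField G path) v w) w) else 1).prod := by
        intro l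
        induction l with
        | nil => exact fun todo a b hb => ⟨a, b, Reaches.refl _, hb, by simp⟩
        | cons w l ihl =>
          intro todo a b hb
          rw [List.map_cons, List.foldl_cons, List.map_cons, List.prod_cons]
          by_cases h : G.Adj v w
          · have hne : ¬ entry (rows G) v w = 0 := by rw [entry_rows, if_pos h]; norm_num
            rw [if_neg hne, if_pos h]
            obtain ⟨a₁, b₁, hr₁, hb₁, hq₁⟩ := ihl
              (some (((v : ℕ), (w : ℕ)) :: path, ((w : ℕ), B')) :: none :: todo) a b hb
            obtain ⟨a₂, b₂, hr₂, hb₂, hq₂⟩ := ih B' (TwoSpin.div_budget_lt hB _)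
              (((v : ℕ), (w : ℕ)) :: path) w (none :: todo) ((a₁, b₁) :: vals)
            rw [pathField_cons] at hq₂
            refine ⟨_, _, (hr₁.trans hr₂).trans Reaches.step, ?_, ?_⟩
            · exact Nat.mul_pos hb₁ (by omega)
            · have hb₁' : (b₁ : ℝ) ≠ 0 := by exact_mod_cast hb₁.ne'
              rw [← hq₂, factor_div hb₂]
              push_cast
              rw [← div_mul_div_comm, hq₁]
              ring
          · have hne : entry (rows G) v w = 0 := by rw [entry_rows, if_neg h]
            rw [if_pos hne, if_neg h, one_mul]
            exact ihl todo a b hb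
      obtain ⟨a, b, hr, hb, hq⟩ := key (List.finRange n) todo f.1 f.2 hpos
      refine ⟨a, b, Reaches.step.trans ?_, hb, ?_⟩
      · rw [LoopMachine.step, if_neg hB, pushChildren, hC, degree_eq]
        exact hr
      · rw [hq, hval, TwoSpin.interp_of_ne 1 hB, Finset.prod_filter, Fin.prod_univ_def]

theorem reaches_roots (B : ℕ) (l : List (Fin n)) (todo : List Task) (vals : List (ℕ × ℕ))
    (hvals : 0 < (vals.map fun a => a.2).prod) : ∃ vals' : List (ℕ × ℕ),
      Reaches ((rows G, (List.finRange n).map Fin.val),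
        rootTasks ((List.finRange n).map Fin.val) B (l.map Fin.val) todo, vals)
        ((rows G, (List.finRange n).map Fin.val), todo, vals') ∧
      0 < (vals'.map fun a => a.2).prod ∧
      (((vals'.map fun a => a.1 + a.2).prod : ℕ) : ℝ) / ((vals'.map fun a => a.2).prod : ℕ) =
        (((vals.map fun a => a.1 + a.2).prod : ℕ) : ℝ) / ((vals.map fun a => a.2).prod : ℕ) *
          (l.map fun i : Fin n => 1 + TwoSpin.interp G 1 B
            (TwoSpin.deleteBelow (TwoSpin.baseField G) i) i).prod := by
  induction l generalizing todo with
  | nil => exact ⟨vals, Reaches.refl _, hvals, by simp⟩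
  | cons i l ih =>
    obtain ⟨vals₁, hr₁, hp₁, hq₁⟩ := ih
      (some (rootPath ((List.finRange n).map Fin.val) i, ((i : ℕ), B)) :: todo)
    obtain ⟨a, b, hr, hb, hq⟩ := reaches_eval G B
      (rootPath ((List.finRange n).map Fin.val) i) i todo vals₁
    refine ⟨(a, b) :: vals₁, hr₁.trans hr, ?_, ?_⟩
    · rw [List.map_cons, List.prod_cons]; exact Nat.mul_pos hb hp₁
    · have hb' : (b : ℝ) ≠ 0 := by exact_mod_cast hb.ne'
      rw [pathField_rootPath] at hq
      simp only [List.map_cons, List.prod_cons, Nat.cast_mul, Nat.cast_add]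
      rw [← hq, ← div_mul_div_comm, hq₁, add_div, div_self hb', add_comm (1 : ℝ)]
      ring

theorem edgeWeight_eq : edgeWeight (rows G, (List.finRange n).map Fin.val) =
    2 ^ TwoSpin.innerEdges G Finset.univ := by
  classical
  rw [edgeWeight, TwoSpin.innerEdges, ← Finset.prod_pow_eq_pow_sum, Fintype.prod_prod_type,
    Fin.prod_univ_def, List.map_map]
  congr 1
  refine List.map_congr_left fun i _ => ?_
  rw [Fin.prod_univ_def, Function.comp_apply, List.map_map]
  congr 1
  refine List.map_congr_left fun j _ => ?_
  simp only [Function.comp_apply, entry_rows, Finset.mem_univ, and_true, Fin.lt_def]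
  by_cases h : (i : ℕ) < j <;> by_cases h' : G.Adj i j <;> simp [h, h']

theorem approximate_rows (k p q : ℕ) : ∃ a b : ℕ, approximate k (rows G, (p, q)) = (a, b) ∧ 0 < b ∧
    (a : ℝ) / b = 2 ^ TwoSpin.innerEdges G Finset.univ * ∏ i : Fin n,
      (1 + TwoSpin.interp G 1 ((6 * 10 ^ 18 * n * (q / p + 1)) ^ k)
        (TwoSpin.deleteBelow (TwoSpin.baseField G) i) i) := by
  obtain ⟨vals, ⟨i, hr⟩, hp, hq⟩ := reaches_roots G ((6 * 10 ^ 18 * n * (q / p + 1)) ^ k)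
    (List.finRange n) [] [] (by simp)
  have h1 : evalLoop (initState k (rows G, (p, q))) =
      ((rows G, (List.finRange n).map Fin.val), [], vals) := by
    refine evalLoop_eq (i := i) (Eq.trans ?_ hr) rfl
    rw [initState, vertices_rows, budget, length_rows]
  refine ⟨_, _, by rw [approximate, h1, output], hp, ?_⟩
  · simp only [edgeWeight_eq]
    rw [Nat.cast_mul, mul_div_assoc, hq, Fin.prod_univ_def]
    simp

end

/-! ### The approximation scheme -/

theorem hasFPTAS_spinProblem : (spinProblem 0.6 2 1002762).HasFPTAS := by
  obtain ⟨k, hk0, hk⟩ := TwoSpin.exists_rate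
  obtain ⟨A, q, hA⟩ := polyTime_approximate k
  refine ⟨A, q, fun ⟨n, G⟩ ε hε => ?_⟩
  have hnum : 0 < ε.num.toNat := by
    have := Rat.num_pos.2 hε
    omega
  have hεeq : ε = (ε.num.toNat : ℚ) / ε.den := by
    have h1 : (ε.num.toNat : ℤ) = ε.num := Int.toNat_of_nonneg (Rat.num_pos.2 hε).le
    have h2 : ((ε.num.toNat : ℤ) : ℚ) = ε.num := by rw [h1]
    rw [Int.cast_natCast] at h2
    rw [h2, Rat.num_div_den]
  have hden : 0 < ε.den := ε.den_pos
  set p := ε.num.toNat with hp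
  set d := ε.den with hd
  obtain ⟨a, b, hab, hb, hval⟩ := approximate_rows G k p d
  obtain ⟨t, ht, hrun⟩ := hA (rows G, (p, d))
  have hinput : (spinProblem 0.6 2 1002762).input ⟨n, G⟩ ε = enc (rows G, (p, d)) := by
    change Data.pair (encodeGraph G) _ = _
    rw [encodeGraph_eq]
    rfl
  have hceil : d / p ≤ ⌈1 / ε⌉₊ := by
    have h1 : ((d / p : ℕ) : ℚ) ≤ 1 / ε := by
      rw [hεeq, one_div_div]
      exact Nat.cast_div_le
    exact_mod_cast h1.trans (Nat.le_ceil _)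
  refine ⟨a, b, t, ?_, ?_, hb, ?_⟩
  · rw [hinput]
    rw [hab] at hrun
    exact hrun
  · rw [hinput]
    exact ht.trans (polynomial_eval_mono q (Nat.add_le_add_left hceil _))
  -- The accuracy 1/N with N = ⌊1/ε⌋ + 1 is at most ε, and this N is the one built into `budget`.
  · have h1 := TwoSpin.abs_approx_sub_partitionFunction_le (G := G) hk0 hk
      (N := d / p + 1) (Nat.succ_pos _) rfl
    rw [← hval] at h1
    refine h1.trans (mul_le_mul_of_nonneg_right ?_ ?_)
    · have h2 : (ε : ℝ) = (p : ℝ) / d := by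
        conv_lhs => rw [hεeq]
        push_cast
        rfl
      have h3 : d ≤ p * (d / p + 1) := (Nat.lt_mul_div_succ d hnum).le
      rw [h2, div_le_div_iff₀ (by positivity) (by positivity), one_mul]
      exact_mod_cast h3
    · change 0 ≤ TwoSpin.partitionFunction 0.6 2 (fun _ => 1002762) G
      rw [TwoSpin.partitionFunction_eq]
      exact mul_nonneg (by positivity)
        (TwoSpin.subsetSum_pos fun i => (TwoSpin.baseField_pos i).le).le

end LoopMachine

theorem proposition4p1 :
    TwoSpin.criticalField 0.6 2 < 1002762 ∧
      (LoopMachine.spinProblem 0.6 2 1002762).HasFPTAS :=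
  ⟨TwoSpin.criticalField_lt, LoopMachine.hasFPTAS_spinProblem⟩
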